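/- Let $W$ be the Weyl group of type $E_6$, acting on the root lattice. Let $r_1,\dots,r_6$ be simple roots such that $r_1-r_2-r_3-r_4-r_5$ is a chain in the Dynkin diagram and $r_6$ is joined to $r_3$; let $r_0=-(r_1+2r_2+3r_3+2r_4+r_5+2r_6)$, and let $s_i$ be the reflection in $r_i$ ($0\le i\le 6$). Write $a^b=b^{-1}ab$, put $T=s_3^{s_2s_4s_6}$, let $u_1$ be the product of the (commuting) reflections in $r_0,\ r_3,\ r_2+r_3+r_4,\ r_1+r_2+r_3+r_4+r_5$, let $u_2$ be the product of the (commuting) reflections in $r_5,\ r_3,\ r_6+r_3+r_2,\ r_0+r_6+r_3+r_2+r_1$, and put $u_3=u_1u_2u_1$. A reflection of $k^n$ is an invertible linear map that fixes a hyperplane pointwise and has an eigenvector with eigenvalue $\ne 1$. A finite group is called a reflection group over a field $k$ (real if $k=\mathbb R$, complex if $k=\mathbb C$) if for some $n$ it is isomorphic to a subgroup of $GL_n(k)$ generated by reflections. $C_n$, $S_n$ are the cyclic and symmetric groups, $\mathcal D_4$ is the dihedral group of order $8$, $D\wr S_n=D^n\rtimes S_n$ is the permutation wreath product (and $C_2=S_2$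 in $D\wr C_2$), and $G_5,G_8,G_{25},G_{28}$ are Shephard–Todd groups, $G_{28}$ being the reflection group of type $F_4$. Then for each $w\in W$ the centraliser $Z_W(w)$ is an internal direct product of subgroups each of which is a reflection group over $\mathbb C$ or over $\mathbb F_3$. More precisely, the following 25 elements (with Carter's labels) represent each conjugacy class of $W$ exactly once, and the centraliser of each is the internal direct product of the listed subgroups, which have the listed isomorphism types. 1. $\emptyset$: $1$; $\langle s_1,\dots,s_6\rangle = W$. 2. $A_1$: $s_0$; $\langle s_0\rangle\times\langle s_1,\dots,s_5\rangle\cong C_2\times S_6$. 3. $A_1^2$: $s_0s_1$; $\langle s_0,u_2\rangle\times\langle s_3,s_4,s_5\rangle\cong \mathcal D_4\times S_4$. 4. $A_2$: $s_0s_6$; $\langle s_0s_6\rangle\times\langle s_1,s_2,u_1\rangle\cong C_3\times(S_3\wr C_2)$. 5. $A_1^3$: $s_0s_1s_5$; $\langle s_0,u_1,u_2\rangle\times\langle s_3\rangle\cong (C_2\wr S_3)\times C_2$. 6. $A_2\times A_1$: $s_0s_6s_1$; $\langle s_0s_6\rangle\times\langle s_1\rangle\times\langle s_4,s_5\rangle\cong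 C_3\times C_2\times S_3$. 7. $A_3$: $s_0s_6s_3$; $\langle s_0s_6s_3\rangle\times\langle s_1,u_1\rangle\cong C_4\times\mathcal D_4$. 8. $A_1^4$: $s_0s_1s_5s_3$; $\langle s_0,s_1,s_5,T,u_1,u_2\rangle\cong G_{28}$. 9. $A_2\times A_1^2$: $s_0s_6s_1s_5$; $\langle s_0s_6\rangle\times\langle s_1,u_1\rangle\cong C_3\times\mathcal D_4$. 10. $A_2^2$: $s_0s_6s_1s_2$; $\langle s_0s_6,u_2\rangle\times\langle s_4,s_5\rangle\cong (C_3\wr C_2)\times S_3$. 11. $A_3\times A_1$: $s_0s_6s_3s_1$; $\langle s_0s_6s_3\rangle\times\langle s_1\rangle\times\langle s_5\rangle\cong C_4\times C_2\times C_2$. 12. $A_4$: $s_0s_6s_3s_4$; $\langle s_0s_6s_3s_4\rangle\times\langle s_1\rangle\cong C_5\times C_2$. 13. $D_4$: $w=s_0s_1s_5T$; $\langle w\rangle\times\langle u_1,u_2\rangle\cong C_6\times S_3$. 14. $D_4[a_1]$: $s_1Ts_5s_0^T$; $\langle s_5u_3,\ s_5^Tu_1\rangle\cong G_8$. 15. $A_2^2\times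 A_1$: $s_0s_6s_5s_1s_2$; $\langle s_0s_6,u_2\rangle\times\langle s_5\rangle\cong (C_3\wr C_2)\times C_2$. 16. $A_3\times A_1^2$: $w=s_0s_6s_3s_1s_5$; $\langle w\rangle\times\langle s_1,T,s_5\rangle\cong C_4\times S_4$. 17. $A_4\times A_1$: $s_0s_6s_3s_4s_1$; $\langle s_0s_6s_3s_4\rangle\times\langle s_1\rangle\cong C_5\times C_2$. 18. $A_5$: $s_0s_6s_3s_4s_5$; $\langle s_0s_6s_3s_4s_5\rangle\times\langle s_1\rangle\cong C_6\times C_2$. 19. $D_5$: $w=s_0s_6s_3s_4s_3^{s_2s_4}$; $\langle w\rangle\cong C_8$. 20. $D_5[a_1]$: $w=s_0s_6s_3s_4T$; $\langle w\rangle\cong C_{12}$. 21. $A_2^3$: $s_0s_6s_1s_2s_5s_4$; $\langle s_0s_6,\ Ts_3,\ s_5s_4\rangle\cong G_{25}$. 22. $A_5\times A_1$: $w=s_0s_6s_3s_4s_5s_1$; $\langle w\rangle\times\langle s_1,T\rangle\cong C_6\times S_3$. 23. $E_6$: $w=s_1s_2s_3s_4s_5s_6$; $\langle w\rangle\cong C_{12}$.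 24. $E_6[a_1]$: $w=s_1s_2s_3s_4s_5s_6^{s_3}$; $\langle w\rangle\cong C_9$. 25. $E_6[a_2]$: $w=s_6s_2s_0^Ts_1^Ts_4s_3$; $\langle w^2\rangle\times\langle Ts_3,\ s_5s_4\rangle\cong C_3\times SL_2(3)$, and $Z_W(w)\cong G_5$. Moreover: - The factors containing some $u_i$ in cases 3, 4, 5, 7, 9, 10, 15 are internal wreath products, namely $\langle s_0,u_2\rangle=\langle s_0\rangle\wr\langle u_2\rangle$, $\langle s_1,s_2,u_1\rangle=\langle s_1,s_2\rangle\wr\langle u_1\rangle$, $\langle s_0,u_1,u_2\rangle=\langle s_0\rangle\wr_3\langle u_1,u_2\rangle$ (permuting three factors), $\langle s_1,u_1\rangle=\langle s_1\rangle\wr\langle u_1\rangle$ and $\langle s_0s_6,u_2\rangle=\langle s_0s_6\rangle\wr\langle u_2\rangle$. In case 8 the centraliser is the internal semidirect product $\langle s_0,s_1,s_5,T\rangle\rtimes\langle u_1,u_2\rangle$, with factors isomorphic to $W(D_4)$ and $S_3$. - All the listed direct factors are complex reflection groups, with the single exception of $\langle s_1,s_2,u_1\rangle\cong S_3\wr C_2$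 in the case $A_2$. This group is not a complex reflection group, but it is isomorphic to a subgroup of $GL_3(\mathbb F_3)$ generated by reflections. - In the cases where the representative has order $1$ or $2$, all the listed factors are real reflection groups. For $w\in W$, the group $Z_W(w)$ is a real reflection group if and only if $w^2=1$, and it is a complex reflection group if and only if $w$ is not conjugate to $s_0s_6$. -/

import Mathlib

open Matrix

noncomputable section

namespace E6

/-! ### Reflection groups -/

/-- A (semisimple) reflection of `kⁿ`: an invertible matrix that fixes the hyperplane `f = 0`
pointwise and multiplies a vector `v` outside that hyperplane by the scalar `1 + f ⬝ᵥ v ≠ 1`. -/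
def IsReflection {k : Type} [Field k] {n : ℕ} (g : GL (Fin n) k) : Prop :=
  ∃ f v : Fin n → k, f ⬝ᵥ v ≠ 0 ∧ (g : Matrix (Fin n) (Fin n) k) = 1 + vecMulVec v f

/-- The group `G` is isomorphic to a finite subgroup of `GLₙ(k)` generated by reflections. -/
def IsReflectionGroupOfRank (k : Type) [Field k] (n : ℕ) (G : Type) [Group G] : Prop :=
  Finite G ∧ ∃ ρ : G →* GL (Fin n) k,
    Function.Injective ρ ∧ Subgroup.closure {g : G | IsReflection (ρ g)} = ⊤

/-- `G` is a finite reflection group over the field `k` (of some rank). -/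
def IsReflectionGroup (k : Type) [Field k] (G : Type) [Group G] : Prop :=
  ∃ n : ℕ, IsReflectionGroupOfRank k n G

/-- The unitary reflection of `ℂⁿ` that multiplies `a` by `ζ` and fixes the orthogonal complement
of `a` with respect to the standard Hermitian form. -/
def unitaryReflection {n : ℕ} (a : Fin n → ℂ) (ζ : ℂ) : Matrix (Fin n) (Fin n) ℂ :=
  1 - ((1 - ζ) / (star a ⬝ᵥ a)) • vecMulVec a (star a)

/-- The group generated by the unitary reflections of order `m` (with eigenvalue `exp(2πi/m)`)
in the given vectors. -/
def unitaryReflectionGroup {n : ℕ} (m : ℕ) (roots : Set (Fin n → ℂ)) : Subgroup (GL (Fin n) ℂ) :=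
  Subgroup.closure {g | ∃ a ∈ roots, (g : Matrix (Fin n) (Fin n) ℂ) =
    unitaryReflection a (Complex.exp (2 * Real.pi * Complex.I / m))}

/-- The Shephard–Todd group `G₅` (order 72): two reflections `s, t` of order 3
with `stst = tsts`. -/
def G5 : Subgroup (GL (Fin 2) ℂ) :=
  unitaryReflectionGroup 3 {![1, 0], ![(Real.sqrt 2 : ℂ), 1]}

/-- The Shephard–Todd group `G₈` (order 96): two reflections `s, t` of order 4
with `sts = tst`. -/
def G8 : Subgroup (GL (Fin 2) ℂ) :=
  unitaryReflectionGroup 4 {![0, 1], ![1, -1]}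

/-- The Shephard–Todd group `G₂₅` (order 648): three reflections `s, t, u` of order 3
with `sts = tst`, `tut = utu`, `su = us`. -/
def G25 : Subgroup (GL (Fin 3) ℂ) :=
  unitaryReflectionGroup 3 {![1, 0, 0], ![1, 1, 1], ![0, 0, 1]}

/-- The Shephard–Todd group `G₂₈` (order 1152): the complexified reflection group of type `F₄`,
generated by the reflections of order 2 in a set of simple roots. -/
def G28 : Subgroup (GL (Fin 4) ℂ) :=
  unitaryReflectionGroup 2 {![0, 1, -1, 0], ![0, 0, 1, -1], ![0, 0, 0, 1], ![1, -1, -1, -1]}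

/-! ### Products of groups -/

/-- The subgroup `Z` is the internal direct product of the subgroups `H i` (finitely many). -/
def IsInternalDirectProduct {G : Type} [Group G] {m : ℕ} (H : Fin m → Subgroup G)
    (Z : Subgroup G) : Prop :=
  ∃ e : (∀ i, H i) ≃* Z, ∀ (i : Fin m) (x : H i), (e (Pi.mulSingle i x) : G) = x

/-- The subgroup `Z` is the internal semidirect product `N ⋊ K`. -/
def IsInternalSemidirectProduct {G : Type} [Group G] (N K Z : Subgroup G) : Prop :=
  K ≤ Subgroup.normalizer (N : Set G) ∧ Disjoint N K ∧ N ⊔ K = Z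

/-- The permutation wreath product `D ≀ Sₙ = Dⁿ ⋊ Sₙ`. -/
abbrev Wreath (D : Type) [Group D] (n : ℕ) : Type :=
  (Fin n → D) ⋊[mulAutArrow] Equiv.Perm (Fin n)

/-- The subgroup `Z` is the internal permutation wreath product `A ≀ Q`, where `Q` acts by
conjugation on `n` direct factors, one of which is `A`, as the full symmetric group on them. -/
def IsInternalWreathProduct {G : Type} [Group G] (n : ℕ) [NeZero n] (A Q Z : Subgroup G) : Prop :=
  ∃ e : Wreath A n ≃* Z,
    (∀ a : A, (e (SemidirectProduct.inl (Pi.mulSingle 0 a)) : G) = a) ∧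
    (∀ g : G, g ∈ Q ↔ ∃ σ : Equiv.Perm (Fin n), (e (SemidirectProduct.inr σ) : G) = g)

/-! ### Weyl groups -/

/-- The Weyl group of a Cartan matrix `A`, acting on the root lattice in coordinates with respect
to the simple roots: it is generated by the simple reflections `αⱼ ↦ αⱼ - A i j • αᵢ`. -/
def weylGroup {n : ℕ} (A : Matrix (Fin n) (Fin n) ℤ) : Subgroup (GL (Fin n) ℤ) :=
  Subgroup.closure {g | ∃ i : Fin n, (g : Matrix (Fin n) (Fin n) ℤ) =
    1 - vecMulVec (Pi.single i 1) (A i)}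

/-- The Cartan matrix of type `E₆`, with simple roots ordered so that `r₁ — r₂ — r₃ — r₄ — r₅` is a
chain in the Dynkin diagram and `r₆` is joined to `r₃`. -/
def cartanE6 : Matrix (Fin 6) (Fin 6) ℤ :=
  CartanMatrix.E₆.submatrix ![0, 2, 3, 4, 5, 1] ![0, 2, 3, 4, 5, 1]

/-- The Weyl group of type `E₆`. -/
abbrev W : Type := weylGroup cartanE6

/-- The reflection `x ↦ x - (r, x) r` of the root lattice in a root `r`, that is, `(r, r) = 2`. -/
def rootReflection (r : Fin 6 → ℤ) (hr : r ⬝ᵥ cartanE6 *ᵥ r = 2) : GL (Fin 6) ℤ :=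
  have h : (1 - vecMulVec r (cartanE6 *ᵥ r)) * (1 - vecMulVec r (cartanE6 *ᵥ r)) = 1 := by
    have h2 : (cartanE6 *ᵥ r) ⬝ᵥ r = 2 := by rw [dotProduct_comm]; exact hr
    have : vecMulVec r (cartanE6 *ᵥ r) * vecMulVec r (cartanE6 *ᵥ r)
        = (2 : ℤ) • vecMulVec r (cartanE6 *ᵥ r) := by
      rw [vecMulVec_mul_vecMulVec, h2, vecMulVec_smul]
    rw [mul_sub, sub_mul, sub_mul, this, one_mul, mul_one, one_mul, two_smul]
    abel
  ⟨1 - vecMulVec r (cartanE6 *ᵥ r), 1 - vecMulVec r (cartanE6 *ᵥ r), h, h⟩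

theorem single_norm (i : Fin 6) :
    (Pi.single i 1 : Fin 6 → ℤ) ⬝ᵥ cartanE6 *ᵥ (Pi.single i 1) = 2 := by
  revert i; decide

/-- The reflection in the `i`-th simple root (counted from `0`). -/
def simpleReflection (i : Fin 6) : GL (Fin 6) ℤ := rootReflection (Pi.single i 1) (single_norm i)

theorem cartanE6_mulVec_single (i j : Fin 6) :
    (cartanE6 *ᵥ Pi.single i 1) j = cartanE6 i j := by
  rw [mulVec_single_one]
  have h : cartanE6ᵀ = cartanE6 := by decide
  exact congrFun (congrFun h i) j

theorem simpleReflection_mem (i : Fin 6) : simpleReflection i ∈ weylGroup cartanE6 := by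
  refine Subgroup.subset_closure ⟨i, ?_⟩
  change 1 - vecMulVec _ _ = 1 - vecMulVec _ _
  congr 2
  funext j
  exact cartanE6_mulVec_single i j

theorem rootReflection_mem (l : List (Fin 6)) (r : Fin 6 → ℤ) (hr : r ⬝ᵥ cartanE6 *ᵥ r = 2)
    (h : 1 - vecMulVec r (cartanE6 *ᵥ r) = (l.map fun i =>
      (1 : Matrix (Fin 6) (Fin 6) ℤ) -
        vecMulVec (Pi.single i 1) (cartanE6 *ᵥ (Pi.single i 1))).prod) :
    rootReflection r hr ∈ weylGroup cartanE6 := by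
  have : rootReflection r hr = (l.map simpleReflection).prod := by
    apply Units.ext
    rw [← Units.coeHom_apply, ← Units.coeHom_apply, map_list_prod, List.map_map]
    exact h
  rw [this]
  refine Subgroup.list_prod_mem _ fun x hx => ?_
  obtain ⟨i, -, rfl⟩ := List.mem_map.1 hx
  exact simpleReflection_mem i

/-! ### The elements of `W` that occur in the table

`s i` for `1 ≤ i ≤ 6` is the simple reflection in `rᵢ`, and `s 0` is the reflection in
`r₀ = -(r₁ + 2r₂ + 3r₃ + 2r₄ + r₅ + 2r₆)`, the negative of the highest root. -/

/-- The reflections `s₀, s₁, …, s₆`. -/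
def s : Fin 7 → W :=
  Fin.cons
    ⟨rootReflection ![-1, -2, -3, -2, -1, -2] (by decide),
      rootReflection_mem [5, 2, 3, 1, 2, 5, 4, 3, 2, 1, 0, 1, 2, 3, 4, 5, 2, 1, 3, 2, 5] _ _
        (by decide +kernel)⟩
    (fun i => ⟨simpleReflection i, simpleReflection_mem i⟩)

/-- Conjugation `a ^ b = b⁻¹ a b`. -/
def cj (a b : W) : W := b⁻¹ * a * b

/-- `T = s₃ ^ (s₂ s₄ s₆)`, the reflection in the root `r_T = -(r₂ + r₃ + r₄ + r₆)`. -/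
def T : W := cj (s 3) (s 2 * s 4 * s 6)

/-- `u₁`, the product of the commuting reflections in the roots
`r₀`, `r₃`, `r₂ + r₃ + r₄`, `r₁ + r₂ + r₃ + r₄ + r₅`. -/
def u₁ : W :=
  s 0 * s 3 *
    ⟨rootReflection ![0, 1, 1, 1, 0, 0] (by decide),
      rootReflection_mem [3, 2, 1, 2, 3] _ _ (by decide +kernel)⟩ *
    ⟨rootReflection ![1, 1, 1, 1, 1, 0] (by decide),
      rootReflection_mem [4, 3, 2, 1, 0, 1, 2, 3, 4] _ _ (by decide +kernel)⟩

/-- `u₂`, the product of the commuting reflections in the roots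
`r₅`, `r₃`, `r₆ + r₃ + r₂`, `r₀ + r₆ + r₃ + r₂ + r₁ = -(r₂ + 2r₃ + 2r₄ + r₅ + r₆)`. -/
def u₂ : W :=
  s 5 * s 3 *
    ⟨rootReflection ![0, 1, 1, 0, 0, 1] (by decide),
      rootReflection_mem [5, 2, 1, 2, 5] _ _ (by decide +kernel)⟩ *
    ⟨rootReflection ![0, -1, -2, -2, -1, -1] (by decide),
      rootReflection_mem [3, 2, 5, 4, 3, 2, 1, 2, 3, 4, 5, 2, 3] _ _ (by decide +kernel)⟩

/-- `u₃ = u₁ u₂ u₁`. -/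
def u₃ : W := u₁ * u₂ * u₁

/-! ### Conjugacy classes, representatives and centralisers -/

/-- Carter's labels of the 25 conjugacy classes of `W`; for instance `cA2A1A1` stands for
`A₂ × A₁²`, and `cD4a1` for `D₄[a₁]`. -/
inductive CarterType : Type
  | c1
  | cA1
  | cA1A1
  | cA2
  | cA1A1A1
  | cA2A1
  | cA3
  | cA1A1A1A1
  | cA2A1A1
  | cA2A2
  | cA3A1
  | cA4
  | cD4
  | cD4a1
  | cA2A2A1
  | cA3A1A1
  | cA4A1
  | cA5
  | cD5
  | cD5a1
  | cA2A2A2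
  | cA5A1
  | cE6
  | cE6a1
  | cE6a2

/-- The chosen representative of each conjugacy class. -/
def rep : CarterType → W
  | .c1 => 1
  | .cA1 => s 0
  | .cA1A1 => s 0 * s 1
  | .cA2 => s 0 * s 6
  | .cA1A1A1 => s 0 * s 1 * s 5
  | .cA2A1 => s 0 * s 6 * s 1
  | .cA3 => s 0 * s 6 * s 3
  | .cA1A1A1A1 => s 0 * s 1 * s 5 * s 3
  | .cA2A1A1 => s 0 * s 6 * s 1 * s 5
  | .cA2A2 => s 0 * s 6 * s 1 * s 2
  | .cA3A1 => s 0 * s 6 * s 3 * s 1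
  | .cA4 => s 0 * s 6 * s 3 * s 4
  | .cD4 => s 0 * s 1 * s 5 * T
  | .cD4a1 => s 1 * T * s 5 * cj (s 0) T
  | .cA2A2A1 => s 0 * s 6 * s 5 * s 1 * s 2
  | .cA3A1A1 => s 0 * s 6 * s 3 * s 1 * s 5
  | .cA4A1 => s 0 * s 6 * s 3 * s 4 * s 1
  | .cA5 => s 0 * s 6 * s 3 * s 4 * s 5
  | .cD5 => s 0 * s 6 * s 3 * s 4 * cj (s 3) (s 2 * s 4)
  | .cD5a1 => s 0 * s 6 * s 3 * s 4 * T
  | .cA2A2A2 => s 0 * s 6 * s 1 * s 2 * s 5 * s 4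
  | .cA5A1 => s 0 * s 6 * s 3 * s 4 * s 5 * s 1
  | .cE6 => s 1 * s 2 * s 3 * s 4 * s 5 * s 6
  | .cE6a1 => s 1 * s 2 * s 3 * s 4 * s 5 * cj (s 6) (s 3)
  | .cE6a2 => s 6 * s 2 * cj (s 0) T * cj (s 1) T * s 4 * s 3

/-- The subgroup of `W` generated by a set. -/
abbrev gp (S : Set W) : Subgroup W := Subgroup.closure S

/-- The cyclic group of order `n`. -/
abbrev Cyc (n : ℕ) : Type := Multiplicative (ZMod n)

/-- The symmetric group on `n` letters. -/
abbrev SymGrp (n : ℕ) : Type := Equiv.Perm (Fin n)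

/-- A direct factor of a centraliser: a subgroup of `W`, with the group to which it is claimed to be
isomorphic. -/
structure Factor where
  sub : Subgroup W
  Model : Type
  [grp : Group Model]

attribute [instance] Factor.grp

/-- The table of the direct factors of the centralisers of the representatives: generators
and isomorphism type of each factor. -/
def factors : CarterType → List Factor
  | .c1 => [⟨gp {s 1, s 2, s 3, s 4, s 5, s 6}, W⟩]
  | .cA1 => [⟨gp {s 0}, Cyc 2⟩, ⟨gp {s 1, s 2, s 3, s 4, s 5}, SymGrp 6⟩]
  | .cA1A1 => [⟨gp {s 0, u₂}, DihedralGroup 4⟩, ⟨gp {s 3, s 4, s 5}, SymGrp 4⟩]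
  | .cA2 => [⟨gp {s 0 * s 6}, Cyc 3⟩, ⟨gp {s 1, s 2, u₁}, Wreath (SymGrp 3) 2⟩]
  | .cA1A1A1 => [⟨gp {s 0, u₁, u₂}, Wreath (Cyc 2) 3⟩, ⟨gp {s 3}, Cyc 2⟩]
  | .cA2A1 => [⟨gp {s 0 * s 6}, Cyc 3⟩, ⟨gp {s 1}, Cyc 2⟩, ⟨gp {s 4, s 5}, SymGrp 3⟩]
  | .cA3 => [⟨gp {s 0 * s 6 * s 3}, Cyc 4⟩, ⟨gp {s 1, u₁}, DihedralGroup 4⟩]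
  | .cA1A1A1A1 => [⟨gp {s 0, s 1, s 5, T, u₁, u₂}, G28⟩]
  | .cA2A1A1 => [⟨gp {s 0 * s 6}, Cyc 3⟩, ⟨gp {s 1, u₁}, DihedralGroup 4⟩]
  | .cA2A2 => [⟨gp {s 0 * s 6, u₂}, Wreath (Cyc 3) 2⟩, ⟨gp {s 4, s 5}, SymGrp 3⟩]
  | .cA3A1 => [⟨gp {s 0 * s 6 * s 3}, Cyc 4⟩, ⟨gp {s 1}, Cyc 2⟩, ⟨gp {s 5}, Cyc 2⟩]
  | .cA4 => [⟨gp {s 0 * s 6 * s 3 * s 4}, Cyc 5⟩, ⟨gp {s 1}, Cyc 2⟩]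
  | .cD4 => [⟨gp {rep .cD4}, Cyc 6⟩, ⟨gp {u₁, u₂}, SymGrp 3⟩]
  | .cD4a1 => [⟨gp {s 5 * u₃, cj (s 5) T * u₁}, G8⟩]
  | .cA2A2A1 => [⟨gp {s 0 * s 6, u₂}, Wreath (Cyc 3) 2⟩, ⟨gp {s 5}, Cyc 2⟩]
  | .cA3A1A1 => [⟨gp {rep .cA3A1A1}, Cyc 4⟩, ⟨gp {s 1, T, s 5}, SymGrp 4⟩]
  | .cA4A1 => [⟨gp {s 0 * s 6 * s 3 * s 4}, Cyc 5⟩, ⟨gp {s 1}, Cyc 2⟩]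
  | .cA5 => [⟨gp {s 0 * s 6 * s 3 * s 4 * s 5}, Cyc 6⟩, ⟨gp {s 1}, Cyc 2⟩]
  | .cD5 => [⟨gp {rep .cD5}, Cyc 8⟩]
  | .cD5a1 => [⟨gp {rep .cD5a1}, Cyc 12⟩]
  | .cA2A2A2 => [⟨gp {s 0 * s 6, T * s 3, s 5 * s 4}, G25⟩]
  | .cA5A1 => [⟨gp {rep .cA5A1}, Cyc 6⟩, ⟨gp {s 1, T}, SymGrp 3⟩]
  | .cE6 => [⟨gp {rep .cE6}, Cyc 12⟩]
  | .cE6a1 => [⟨gp {rep .cE6a1}, Cyc 9⟩]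
  | .cE6a2 => [⟨gp {rep .cE6a2 ^ 2}, Cyc 3⟩,
      ⟨gp {T * s 3, s 5 * s 4}, SpecialLinearGroup (Fin 2) (ZMod 3)⟩]

end E6

end

open E6

namespace E6

/-! ### The action of `W` on the 27 minuscule weights -/

/-! `W` acts faithfully on the 27 minuscule weights, and preserves whether two weights are equal,
have inner product 1/3, or have inner product -2/3. An element is stored as a permutation written as
one number in base 32, so a relation between words in `s 0, …, s 6` is an equality of numbers
(`word_eq_word`), and an element that fixes a `rigid` set of weights is trivial (`eq_one_of_rigid`).

Each centraliser is squeezed between two bounds. An element that commutes with `w` preserves the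
relative positions of whole `w`-orbits, which bounds its orbits along a base of weights from above.
Explicit words in the listed generators produce orbits, which bound the order of the generated
subgroup from below. When the bounds agree, the generators and the order are both known
(`centralizer_eq_closure`). The representatives are pairwise non-conjugate because the traces of
their first four powers differ, and there are no further classes because the class lengths already
add up to the order of `W` (`exists_isConj`). Commuting factors that generate the centraliser, and
whose orders multiply to its order, form an internal direct product.

Symmetric groups and `SL₂(3)` are recognised by their actions on sets of weights
(`wordClosure_mulEquiv_of_check`), wreath products by `isInternalWreathProduct`. For `A₁⁴`,
`D₄[a₁]`, `A₂³` and `E₆[a₂]` the situation is that of Springer's regular elements: the centraliser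
acts faithfully on an eigenspace of `w`, as a reflection group. The lemma `exists_mulEquiv_GL`
matches this action with `G28`, `G8`, `G25`, `G5` in coordinates over the rational, Gaussian or
Eisenstein integers.

Cyclic groups, symmetric groups and wreath products with cyclic base are reflection groups through
monomial matrices, and direct products through block sums. The group `S₃ ≀ C₂` consists of affine
maps of the plane over the field of three elements, hence of 3 × 3 matrices over that field. Over
the reals a central element multiplies every root by a real root of unity, so its square is trivial
(`pow_eq_one_of_isReflectionGroup_real`). Over the complex numbers, a reflection and its nontrivial
powers have the same centraliser. In `C₃ × (S₃ ≀ C₂)` this forces the transpositions of a factor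
`S₃` and the interchange of the two factors to be reflections, which is impossible
(`not_isReflection_of_swap`). -/

/-- The 27 weights of the minuscule representation, in coordinates dual to the simple roots. -/
def wt : Fin 27 → Fin 6 → ℤ := ![![1, 0, 0, 0, 0, 0], ![1, 0, 0, 0, 0, -1], ![1, 0, -1, 0, 0, 1],
  ![1, -1, 1, -1, 0, 0], ![1, -1, 0, 1, -1, 0], ![1, -1, 0, 0, 1, 0],
  ![0, 1, 0, -1, 0, 0], ![0, 1, -1, 1, -1, 0], ![0, 1, -1, 0, 1, 0],
  ![0, 0, 1, 0, -1, -1], ![0, 0, 1, -1, 1, -1], ![0, 0, 0, 1, 0, -1],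
  ![0, 0, 0, 0, -1, 1], ![0, 0, 0, 0, -1, 0], ![0, 0, 0, -1, 1, 1],
  ![0, 0, 0, -1, 1, 0], ![0, 0, -1, 1, 0, 1], ![0, 0, -1, 1, 0, 0],
  ![0, -1, 1, 0, 0, 0], ![0, -1, 1, 0, 0, -1], ![0, -1, 0, 0, 0, 1],
  ![-1, 1, 0, 0, 0, 0], ![-1, 1, 0, 0, 0, -1], ![-1, 1, -1, 0, 0, 1],
  ![-1, 0, 1, -1, 0, 0], ![-1, 0, 0, 1, -1, 0], ![-1, 0, 0, 0, 1, 0]]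

/-- The `j`-th entry of a self-map of `{0, …, 26}` that is encoded in base 32. -/
def look (t j : ℕ) : ℕ := (t >>> (5 * j)) % 32

/-- The codes of the permutations of the weights induced by the reflections `s i`. -/
def reflectionCode : Fin 7 → ℕ := ![36485633589001097553035897803975925270529,
  6979860606819184490889193708298683834069,
  36485506219432708139671911914447091992608,
  36484347156846365743251181324006083071008,
  36444428778679494530746699219638882011168,
  35167040674730270010228267895990441314336,
  36485594605020210420751842828176372892736]

/-- The Gram matrix of the weights, encoded in base 2 (distinct weights have inner product `1/3`
or `-2/3`). -/
def incidenceCode : ℕ :=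
  1411732963086666032931910730451295500313545962004704184511940435049651036880137589592658789023674868765453236014284058679648560951277271789914493458883409681621218705499219173639217610325731261338736308299799904003645438

/-- `1` if the weights with numbers `j` and `k` have inner product `1/3`, and `0` otherwise. -/
def inc (j k : ℕ) : ℕ := (incidenceCode >>> (27 * j + k)) % 2

/-- A reflection is an involution, so the same code serves as its own inverse. -/
def reflectionPerm (i : Fin 7) : Equiv.Perm (Fin 27) where
  toFun j := Fin.ofNat 27 (look (reflectionCode i) j)
  invFun j := Fin.ofNat 27 (look (reflectionCode i) j)
  left_inv := by revert i; decide +kernel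
  right_inv := by revert i; decide +kernel

theorem reflectionPerm_val (i : Fin 7) (j : Fin 27) :
    (reflectionPerm i j : ℕ) = look (reflectionCode i) j := by
  revert i j; decide +kernel

/-- The matrix of an element of `W`. -/
def mat : W →* Matrix (Fin 6) (Fin 6) ℤ := (Units.coeHom _).comp (weylGroup cartanE6).subtype

theorem mat_injective : Function.Injective mat := fun _ _ h => Subtype.ext (Units.ext h)

/-- Weights are linear forms, and matrices act on them from the right. Moving the permutation to the
other side of the equation makes it act by `λ ↦ λ ∘ x⁻¹`, which is a left action. -/
theorem wt_reflectionPerm (i : Fin 7) (j : Fin 27) :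
    wt (reflectionPerm i j) ᵥ* mat (s i) = wt j := by
  revert i j; decide +kernel

theorem inc_reflectionPerm (i : Fin 7) (j k : Fin 27) :
    inc (reflectionPerm i j) (reflectionPerm i k) = inc j k := by
  revert i j k; decide +kernel

theorem wt_injective : Function.Injective wt := by
  have h : ∀ j k, wt j = wt k → j = k := by decide +kernel
  exact fun j k => h j k

theorem closure_simpleReflections : Subgroup.closure (Set.range fun i : Fin 6 => s i.succ) = ⊤ := by
  rw [eq_top_iff]
  rintro ⟨x, hx⟩ -
  refine Subgroup.closure_induction (p := fun x hx =>
    (⟨x, hx⟩ : W) ∈ Subgroup.closure (Set.range fun i : Fin 6 => s i.succ)) ?_ ?_ ?_ ?_ hx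
  · rintro g ⟨i, hi⟩
    refine Subgroup.subset_closure ⟨i, Subtype.ext (Units.ext ?_)⟩
    rw [hi]
    change 1 - vecMulVec _ _ = 1 - vecMulVec _ _
    congr 2
    funext j
    exact cartanE6_mulVec_single i j
  · exact one_mem _
  · exact fun x y hx hy h1 h2 => mul_mem h1 h2
  · exact fun x hx h => inv_mem h

/-- The property holds for simple reflections and passes to products and inverses. Since the weights
are distinct, the permutation is unique, which is why choosing it gives a homomorphism. -/
theorem exists_perm (x : W) : ∃ σ : Equiv.Perm (Fin 27),
    (∀ j, wt (σ j) ᵥ* mat x = wt j) ∧ ∀ j k : Fin 27, inc (σ j) (σ k) = inc j k := by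
  have hx : x ∈ Subgroup.closure (Set.range fun i : Fin 6 => s i.succ) := by
    rw [closure_simpleReflections]; trivial
  induction hx using Subgroup.closure_induction with
  | mem x hx =>
    obtain ⟨i, rfl⟩ := hx
    exact ⟨reflectionPerm i.succ, wt_reflectionPerm _, inc_reflectionPerm _⟩
  | one => exact ⟨1, fun j => by simp, fun j k => rfl⟩
  | mul x y _ _ hx hy =>
    obtain ⟨σ, h1, h2⟩ := hx
    obtain ⟨τ, h3, h4⟩ := hy
    refine ⟨σ * τ, fun j => ?_, fun j k => ?_⟩
    · rw [map_mul, ← vecMul_vecMul, Equiv.Perm.mul_apply, h1, h3]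
    · simp only [Equiv.Perm.mul_apply, h2, h4]
  | inv x _ hx =>
    obtain ⟨σ, h1, h2⟩ := hx
    have hσ : ∀ k, σ (σ⁻¹ k) = k := σ.apply_symm_apply
    refine ⟨σ⁻¹, fun j => ?_, fun j k => ?_⟩
    · have := h1 (σ⁻¹ j)
      rw [hσ] at this
      rw [← this, vecMul_vecMul, ← map_mul, mul_inv_cancel, map_one, vecMul_one]
    · have := h2 (σ⁻¹ j) (σ⁻¹ k)
      simpa only [hσ] using this.symm

theorem vecMul_mat_injective (x : W) : Function.Injective fun v : Fin 6 → ℤ => v ᵥ* mat x := by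
  intro v w h
  have h' := congrArg (fun u => u ᵥ* mat x⁻¹) h
  simpa only [vecMul_vecMul, ← map_mul, mul_inv_cancel, map_one, vecMul_one] using h'

/-- The permutation action of `W` on the 27 weights. -/
noncomputable def weightPerm : W →* Equiv.Perm (Fin 27) :=
  MonoidHom.mk' (fun x => (exists_perm x).choose) fun x y => by
    ext j
    congr 1
    refine wt_injective (vecMul_mat_injective (x * y) ?_)
    change wt _ ᵥ* mat (x * y) = wt _ ᵥ* mat (x * y)
    rw [(exists_perm (x * y)).choose_spec.1, map_mul, ← vecMul_vecMul, Equiv.Perm.mul_apply,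
      (exists_perm x).choose_spec.1, (exists_perm y).choose_spec.1]

theorem wt_weightPerm (x : W) (j : Fin 27) : wt (weightPerm x j) ᵥ* mat x = wt j :=
  (exists_perm x).choose_spec.1 j

theorem inc_weightPerm (x : W) (j k : Fin 27) :
    inc (weightPerm x j) (weightPerm x k) = inc j k :=
  (exists_perm x).choose_spec.2 j k

theorem weightPerm_s (i : Fin 7) : weightPerm (s i) = reflectionPerm i := by
  ext j
  congr 1
  refine wt_injective (vecMul_mat_injective (s i) ?_)
  change wt _ ᵥ* mat (s i) = wt _ ᵥ* mat (s i)
  rw [wt_weightPerm, wt_reflectionPerm]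

theorem weightPerm_injective : Function.Injective weightPerm := by
  rw [injective_iff_map_eq_one]
  intro x hx
  -- These six weights form a basis of the weight lattice, and `N` is the integral inverse of their
  -- coordinate matrix. An element that fixes them has matrix 1.
  let J : Fin 6 → Fin 27 := ![0, 1, 2, 3, 4, 8]
  let N : Matrix (Fin 6) (Fin 6) ℤ := ![![1, 0, 0, 0, 0, 0], ![2, 0, 0, -1, -1, -1],
    ![2, -1, -1, 0, 0, 0], ![1, -1, -1, 0, 1, 1], ![0, -1, -1, 1, 1, 2], ![1, -1, 0, 0, 0, 0]]
  have hN : N * Matrix.of (fun i => wt (J i)) = 1 := by decide +kernel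
  have h : Matrix.of (fun i => wt (J i)) * mat x = Matrix.of fun i => wt (J i) := by
    funext i
    have := wt_weightPerm x (J i)
    rw [hx] at this
    exact this
  refine mat_injective ?_
  rw [map_one, ← one_mul (mat x), ← hN, mul_assoc, h]

/-! ### Codes of elements -/

/-- `t` encodes the permutation of the weights induced by `x`. -/
def IsCode (t : ℕ) (x : W) : Prop := ∀ j : Fin 27, (weightPerm x j : ℕ) = look t j

theorem isCode_s (i : Fin 7) : IsCode (reflectionCode i) (s i) := fun j => by
  rw [weightPerm_s, reflectionPerm_val]

/-- The code of a product. -/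
def compCode (t u : ℕ) : ℕ :=
  (List.range 27).foldl (fun a j => a + look t (look u j) <<< (5 * j)) 0

def oneCode : ℕ := (List.range 27).foldl (fun a j => a + j <<< (5 * j)) 0

def wordCode (l : List (Fin 7)) : ℕ :=
  (List.range 27).foldl
    (fun a j => a + (l.foldr (fun i k => look (reflectionCode i) k) j) <<< (5 * j)) 0

/-- The product of the reflections listed in a word. -/
def word (l : List (Fin 7)) : W := (l.map s).prod

/-- Uniqueness of base 32 digits: the sum of the first `n` terms is below `32 ^ n`, so the next term
leaves the lower digits alone and is itself recovered by division. -/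
theorem look_foldl (f : ℕ → ℕ) (hf : ∀ j < 27, f j < 32) (j : ℕ) (hj : j < 27) :
    look ((List.range 27).foldl (fun a j => a + f j <<< (5 * j)) 0) j = f j := by
  have key : ∀ n, (∀ j < n, f j < 32) → 
      (List.range n).foldl (fun a j => a + f j <<< (5 * j)) 0 < 2 ^ (5 * n) ∧
      ∀ j < n, look ((List.range n).foldl (fun a j => a + f j <<< (5 * j)) 0) j = f j := by
    intro n
    induction n with
    | zero => intro _; exact ⟨by simp, fun j hj => absurd hj (by omega)⟩
    | succ n ih =>
      intro h
      obtain ⟨h1, h2⟩ := ih fun j hj => h j (by omega)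
      rw [List.range_succ, List.foldl_append, List.foldl_cons, List.foldl_nil]
      generalize (List.range n).foldl (fun a j => a + f j <<< (5 * j)) 0 = a at h1 h2 ⊢
      have hn := h n (by omega)
      simp only [Nat.shiftLeft_eq, look, Nat.shiftRight_eq_div_pow] at h2 ⊢
      refine ⟨?_, fun j hj => ?_⟩
      · rw [Nat.mul_succ, pow_add]
        have : f n * 2 ^ (5 * n) ≤ 31 * 2 ^ (5 * n) := Nat.mul_le_mul_right _ (by omega)
        omega
      · rcases Nat.lt_succ_iff_lt_or_eq.1 hj with hj | rfl
        · rw [← h2 j hj]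
          have : f n * 2 ^ (5 * n) = 2 ^ (5 * j) * (32 * (f n * 2 ^ (5 * (n - j - 1)))) := by
            have e : 5 * n = 5 * j + (5 + 5 * (n - j - 1)) := by omega
            conv_lhs => rw [e, pow_add, pow_add]
            ring
          rw [this, Nat.add_mul_div_left _ _ (by positivity), Nat.add_mul_mod_self_left]
        · rw [Nat.add_mul_div_right _ _ (by positivity), Nat.div_eq_of_lt h1, zero_add,
            Nat.mod_eq_of_lt hn]
  exact (key 27 hf).2 j hj

theorem isCode_mul {t u : ℕ} {x y : W} (hx : IsCode t x) (hy : IsCode u y) :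
    IsCode (compCode t u) (x * y) := by
  intro j
  have h (j : Fin 27) : look t (look u j) = weightPerm (x * y) j := by
    rw [← hy, ← hx, map_mul, Equiv.Perm.mul_apply]
  rw [compCode, look_foldl (fun j => look t (look u j)) (fun k hk => ?_) j j.2, h]
  have := h ⟨k, hk⟩
  simp only at this
  rw [this]
  omega

theorem isCode_word (l : List (Fin 7)) : IsCode (wordCode l) (word l) := by
  have h (j : Fin 27) : l.foldr (fun i k => look (reflectionCode i) k) (j : ℕ)
      = weightPerm (word l) j := by
    induction l with
    | nil => simp [word]
    | cons i l ih =>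
      rw [List.foldr_cons, ih, ← isCode_s i, ← Equiv.Perm.mul_apply, ← map_mul]
      rfl
  intro j
  rw [wordCode, look_foldl (fun j => l.foldr (fun i k => look (reflectionCode i) k) j)
    (fun k hk => ?_) j j.2, h]
  have := h ⟨k, hk⟩
  simp only at this
  rw [this]
  omega

theorem IsCode.eq {t : ℕ} {x y : W} (hx : IsCode t x) (hy : IsCode t y) : x = y := by
  refine weightPerm_injective (Equiv.ext fun j => Fin.ext ?_)
  rw [hx, hy]

/-- By faithfulness on the weights, every relation in `W` is decided by comparing two numbers. -/
theorem word_eq_word {l m : List (Fin 7)} (h : wordCode l = wordCode m) : word l = word m :=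
  (isCode_word l).eq (y := word m) (by rw [h]; exact isCode_word m)

theorem isCode_one : IsCode oneCode 1 := by
  have h : oneCode = wordCode [] := by decide +kernel
  rw [h]
  exact isCode_word []

theorem word_append (l m : List (Fin 7)) : word (l ++ m) = word l * word m := by
  simp [word]

theorem word_pow (l : List (Fin 7)) (n : ℕ) : word l ^ n = word (List.replicate n l).flatten := by
  induction n with
  | zero => rfl
  | succ n ih => rw [pow_succ', ih, List.replicate_succ, List.flatten_cons, word_append]

attribute [irreducible] look compCode oneCode wordCode inc

theorem s_mul_self (i : Fin 7) : s i * s i = 1 := by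
  have h : ∀ i, wordCode [i, i] = wordCode [] := by decide +kernel
  have := word_eq_word (h i)
  simpa [word] using this

theorem s_inv (i : Fin 7) : (s i)⁻¹ = s i := inv_eq_of_mul_eq_one_left (s_mul_self i)

theorem word_inv (l : List (Fin 7)) : (word l)⁻¹ = word l.reverse := by
  rw [word, List.prod_inv_reverse, word, List.map_map, List.map_reverse]
  congr 3
  exact funext s_inv

theorem T_eq_word : T = word [6, 4, 2, 3, 2, 4, 6] := by
  simp [T, cj, word, s_inv, mul_assoc]

/-- The word concatenates four palindromes, one for each root; a palindrome conjugates a simple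
reflection into the reflection in that root. -/
theorem u₁_eq_word : u₁ = word [0, 3, 4, 3, 2, 3, 4, 5, 4, 3, 2, 1, 2, 3, 4, 5] := by
  refine mat_injective ?_
  rw [word, map_list_prod, List.map_map]
  decide +kernel

theorem u₂_eq_word :
    u₂ = word [5, 3, 6, 3, 2, 3, 6, 4, 3, 6, 5, 4, 3, 2, 3, 4, 5, 6, 3, 4] := by
  refine mat_injective ?_
  rw [word, map_list_prod, List.map_map]
  decide +kernel

/-! ### The action on weight numbers -/

instance : Finite W := Finite.of_injective weightPerm weightPerm_injective

/-- The action of `W` on the numbers of the weights, extended by the identity. -/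
noncomputable def act (x : W) (j : ℕ) : ℕ := if h : j < 27 then weightPerm x ⟨j, h⟩ else j

theorem act_of_lt (x : W) {j : ℕ} (h : j < 27) : act x j = weightPerm x ⟨j, h⟩ := dif_pos h

theorem act_fin (x : W) (j : Fin 27) : act x j = weightPerm x j := act_of_lt x j.2

theorem act_lt (x : W) {j : ℕ} (h : j < 27) : act x j < 27 := by
  rw [act_of_lt x h]; exact Fin.is_lt _

theorem act_one (j : ℕ) : act 1 j = j := by
  unfold act; split <;> simp

theorem act_mul (x y : W) (j : ℕ) : act (x * y) j = act x (act y j) := by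
  by_cases h : j < 27
  · rw [act_of_lt _ h, act_of_lt y h, act_fin, map_mul, Equiv.Perm.mul_apply]
  · simp [act, h]

theorem act_inv_act (x : W) (j : ℕ) : act x⁻¹ (act x j) = j := by
  rw [← act_mul, inv_mul_cancel, act_one]

theorem act_injective (x : W) : Function.Injective (act x) :=
  Function.LeftInverse.injective (act_inv_act x)

theorem inc_act (x : W) {j k : ℕ} (hj : j < 27) (hk : k < 27) :
    inc (act x j) (act x k) = inc j k := by
  rw [act_of_lt x hj, act_of_lt x hk]
  exact inc_weightPerm x ⟨j, hj⟩ ⟨k, hk⟩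

theorem IsCode.act_eq {t : ℕ} {x : W} (h : IsCode t x) {j : ℕ} (hj : j < 27) :
    act x j = look t j := by
  rw [act_of_lt x hj, h]

theorem eq_one_of_act {x : W} (h : ∀ j < 27, act x j = j) : x = 1 := by
  refine weightPerm_injective (Equiv.ext fun j => Fin.ext ?_)
  rw [← act_fin, h j j.2, map_one]; rfl

/-! ### Rigid sets of weights -/

/-- The relative position of two weights. -/
def position (j k : ℕ) : ℕ := bif Nat.beq j k then 2 else inc j k

theorem position_act (x : W) {j k : ℕ} (hj : j < 27) (hk : k < 27) :
    position (act x j) (act x k) = position j k := by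
  have : Nat.beq (act x j) (act x k) = Nat.beq j k := by
    rw [Bool.eq_iff_iff, Nat.beq_eq, Nat.beq_eq, (act_injective x).eq_iff]
  rw [position, position, inc_act x hj hk, this]

/-- The weights that are determined by their positions relative to the given weights. -/
def determined (pts : List ℕ) : List ℕ :=
  (List.range 27).filter fun j => (List.range 27).all fun k =>
    Nat.beq k j || !(pts.all fun p => Nat.beq (position j p) (position k p))

/-- The given weights are numbered correctly, and determine all weights (in two steps). -/
def rigid (pts : List ℕ) : Bool :=
  pts.all (Nat.blt · 27) && Nat.beq (determined (determined pts)).length 27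

/-- The image of `j` has the same positions relative to the fixed weights as `j`, and no other
weight has these positions. -/
theorem act_of_mem_determined {pts : List ℕ} (h27 : ∀ p ∈ pts, p < 27) {x : W}
    (hx : ∀ p ∈ pts, act x p = p) {j : ℕ} (hj : j ∈ determined pts) : act x j = j := by
  obtain ⟨hj1, hj2⟩ := List.mem_filter.1 hj
  rw [List.mem_range] at hj1
  have := List.all_eq_true.1 hj2 (act x j) (List.mem_range.2 (act_lt x hj1))
  rw [Bool.or_eq_true, Nat.beq_eq] at this
  refine this.resolve_right fun h => ?_
  rw [Bool.not_eq_true', ← Bool.not_eq_true, List.all_eq_true] at h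
  refine h fun p hp => ?_
  rw [Nat.beq_eq, ← position_act x hj1 (h27 p hp), hx p hp]

theorem eq_one_of_rigid {pts : List ℕ} (h : rigid pts = true) {x : W}
    (hx : ∀ p ∈ pts, act x p = p) : x = 1 := by
  rw [rigid, Bool.and_eq_true, List.all_eq_true, Nat.beq_eq] at h
  obtain ⟨h1, h2⟩ := h
  have h3 : ∀ p ∈ pts, p < 27 := fun p hp => by simpa [Nat.blt_eq] using h1 p hp
  -- A sublist of the 27 weights with 27 entries contains them all.
  have h4 : determined (determined pts) = List.range 27 :=
    List.Sublist.eq_of_length List.filter_sublist (by rw [h2, List.length_range])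
  refine eq_one_of_act fun j hj => ?_
  refine act_of_mem_determined (pts := determined pts)
    (fun p hp => List.mem_range.1 (List.mem_filter.1 hp).1)
    (fun p hp => act_of_mem_determined h3 hx hp) ?_
  rw [h4, List.mem_range]
  exact hj

/-! ### Upper bounds for centralisers -/

/-- The first `n` iterates of a coded permutation at `j`. -/
def iterates (t : ℕ) : ℕ → ℕ → List ℕ
  | 0, _ => []
  | n + 1, j => j :: iterates t n (look t j)

/-- The positions of the iterates of `j` relative to `j` and to the given weights. -/
def signature (t n : ℕ) (pre : List ℕ) (j : ℕ) : List ℕ :=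
  (iterates t n j).flatMap fun q => position q j :: pre.map (position q)

def beqList : List ℕ → List ℕ → Bool
  | [], [] => true
  | a :: l, b :: m => Nat.beq a b && beqList l m
  | _, _ => false

theorem beqList_refl (l : List ℕ) : beqList l l = true := by
  induction l with
  | nil => rfl
  | cons a l ih => simp [beqList, ih]

/-- An overestimate of the orbit of `b` under the elements that commute with the coded permutation
and fix `pre`: such elements preserve signatures. -/
def candidates (t n : ℕ) (pre : List ℕ) (b : ℕ) : List ℕ :=
  (List.range 27).filter fun c => beqList (signature t n pre c) (signature t n pre b)

def candidatesProd (t n : ℕ) : List ℕ → List ℕ → ℕ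
  | _, [] => 1
  | pre, b :: base => (candidates t n pre b).length * candidatesProd t n (b :: pre) base

/-- The elements that commute with `w` and fix the given weights. -/
def fixingCentralizer (K : Subgroup W) (pre : List ℕ) : Subgroup W where
  carrier := {x | x ∈ K ∧ ∀ l ∈ pre, act x l = l}
  one_mem' := ⟨one_mem _, fun _ _ => act_one _⟩
  mul_mem' := fun {x y} hx hy =>
    ⟨mul_mem hx.1 hy.1, fun l hl => by rw [act_mul, hy.2 l hl, hx.2 l hl]⟩
  inv_mem' := fun {x} hx => ⟨inv_mem hx.1, fun l hl => by
    conv_lhs => rw [← hx.2 l hl]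
    rw [act_inv_act]⟩

theorem iterates_act {t n : ℕ} {w x : W} (hw : IsCode t w) (hx : x * w = w * x) {j : ℕ}
    (hj : j < 27) : iterates t n (act x j) = (iterates t n j).map (act x) := by
  induction n generalizing j with
  | zero => rfl
  | succ n ih =>
    rw [iterates, iterates, List.map_cons, ← hw.act_eq hj, ← hw.act_eq (act_lt x hj), ← act_mul,
      ← hx, act_mul, ih (act_lt w hj)]

theorem iterates_lt {t n : ℕ} {w : W} (hw : IsCode t w) {j : ℕ} (hj : j < 27) :
    ∀ q ∈ iterates t n j, q < 27 := by
  induction n generalizing j with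
  | zero => simp [iterates]
  | succ n ih =>
    rw [iterates, ← hw.act_eq hj]
    intro q hq
    rcases List.mem_cons.1 hq with rfl | hq
    · exact hj
    · exact ih (act_lt w hj) q hq

theorem signature_act {t n : ℕ} {w x : W} (hw : IsCode t w) (hx : x * w = w * x) {pre : List ℕ}
    (hpre : ∀ l ∈ pre, l < 27) (hfix : ∀ l ∈ pre, act x l = l) {j : ℕ} (hj : j < 27) :
    signature t n pre (act x j) = signature t n pre j := by
  rw [signature, iterates_act hw hx hj, List.flatMap_map, signature]
  have hq := iterates_lt (n := n) hw hj
  generalize iterates t n j = L at hq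
  induction L with
  | nil => rfl
  | cons q L ih =>
    rw [List.flatMap_cons, List.flatMap_cons, ih fun q h => hq q (List.mem_cons_of_mem _ h)]
    have hq0 : q < 27 := hq q (List.mem_cons_self ..)
    congr 2
    · exact position_act x hq0 hj
    · refine List.map_congr_left fun l hl => ?_
      rw [← position_act x hq0 (hpre l hl), hfix l hl]

/-- Orbit–stabiliser as an inequality: the images of `b` are candidates, and the elements with a
given image of `b` form a coset of the stabiliser of `b`. -/
theorem card_fixingCentralizer_le {t n : ℕ} {w : W} (hw : IsCode t w) {pre : List ℕ}
    (hpre : ∀ l ∈ pre, l < 27) {b : ℕ} (hb : b < 27) :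
    Nat.card (fixingCentralizer (Subgroup.centralizer {w}) pre) ≤
      (candidates t n pre b).length *
        Nat.card (fixingCentralizer (Subgroup.centralizer {w}) (b :: pre)) := by
  classical
  have := Fintype.ofFinite (fixingCentralizer (Subgroup.centralizer {w}) pre)
  rw [Nat.card_eq_fintype_card, mul_comm]
  refine (Finset.card_le_mul_card_image_of_maps_to (s := Finset.univ)
    (t := (candidates t n pre b).toFinset)
    (f := fun x : fixingCentralizer (Subgroup.centralizer {w}) pre => act x b) ?_ _ ?_).trans
    (Nat.mul_le_mul_left _ (List.toFinset_card_le _))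
  · rintro ⟨x, hx1, hx2⟩ -
    rw [List.mem_toFinset]
    refine List.mem_filter.2 ⟨List.mem_range.2 (act_lt x hb), ?_⟩
    rw [signature_act hw (Subgroup.mem_centralizer_singleton_iff.1 hx1) hpre hx2 hb]
    exact beqList_refl _
  · intro c _
    rcases Finset.eq_empty_or_nonempty (Finset.univ.filter fun
      x : fixingCentralizer (Subgroup.centralizer {w}) pre => act x b = c) with h | ⟨x₀, hx₀⟩
    · rw [h]; exact Nat.zero_le _
    · have hc := (Finset.mem_filter.1 hx₀).2
      have := Fintype.ofFinite (fixingCentralizer (Subgroup.centralizer {w}) (b :: pre))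
      have hcard : Nat.card (fixingCentralizer (Subgroup.centralizer {w}) (b :: pre)) =
          (Set.toFinset (fixingCentralizer (Subgroup.centralizer {w}) (b :: pre) : Set W)).card := by
        rw [Set.toFinset_card, Nat.card_eq_fintype_card]; rfl
      rw [hcard]
      -- Left translation by the inverse of one element of the fibre carries the fibre into the
      -- stabiliser of `b`.
      refine Finset.card_le_card_of_injOn (fun a => (x₀⁻¹ * a : W)) ?_ ?_
      · rintro a ha
        have ha' := (Finset.mem_filter.1 ha).2
        have hmem : (x₀⁻¹ * a : W) ∈ fixingCentralizer (Subgroup.centralizer {w}) pre :=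
          mul_mem (inv_mem x₀.2) a.2
        rw [Set.coe_toFinset]
        refine ⟨hmem.1, fun l hl => ?_⟩
        rcases List.mem_cons.1 hl with rfl | hl
        · rw [act_mul, ha', ← hc]; exact act_inv_act _ _
        · exact hmem.2 l hl
      · intro a _ a' _ h
        exact Subtype.ext (mul_left_cancel h)

/-- The `n`-fold iterates of the listed weights form a rigid set. -/
def rigidBase (t n : ℕ) (base : List ℕ) : Bool := rigid (base.flatMap (iterates t n))

/-- Fixing one weight and commuting with `w` forces fixing its whole `w`-orbit, so few base points
are needed. -/
theorem act_of_mem_iterates {t n : ℕ} {w x : W} (hw : IsCode t w) (hx : x * w = w * x) {j : ℕ}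
    (hj : j < 27) (hfix : act x j = j) : ∀ q ∈ iterates t n j, act x q = q := by
  induction n generalizing j with
  | zero => simp [iterates]
  | succ n ih =>
    rw [iterates, ← hw.act_eq hj]
    intro q hq
    rcases List.mem_cons.1 hq with rfl | hq
    · exact hfix
    · exact ih (act_lt w hj) (by rw [← act_mul, hx, act_mul, hfix]) q hq

/-- Iterate the inequality along the base. After the last base point only the identity remains,
because the `w`-orbits of the base points form a rigid set. -/
theorem card_fixingCentralizer_le_prod {t n : ℕ} {w : W} (hw : IsCode t w) (base : List ℕ)
    (hbase : ∀ l ∈ base, l < 27) (pre : List ℕ) (hpre : ∀ l ∈ pre, l < 27)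
    (hr : rigidBase t n (base.reverse ++ pre) = true) :
    Nat.card (fixingCentralizer (Subgroup.centralizer {w}) pre) ≤ candidatesProd t n pre base := by
  induction base generalizing pre with
  | nil =>
    have : fixingCentralizer (Subgroup.centralizer {w}) pre = ⊥ := by
      rw [eq_bot_iff]
      rintro x ⟨hx, hfix⟩
      refine eq_one_of_rigid hr fun p hp => ?_
      obtain ⟨l, hl, hp⟩ := List.mem_flatMap.1 hp
      exact act_of_mem_iterates hw (Subgroup.mem_centralizer_singleton_iff.1 hx) (hpre l hl)
        (hfix l hl) p hp
    rw [this, candidatesProd, Subgroup.card_bot]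
  | cons b base ih =>
    have hb : b < 27 := hbase b (List.mem_cons_self ..)
    refine (card_fixingCentralizer_le hw hpre hb).trans (Nat.mul_le_mul_left _ (ih ?_ _ ?_ ?_))
    · exact fun l hl => hbase l (List.mem_cons_of_mem _ hl)
    · intro l hl
      rcases List.mem_cons.1 hl with rfl | hl
      · exact hb
      · exact hpre l hl
    · simpa using hr

theorem fixingCentralizer_nil (K : Subgroup W) : fixingCentralizer K [] = K := by
  ext x
  exact ⟨fun h => h.1, fun h => ⟨h, by simp⟩⟩

/-! ### Lower bounds for subgroups -/

/-- Every weight of the list `rest` is the image of an earlier one (or one of `seen`) under one of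
the coded permutations. -/
def reachable (codes : List ℕ) : List ℕ → List ℕ → Bool
  | _, [] => true
  | seen, q :: rest => (codes.any fun t => seen.any fun p => Nat.beq (look t p) q) &&
      reachable codes (q :: seen) rest

theorem exists_of_reachable {codes : List ℕ} {K : Subgroup W}
    (hc : ∀ t ∈ codes, ∃ x ∈ K, IsCode t x) {b : ℕ} (seen rest : List ℕ)
    (hseen : ∀ q ∈ seen, q < 27 ∧ ∃ x ∈ K, act x b = q)
    (h : reachable codes seen rest = true) : ∀ q ∈ rest, q < 27 ∧ ∃ x ∈ K, act x b = q := by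
  induction rest generalizing seen with
  | nil => simp
  | cons q rest ih =>
    rw [reachable, Bool.and_eq_true, List.any_eq_true] at h
    obtain ⟨⟨t, ht, h1⟩, h2⟩ := h
    obtain ⟨p, hp, h1⟩ := List.any_eq_true.1 h1
    rw [Nat.beq_eq] at h1
    have hq : q < 27 ∧ ∃ x ∈ K, act x b = q := by
      obtain ⟨x, hx, htx⟩ := hc t ht
      obtain ⟨hp27, y, hy, rfl⟩ := hseen p hp
      rw [← h1, ← htx.act_eq hp27]
      exact ⟨act_lt x hp27, x * y, mul_mem hx hy, act_mul x y b⟩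
    intro r hr
    rcases List.mem_cons.1 hr with rfl | hr
    · exact hq
    · refine ih (q :: seen) (fun p hp => ?_) h2 r hr
      rcases List.mem_cons.1 hp with rfl | hp
      · exact hq
      · exact hseen p hp

/-- Multiply a chosen element that moves `b` to `q` by an element of the stabiliser of `b`: the
image of `b` under the product gives back `q`, hence both factors. -/
theorem le_card_of_orbit {K : Subgroup W} {pre : List ℕ} {b : ℕ} {pts : List ℕ} (hn : pts.Nodup)
    (h : ∀ q ∈ pts, ∃ x ∈ fixingCentralizer K pre, act x b = q) :
    pts.length * Nat.card (fixingCentralizer K (b :: pre)) ≤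
      Nat.card (fixingCentralizer K pre) := by
  choose! f hf1 hf2 using h
  have hcard : pts.toFinset.card = Nat.card pts.toFinset := by
    rw [Nat.card_eq_fintype_card, Fintype.card_coe]
  rw [← List.toFinset_card_of_nodup hn, hcard, ← Nat.card_prod]
  refine Nat.card_le_card_of_injective
    (fun p : pts.toFinset × fixingCentralizer K (b :: pre) => ⟨f p.1 * p.2, mul_mem (hf1 _ (List.mem_toFinset.1 p.1.2)) ?_⟩) ?_
  · exact ⟨p.2.2.1, fun l hl => p.2.2.2 l (List.mem_cons_of_mem _ hl)⟩
  · rintro ⟨⟨q, hq⟩, y⟩ ⟨⟨q', hq'⟩, y'⟩ h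
    have h := congrArg Subtype.val h
    simp only at h
    rw [List.mem_toFinset] at hq hq'
    have hy (y : fixingCentralizer K (b :: pre)) : act y b = b := y.2.2 b (List.mem_cons_self ..)
    have : q = q' := by
      rw [← hf2 q hq, ← hf2 q' hq']
      conv_lhs => rw [← hy y, ← act_mul, h, act_mul, hy]
    subst this
    have := Subtype.ext (mul_left_cancel h)
    rw [this]

/-- A step of a stabiliser chain: a base point, words (in given generators) for elements that fix
the previous base points, and the further points of an orbit under these elements. -/
structure ChainStep where
  base : ℕ
  words : List (List ℕ)
  orbit : List ℕ

/-- The code of the product of the coded elements with the given numbers. -/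
def indexCode (codes : List ℕ) (l : List ℕ) : ℕ :=
  l.foldr (fun i c => compCode (codes.getD i oneCode) c) oneCode

def nodup : List ℕ → Bool
  | [] => true
  | a :: l => (l.all fun b => !Nat.beq a b) && nodup l

/-- The words of a step need not generate the full stabiliser of the earlier base points: any orbit
they produce gives a valid lower bound. -/
def checkChain (codes : List ℕ) : List ℕ → List ChainStep → Bool
  | _, [] => true
  | pre, c :: cs => Nat.blt c.base 27 &&
      ((c.words.map (indexCode codes)).all fun t => pre.all fun l => Nat.beq (look t l) l) &&
      reachable (c.words.map (indexCode codes)) [c.base] c.orbit && nodup (c.base :: c.orbit) &&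
      checkChain codes (c.base :: pre) cs

/-- The base point itself is not listed in `orbit`, hence the `+ 1`. -/
def chainProd (cs : List ChainStep) : ℕ := (cs.map fun c => c.orbit.length + 1).prod

theorem nodup_of_nodup {l : List ℕ} (h : nodup l = true) : l.Nodup := by
  induction l with
  | nil => exact List.nodup_nil
  | cons a l ih =>
    rw [nodup, Bool.and_eq_true, List.all_eq_true] at h
    refine List.nodup_cons.2 ⟨fun ha => ?_, ih h.2⟩
    simpa using h.1 a ha

theorem exists_indexCode {codes : List ℕ} {K : Subgroup W}
    (hc : ∀ t ∈ codes, ∃ x ∈ K, IsCode t x) (l : List ℕ) :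
    ∃ x ∈ K, IsCode (indexCode codes l) x := by
  induction l with
  | nil => exact ⟨1, one_mem _, isCode_one⟩
  | cons i l ih =>
    obtain ⟨x, hx, h⟩ := ih
    have : ∃ y ∈ K, IsCode (codes.getD i oneCode) y := by
      rcases lt_or_ge i codes.length with hi | hi
      · rw [List.getD_eq_getElem _ _ hi]
        exact hc _ (List.getElem_mem hi)
      · rw [List.getD_eq_default _ _ hi]
        exact ⟨1, one_mem _, isCode_one⟩
    obtain ⟨y, hy, h'⟩ := this
    refine ⟨y * x, mul_mem hy hx, ?_⟩
    rw [indexCode, List.foldr_cons]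
    exact isCode_mul h' h

theorem chainProd_le_card {codes : List ℕ} {K : Subgroup W}
    (hc : ∀ t ∈ codes, ∃ x ∈ K, IsCode t x) (cs : List ChainStep) (pre : List ℕ)
    (hpre : ∀ l ∈ pre, l < 27) (h : checkChain codes pre cs = true) :
    chainProd cs ≤ Nat.card (fixingCentralizer K pre) := by
  induction cs generalizing pre with
  | nil => exact Nat.card_pos
  | cons c cs ih =>
    simp only [checkChain, Bool.and_eq_true, Nat.blt_eq] at h
    obtain ⟨⟨⟨⟨h1, h2⟩, h3⟩, h4⟩, h5⟩ := h
    have hcodes : ∀ t ∈ c.words.map (indexCode codes), ∃ x ∈ fixingCentralizer K pre,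
        IsCode t x := by
      intro t ht
      have hfix := List.all_eq_true.1 h2 t ht
      obtain ⟨l, -, rfl⟩ := List.mem_map.1 ht
      obtain ⟨x, hx, hcode⟩ := exists_indexCode hc l
      refine ⟨x, ⟨hx, fun l hl => ?_⟩, hcode⟩
      rw [hcode.act_eq (hpre l hl)]
      simpa using List.all_eq_true.1 hfix l hl
    have horb := exists_of_reachable hcodes (b := c.base) [c.base] c.orbit (by
      intro q hq
      rw [List.mem_singleton.1 hq]
      exact ⟨h1, 1, one_mem _, act_one _⟩) h3
    refine le_trans ?_ (le_card_of_orbit (nodup_of_nodup h4) (b := c.base) (pre := pre) (K := K) ?_)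
    · rw [chainProd, List.map_cons, List.prod_cons, List.length_cons]
      refine Nat.mul_le_mul_left _ (ih _ ?_ h5)
      intro l hl
      rcases List.mem_cons.1 hl with rfl | hl
      · exact h1
      · exact hpre l hl
    · intro q hq
      rcases List.mem_cons.1 hq with rfl | hq
      · exact ⟨1, one_mem _, act_one _⟩
      · exact (horb q hq).2

/-- The elements commute with the permutation `t` (all in coded form), and a stabiliser chain of
the group that they generate shows that they generate the centraliser. -/
def checkCentralizer (t n : ℕ) (codes : List ℕ) (cs : List ChainStep) : Bool :=
  (codes.all fun u => Nat.beq (compCode u t) (compCode t u)) && checkChain codes [] cs &&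
    rigidBase t n (cs.map ChainStep.base).reverse &&
    Nat.ble (candidatesProd t n [] (cs.map ChainStep.base)) (chainProd cs)

/-- The generators commute with `w`, so they generate a subgroup of the centraliser. Its order is at
least `chainProd cs`, while the centraliser has order at most `candidatesProd`, which is no larger;
all these numbers coincide. -/
theorem centralizer_eq_closure {t n : ℕ} {w : W} (hw : IsCode t w) {codes : List ℕ} {S : List W}
    (hS : List.Forall₂ IsCode codes S) (cs : List ChainStep)
    (h : checkCentralizer t n codes cs = true) :
    Subgroup.centralizer {w} = Subgroup.closure {x | x ∈ S} ∧
      Nat.card (Subgroup.centralizer {w}) = chainProd cs := by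
  simp only [checkCentralizer, Bool.and_eq_true, Nat.ble_eq] at h
  obtain ⟨⟨⟨h1, h2⟩, h3⟩, h4⟩ := h
  have hbase : ∀ (cs : List ChainStep) (pre : List ℕ), checkChain codes pre cs = true →
      ∀ l ∈ cs.map ChainStep.base, l < 27 := by
    intro cs
    induction cs with
    | nil => simp
    | cons c cs ih =>
      intro pre h l hl
      simp only [checkChain, Bool.and_eq_true, Nat.blt_eq] at h
      rcases List.mem_cons.1 hl with rfl | hl
      · exact h.1.1.1.1
      · exact ih _ h.2 l hl
  have hle : Subgroup.closure {x | x ∈ S} ≤ Subgroup.centralizer {w} := by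
    rw [Subgroup.closure_le]
    intro x hx
    obtain ⟨i, hi, rfl⟩ := List.getElem_of_mem hx
    have hi' : i < codes.length := by rw [hS.length_eq]; exact hi
    have hcode := hS.get hi' hi
    rw [List.get_eq_getElem, List.get_eq_getElem] at hcode
    have := List.all_eq_true.1 h1 _ (List.getElem_mem hi')
    rw [Nat.beq_eq] at this
    refine Subgroup.mem_centralizer_singleton_iff.2 ((isCode_mul hcode hw).eq ?_)
    rw [this]
    exact isCode_mul hw hcode
  have hlow : chainProd cs ≤ Nat.card (Subgroup.closure {x | x ∈ S}) := by
    rw [← fixingCentralizer_nil (Subgroup.closure {x | x ∈ S})]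
    refine chainProd_le_card (codes := codes) (fun t ht => ?_) cs [] (by simp) h2
    obtain ⟨i, hi, rfl⟩ := List.getElem_of_mem ht
    have hi' : i < S.length := by rw [← hS.length_eq]; exact hi
    have hcode := hS.get hi hi'
    exact ⟨S[i], Subgroup.subset_closure (List.getElem_mem hi'), hcode⟩
  have hup : Nat.card (Subgroup.centralizer {w}) ≤ chainProd cs := by
    rw [← fixingCentralizer_nil (Subgroup.centralizer {w})]
    exact (card_fixingCentralizer_le_prod hw _ (hbase cs [] h2) [] (by simp)
      (by simpa using h3)).trans h4
  have hcard := Subgroup.card_le_of_le hle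
  refine ⟨(Subgroup.eq_of_le_of_card_ge hle (hup.trans hlow)).symm, ?_⟩
  exact le_antisymm hup (hlow.trans hcard)

/-! ### The centralisers of the representatives -/

def TWord : List (Fin 7) := [6, 4, 2, 3, 2, 4, 6]

def u₁Word : List (Fin 7) := [0, 3, 4, 3, 2, 3, 4, 5, 4, 3, 2, 1, 2, 3, 4, 5]

def u₂Word : List (Fin 7) := [5, 3, 6, 3, 2, 3, 6, 4, 3, 6, 5, 4, 3, 2, 3, 4, 5, 6, 3, 4]

theorem word_TWord : word TWord = T := T_eq_word.symm

theorem word_u₁Word : word u₁Word = u₁ := u₁_eq_word.symm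

theorem word_u₂Word : word u₂Word = u₂ := u₂_eq_word.symm

theorem T_inv : T⁻¹ = T := by rw [T_eq_word, word_inv]; rfl

/-- Words for the representatives of the conjugacy classes. -/
def repWord : CarterType → List (Fin 7)
  | .c1 => []
  | .cA1 => [0]
  | .cA1A1 => [0, 1]
  | .cA2 => [0, 6]
  | .cA1A1A1 => [0, 1, 5]
  | .cA2A1 => [0, 6, 1]
  | .cA3 => [0, 6, 3]
  | .cA1A1A1A1 => [0, 1, 5, 3]
  | .cA2A1A1 => [0, 6, 1, 5]
  | .cA2A2 => [0, 6, 1, 2]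
  | .cA3A1 => [0, 6, 3, 1]
  | .cA4 => [0, 6, 3, 4]
  | .cD4 => [0, 1, 5] ++ TWord
  | .cD4a1 => [1] ++ TWord ++ [5] ++ TWord ++ [0] ++ TWord
  | .cA2A2A1 => [0, 6, 5, 1, 2]
  | .cA3A1A1 => [0, 6, 3, 1, 5]
  | .cA4A1 => [0, 6, 3, 4, 1]
  | .cA5 => [0, 6, 3, 4, 5]
  | .cD5 => [0, 6, 3, 4, 4, 2, 3, 2, 4]
  | .cD5a1 => [0, 6, 3, 4] ++ TWord
  | .cA2A2A2 => [0, 6, 1, 2, 5, 4]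
  | .cA5A1 => [0, 6, 3, 4, 5, 1]
  | .cE6 => [1, 2, 3, 4, 5, 6]
  | .cE6a1 => [1, 2, 3, 4, 5, 3, 6, 3]
  | .cE6a2 => [6, 2] ++ TWord ++ [0] ++ TWord ++ TWord ++ [1] ++ TWord ++ [4, 3]

/-- Words for the generators of the direct factors of the centralisers. -/
def factorWords : CarterType → List (List (List (Fin 7)))
  | .c1 => [[[1], [2], [3], [4], [5], [6]]]
  | .cA1 => [[[0]], [[1], [2], [3], [4], [5]]]
  | .cA1A1 => [[[0], u₂Word], [[3], [4], [5]]]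
  | .cA2 => [[[0, 6]], [[1], [2], u₁Word]]
  | .cA1A1A1 => [[[0], u₁Word, u₂Word], [[3]]]
  | .cA2A1 => [[[0, 6]], [[1]], [[4], [5]]]
  | .cA3 => [[[0, 6, 3]], [[1], u₁Word]]
  | .cA1A1A1A1 => [[[0], [1], [5], TWord, u₁Word, u₂Word]]
  | .cA2A1A1 => [[[0, 6]], [[1], u₁Word]]
  | .cA2A2 => [[[0, 6], u₂Word], [[4], [5]]]
  | .cA3A1 => [[[0, 6, 3]], [[1]], [[5]]]
  | .cA4 => [[[0, 6, 3, 4]], [[1]]]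
  | .cD4 => [[[0, 1, 5] ++ TWord], [u₁Word, u₂Word]]
  | .cD4a1 => [[[5] ++ u₁Word ++ u₂Word ++ u₁Word, TWord ++ [5] ++ TWord ++ u₁Word]]
  | .cA2A2A1 => [[[0, 6], u₂Word], [[5]]]
  | .cA3A1A1 => [[[0, 6, 3, 1, 5]], [[1], TWord, [5]]]
  | .cA4A1 => [[[0, 6, 3, 4]], [[1]]]
  | .cA5 => [[[0, 6, 3, 4, 5]], [[1]]]
  | .cD5 => [[[0, 6, 3, 4, 4, 2, 3, 2, 4]]]
  | .cD5a1 => [[[0, 6, 3, 4] ++ TWord]]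
  | .cA2A2A2 => [[[0, 6], TWord ++ [3], [5, 4]]]
  | .cA5A1 => [[[0, 6, 3, 4, 5, 1]], [[1], TWord]]
  | .cE6 => [[[1, 2, 3, 4, 5, 6]]]
  | .cE6a1 => [[[1, 2, 3, 4, 5, 3, 6, 3]]]
  | .cE6a2 => [[[6, 2] ++ TWord ++ [0] ++ TWord ++ TWord ++ [1] ++ TWord ++ [4, 3, 6, 2] ++ TWord ++ [0] ++ TWord ++ TWord ++ [1] ++ TWord ++ [4, 3]], [TWord ++ [3], [5, 4]]]

/-- The orders of the representatives. -/
def repOrder : CarterType → ℕ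
  | .c1 => 1
  | .cA1 => 2
  | .cA1A1 => 2
  | .cA2 => 3
  | .cA1A1A1 => 2
  | .cA2A1 => 6
  | .cA3 => 4
  | .cA1A1A1A1 => 2
  | .cA2A1A1 => 6
  | .cA2A2 => 3
  | .cA3A1 => 4
  | .cA4 => 5
  | .cD4 => 6
  | .cD4a1 => 4
  | .cA2A2A1 => 6
  | .cA3A1A1 => 4
  | .cA4A1 => 10
  | .cA5 => 6
  | .cD5 => 8
  | .cD5a1 => 12
  | .cA2A2A2 => 3
  | .cA5A1 => 6
  | .cE6 => 12
  | .cE6a1 => 9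
  | .cE6a2 => 6

/-- The orders of the centralisers. -/
def centralizerOrder : CarterType → ℕ
  | .c1 => 51840
  | .cA1 => 1440
  | .cA1A1 => 192
  | .cA2 => 216
  | .cA1A1A1 => 96
  | .cA2A1 => 36
  | .cA3 => 32
  | .cA1A1A1A1 => 1152
  | .cA2A1A1 => 24
  | .cA2A2 => 108
  | .cA3A1 => 16
  | .cA4 => 10
  | .cD4 => 36
  | .cD4a1 => 96
  | .cA2A2A1 => 36
  | .cA3A1A1 => 96
  | .cA4A1 => 10
  | .cA5 => 12
  | .cD5 => 8
  | .cD5a1 => 12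
  | .cA2A2A2 => 648
  | .cA5A1 => 36
  | .cE6 => 12
  | .cE6a1 => 9
  | .cE6a2 => 72

/-- Stabiliser chains of the centralisers. -/
def chain : CarterType → List ChainStep
  | .c1 => [
      ⟨0, [[0], [1], [2], [3], [4], [5]],
        [21, 18, 16, 14, 11, 12, 10, 9, 8, 7, 5, 4, 6, 26, 25, 3, 24, 2, 23, 1, 20, 22, 19, 17, 15, 13]⟩,
      ⟨1, [[5], [2], [1], [3], [4]],
        [2, 3, 6, 4, 7, 5, 9, 8, 12, 10, 14, 11, 16, 18, 21]⟩,
      ⟨2, [[2], [1], [3], [4]],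
        [3, 6, 4, 7, 5, 9, 8, 10, 11]⟩,
      ⟨3, [[1], [3], [4]],
        [6, 4, 7, 5, 8]⟩,
      ⟨7, [[4]],
        [8]⟩]
  | .cA1 => [
      ⟨0, [[0], [1], [2], [3], [4], [5]],
        [1, 21, 22, 18, 19, 16, 17, 14, 15, 12, 13]⟩,
      ⟨2, [[3], [2], [4], [5]],
        [3, 6, 4, 7, 5, 9, 8, 10, 11]⟩,
      ⟨3, [[2], [4], [5]],
        [6, 4, 7, 5, 8]⟩,
      ⟨7, [[5]],
        [8]⟩]
  | .cA1A1 => [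
      ⟨0, [[0], [1]],
        [1, 21, 22]⟩,
      ⟨1, [[1]],
        [21]⟩,
      ⟨2, [[2], [3], [4]],
        [3, 4, 5]⟩,
      ⟨3, [[3], [4]],
        [4, 5]⟩,
      ⟨4, [[4]],
        [5]⟩]
  | .cA2 => [
      ⟨0, [[0], [1], [2], [3]],
        [1, 21, 13, 2, 22, 12, 18, 15, 23, 9, 19, 14, 17, 20, 10, 16, 11]⟩,
      ⟨3, [[2], [3, 2, 3], [3, 1, 3]],
        [6, 4, 7, 5, 8]⟩,
      ⟨7, [[3, 1, 3]],
        [8]⟩]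
  | .cA1A1A1 => [
      ⟨0, [[0], [1], [2]],
        [1, 13, 12, 21, 26, 5, 22, 15, 25, 14, 4]⟩,
      ⟨1, [[2]],
        [21]⟩,
      ⟨2, [[3]],
        [3]⟩,
      ⟨4, [[1, 2, 0, 2, 1]],
        [5]⟩]
  | .cA2A1 => [
      ⟨0, [[0], [1]],
        [1, 21, 2, 22, 23]⟩,
      ⟨3, [[2], [3]],
        [4, 5]⟩,
      ⟨4, [[3]],
        [5]⟩]
  | .cA3 => [
      ⟨0, [[0], [1], [2]],
        [1, 21, 13, 2, 22, 12, 15, 3, 23, 9, 14, 24, 7, 10, 8]⟩,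
      ⟨7, [[2, 1, 2]],
        [8]⟩]
  | .cA1A1A1A1 => [
      ⟨0, [[0], [1], [3], [2], [4], [5]],
        [1, 21, 13, 22, 7, 12, 10, 15, 26, 14, 8, 3, 5, 9, 23, 25, 4, 24, 16, 2, 19, 17, 18]⟩,
      ⟨1, [[3], [2], [5]],
        [7, 21, 8, 10, 9]⟩,
      ⟨2, [[0, 1, 3, 0, 1, 3, 5], [2]],
        [4, 5, 3]⟩,
      ⟨4, [[2]],
        [5]⟩]
  | .cA2A1A1 => [
      ⟨0, [[0], [1], [2]],
        [1, 21, 13, 2, 22, 12, 15, 23, 9, 14, 10]⟩,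
      ⟨4, [[2, 1, 2]],
        [5]⟩]
  | .cA2A2 => [
      ⟨0, [[0], [1]],
        [1, 2, 21, 18, 22, 19, 23, 20]⟩,
      ⟨1, [[1]],
        [21]⟩,
      ⟨3, [[2], [3]],
        [4, 5]⟩,
      ⟨4, [[3]],
        [5]⟩]
  | .cA3A1 => [
      ⟨0, [[0], [1]],
        [1, 21, 2, 22, 3, 23, 24]⟩,
      ⟨4, [[2]],
        [5]⟩]
  | .cA4 => [
      ⟨5, [[1]],
        [26]⟩,
      ⟨0, [[0]],
        [1, 2, 3, 4]⟩]
  | .cD4 => [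
      ⟨0, [[0], [1], [2]],
        [22, 13, 14, 26, 4]⟩,
      ⟨1, [[2], [0, 0]],
        [21, 7, 10, 9, 8]⟩]
  | .cD4a1 => [
      ⟨0, [[0], [1]],
        [25, 23, 1, 5, 3, 10, 26, 12, 21, 7, 16, 13, 19, 8, 4, 15, 14, 9, 18, 24, 22, 17, 2]⟩,
      ⟨1, [[0, 1, 0, 1, 1]],
        [10, 21, 7]⟩]
  | .cA2A2A1 => [
      ⟨0, [[0], [1]],
        [1, 2, 21, 18, 22, 19, 23, 20]⟩,
      ⟨1, [[1]],
        [21]⟩,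
      ⟨4, [[2]],
        [5]⟩]
  | .cA3A1A1 => [
      ⟨0, [[0], [1], [2], [3]],
        [22, 21, 2, 1, 10, 24, 23, 7, 9, 3, 15, 8, 12, 13, 14]⟩,
      ⟨1, [[2], [3]],
        [7, 8]⟩,
      ⟨4, [[3]],
        [5]⟩]
  | .cA4A1 => [
      ⟨0, [[0], [1]],
        [1, 21, 2, 22, 3, 23, 4, 24, 25]⟩]
  | .cA5 => [
      ⟨0, [[0], [1]],
        [1, 21, 2, 22, 3, 23, 4, 24, 5, 25, 26]⟩]
  | .cD5 => [
      ⟨0, [[0]],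
        [1, 2, 6, 13, 12, 9, 4]⟩]
  | .cD5a1 => [
      ⟨0, [[0]],
        [1, 6, 13, 12, 4]⟩,
      ⟨5, [[0, 0, 0, 0, 0, 0]],
        [11]⟩]
  | .cA2A2A2 => [
      ⟨0, [[0], [1], [2]],
        [1, 2, 7, 12, 9, 6, 3, 14, 13, 10, 8, 5, 16, 15, 11, 21, 4, 18, 23, 17, 22, 19, 24, 25, 20, 26]⟩,
      ⟨1, [[1], [2]],
        [7, 9, 6, 10, 8, 11, 21]⟩,
      ⟨3, [[2]],
        [5, 4]⟩]
  | .cA5A1 => [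
      ⟨0, [[0], [1], [2]],
        [22, 21, 2, 1, 10, 24, 23, 7, 4, 3, 15, 26, 25, 12, 5, 19, 16]⟩,
      ⟨1, [[2]],
        [7]⟩]
  | .cE6 => [
      ⟨0, [[0]],
        [21, 18, 16, 26, 20, 17, 15, 13, 1, 6, 9]⟩]
  | .cE6a1 => [
      ⟨0, [[0]],
        [21, 18, 26, 20, 15, 13, 1, 7]⟩]
  | .cE6a2 => [
      ⟨0, [[0]],
        [22, 20]⟩,
      ⟨1, [[1], [2]],
        [7, 9, 6, 10, 8, 11, 21]⟩,
      ⟨3, [[2]],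
        [5, 4]⟩]

theorem word_repWord (c : CarterType) : word (repWord c) = rep c := by
  cases c <;> simp only [repWord, word_append, word_TWord] <;>
    simp [rep, word, cj, T_inv, s_inv, mul_assoc]

theorem word_cons (i : Fin 7) (l : List (Fin 7)) : word (i :: l) = s i * word l := by
  simp [word]

theorem word_nil : word [] = 1 := rfl

/-- The group generated by a list of words. -/
def wordClosure (ws : List (List (Fin 7))) : Subgroup W := Subgroup.closure {x | x ∈ ws.map word}

theorem setOf_mem_cons {α : Type} (a : α) (l : List α) :
    {x | x ∈ a :: l} = insert a {x | x ∈ l} := by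
  ext; simp

theorem setOf_mem_nil {α : Type} : {x : α | x ∈ []} = ∅ := by
  ext; simp

theorem map_factors_sub (c : CarterType) :
    (factors c).map Factor.sub = (factorWords c).map wordClosure := by
  cases c <;> simp only [factors, factorWords, wordClosure, List.map_cons, List.map_nil,
      word_append, word_TWord, word_u₁Word, word_u₂Word, word_cons, word_nil, mul_one,
      setOf_mem_cons, setOf_mem_nil, insert_empty_eq, rep, cj, T_inv, s_inv, u₃, pow_two,
      _root_.mul_inv_rev, mul_assoc]

/-- Taking as many iterates as the order of the representative makes them run through full orbits.
-/
theorem checkCentralizer_rep (c : CarterType) :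
    checkCentralizer (wordCode (repWord c)) (repOrder c)
      ((factorWords c).flatten.map wordCode) (chain c) = true := by
  cases c <;> decide +kernel

theorem forall₂_isCode_word (ws : List (List (Fin 7))) :
    List.Forall₂ IsCode (ws.map wordCode) (ws.map word) := by
  induction ws with
  | nil => exact .nil
  | cons l ws ih => exact .cons (isCode_word l) ih

theorem chainProd_chain (c : CarterType) : chainProd (chain c) = centralizerOrder c := by
  cases c <;> decide +kernel

theorem centralizer_rep (c : CarterType) :
    Subgroup.centralizer {rep c} = wordClosure (factorWords c).flatten :=
  (centralizer_eq_closure (word_repWord c ▸ isCode_word (repWord c)) (forall₂_isCode_word _) _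
    (checkCentralizer_rep c)).1

theorem card_centralizer_rep (c : CarterType) :
    Nat.card (Subgroup.centralizer {rep c}) = centralizerOrder c := by
  rw [← chainProd_chain]
  exact (centralizer_eq_closure (word_repWord c ▸ isCode_word (repWord c)) (forall₂_isCode_word _) _
    (checkCentralizer_rep c)).2

theorem card_W : Nat.card W = 51840 := by
  have h := card_centralizer_rep .c1
  have h1 : Subgroup.centralizer {rep .c1} = ⊤ := by
    rw [eq_top_iff]
    intro x _
    exact Subgroup.mem_centralizer_singleton_iff.2 (by simp [rep])
  rw [h1, Subgroup.card_top] at h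
  exact h

/-! ### The conjugacy classes -/

/-- A class function on `W`: the sum of the positions of the weights relative to their images. -/
noncomputable def positionSum (x : W) : ℕ := ((List.range 27).map fun j => position (act x j) j).sum

/-- Reindex the sum by the permutation of `y`. Positions 2, 1, 0 stand for inner products 4/3, 1/3,
-2/3, so the sum is 18 plus six times the trace of `x` on the root lattice, and therefore a class
function. -/
theorem positionSum_conj (x y : W) : positionSum (y * x * y⁻¹) = positionSum x := by
  have h (z : W) : positionSum z = ∑ j : Fin 27, position (weightPerm z j) j := by
    have h : positionSum z = ∑ j ∈ Finset.range 27, position (act z j) j := rfl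
    rw [h, Finset.sum_range]
    exact Finset.sum_congr rfl fun j _ => by rw [act_fin]
  rw [h, h, ← Equiv.sum_comp (weightPerm y)]
  refine Finset.sum_congr rfl fun j _ => ?_
  rw [← act_fin, ← act_fin, ← act_fin, ← act_mul, inv_mul_cancel_right, act_mul]
  exact position_act y (act_lt x j.2) j.2

/-- Four values of `positionSum` as one number. -/
noncomputable def classInvariant (x : W) : ℕ :=
  1000000 * positionSum x + 10000 * positionSum (x ^ 2) + 100 * positionSum (x ^ 3) +
    positionSum (x ^ 4)

theorem classInvariant_eq_of_isConj {x y : W} (h : IsConj x y) :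
    classInvariant x = classInvariant y := by
  obtain ⟨z, rfl⟩ := isConj_iff.1 h
  simp only [classInvariant, conj_pow, positionSum_conj]

def codePositionSum (t : ℕ) : ℕ := ((List.range 27).map fun j => position (look t j) j).sum

theorem IsCode.positionSum {t : ℕ} {x : W} (h : IsCode t x) :
    positionSum x = codePositionSum t := by
  rw [E6.positionSum, codePositionSum]
  congr 1
  refine List.map_congr_left fun j hj => ?_
  rw [h.act_eq (List.mem_range.1 hj)]

def wordInvariant (l : List (Fin 7)) : ℕ :=
  1000000 * codePositionSum (wordCode l) + 10000 * codePositionSum (wordCode (l ++ l)) +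
    100 * codePositionSum (wordCode (l ++ l ++ l)) +
    codePositionSum (wordCode (l ++ l ++ l ++ l))

theorem classInvariant_word (l : List (Fin 7)) : classInvariant (word l) = wordInvariant l := by
  have h2 : word l ^ 2 = word (l ++ l) := by rw [pow_two, word_append]
  have h3 : word l ^ 3 = word (l ++ l ++ l) := by rw [pow_succ, h2, word_append (l ++ l)]
  have h4 : word l ^ 4 = word (l ++ l ++ l ++ l) := by rw [pow_succ, h3, word_append (l ++ l ++ l)]
  rw [classInvariant, h2, h3, h4, (isCode_word _).positionSum, (isCode_word _).positionSum,
    (isCode_word _).positionSum, (isCode_word _).positionSum, wordInvariant]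

/-- The values of the class invariant on the representatives. -/
def repInvariant : CarterType → ℕ
  | .c1 => 54545454
  | .cA1 => 42544254
  | .cA1A1 => 30543054
  | .cA2 => 36365436
  | .cA1A1A1 => 18541854
  | .cA2A1 => 24364236
  | .cA3 => 30303054
  | .cA1A1A1A1 => 6540654
  | .cA2A1A1 => 12363036
  | .cA2A2 => 18185418
  | .cA3A1 => 18301854
  | .cA4 => 24242424
  | .cD4 => 24360636
  | .cD4a1 => 30063054
  | .cA2A2A1 => 6184218
  | .cA3A1A1 => 6300654
  | .cA4A1 => 12241224
  | .cA5 => 18181818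
  | .cD5 => 18301806
  | .cD5a1 => 24120636
  | .cA2A2A2 => 5400
  | .cA5A1 => 6180618
  | .cE6 => 12243000
  | .cE6a1 => 18180018
  | .cE6a2 => 24000600

theorem wordInvariant_repWord (c : CarterType) :
    wordInvariant (repWord c) = repInvariant c := by
  cases c <;> decide +kernel

def carterTypes : List CarterType :=
  [.c1, .cA1, .cA1A1, .cA2, .cA1A1A1, .cA2A1, .cA3, .cA1A1A1A1,
    .cA2A1A1, .cA2A2, .cA3A1, .cA4, .cD4, .cD4a1, .cA2A2A1, .cA3A1A1,
    .cA4A1, .cA5, .cD5, .cD5a1, .cA2A2A2, .cA5A1, .cE6, .cE6a1,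
    .cE6a2]

/-- Decoding the invariant by a lookup gives injectivity from 25 evaluations instead of a comparison
of all pairs. -/
theorem lookup_repInvariant (c : CarterType) :
    (carterTypes.map fun d => (repInvariant d, d)).lookup (repInvariant c) = some c := by
  cases c <;> rfl

theorem repInvariant_injective : Function.Injective repInvariant := by
  intro c d h
  have hc := lookup_repInvariant c
  rw [h, lookup_repInvariant d] at hc
  exact (Option.some.inj hc).symm

theorem eq_of_isConj {c d : CarterType} (h : IsConj (rep c) (rep d)) : c = d := by
  have := classInvariant_eq_of_isConj h
  rw [← word_repWord, ← word_repWord, classInvariant_word, classInvariant_word,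
    wordInvariant_repWord, wordInvariant_repWord] at this
  exact repInvariant_injective this

theorem nodup_carterTypes : carterTypes.Nodup := by
  have h : (carterTypes.map repInvariant).Nodup :=
    nodup_of_nodup (by decide +kernel)
  exact List.Nodup.of_map _ h

/-- The class equation: the classes of the representatives are disjoint, and their lengths, computed
from the centraliser orders, exhaust `W`. -/
theorem exists_isConj (w : W) : ∃ c, IsConj (rep c) w := by
  classical
  have hsum : ∀ L : List CarterType, L.Nodup →
      Nat.card {w : W | ∃ c ∈ L, IsConj (rep c) w} =
        (L.map fun c => 51840 / centralizerOrder c).sum := by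
    intro L hL
    induction L with
    | nil => simp
    | cons c L ih =>
      rw [List.nodup_cons] at hL
      have hset : {w : W | ∃ d ∈ c :: L, IsConj (rep d) w} =
          {w : W | IsConj (rep c) w} ∪ {w : W | ∃ d ∈ L, IsConj (rep d) w} := by
        ext w; simp
      have hdisj : Disjoint {w : W | IsConj (rep c) w} {w : W | ∃ d ∈ L, IsConj (rep d) w} := by
        rw [Set.disjoint_left]
        rintro w h1 ⟨d, hd, h2⟩
        exact hL.1 (eq_of_isConj (h1.trans h2.symm) ▸ hd)
      have hclass : Nat.card {w : W | IsConj (rep c) w} = 51840 / centralizerOrder c := by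
        -- Orbit–stabiliser for the conjugation action: the stabiliser is the centraliser and the
        -- orbit is the class.
        have h := (MulAction.stabilizer (ConjAct W) (rep c)).card_mul_index
        rw [← Subgroup.nat_card_centralizer_nat_card_stabilizer, card_centralizer_rep,
          MulAction.index_stabilizer, ← Nat.card_coe_set_eq] at h
        have h2 : Nat.card (ConjAct W) = 51840 := card_W
        have h3 : MulAction.orbit (ConjAct W) (rep c) = {w : W | IsConj (rep c) w} := by
          ext w
          rw [ConjAct.mem_orbit_conjAct, isConj_comm]
          rfl
        rw [h2, h3] at h
        rw [← h, Nat.mul_div_cancel_left]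
        cases c <;> decide
      rw [hset, Nat.card_coe_set_eq, Set.ncard_union_eq hdisj, ← Nat.card_coe_set_eq,
        ← Nat.card_coe_set_eq, ih hL.2, hclass, List.map_cons, List.sum_cons]
  have hall : {w : W | ∃ c ∈ carterTypes, IsConj (rep c) w} = Set.univ := by
    refine Set.eq_of_subset_of_ncard_le (Set.subset_univ _) ?_
    rw [Set.ncard_univ, card_W, ← Nat.card_coe_set_eq, hsum _ nodup_carterTypes]
    decide +kernel
  obtain ⟨c, -, hc⟩ := hall.symm ▸ Set.mem_univ w
  exact ⟨c, hc⟩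

theorem existsUnique_isConj (w : W) : ∃! c : CarterType, IsConj (rep c) w := by
  obtain ⟨c, hc⟩ := exists_isConj w
  exact ⟨c, hc, fun d hd => eq_of_isConj (hd.trans hc.symm)⟩

/-! ### Internal products and isomorphisms -/

/-- Multiplication from the abstract product onto `Z` is a surjective homomorphism between finite
groups of the same order. -/
theorem isInternalDirectProduct_of_card {G : Type} [Group G] [Finite G] {m : ℕ}
    {H : Fin m → Subgroup G} {Z : Subgroup G}
    (hcomm : Pairwise fun i j => ∀ x y : G, x ∈ H i → y ∈ H j → Commute x y)
    (hsup : ⨆ i, H i = Z) (hcard : ∏ i, Nat.card (H i) = Nat.card Z) :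
    IsInternalDirectProduct H Z := by
  let f := Subgroup.noncommPiCoprod hcomm
  have hf : f.range = Z := by rw [← hsup]; exact Subgroup.noncommPiCoprod_range
  let f' : (∀ i, H i) →* Z := f.codRestrict Z fun x => hf ▸ MonoidHom.mem_range.2 ⟨x, rfl⟩
  have hsurj : Function.Surjective f' := by
    rintro ⟨z, hz⟩
    obtain ⟨x, hx⟩ := MonoidHom.mem_range.1 (hf.symm ▸ hz)
    exact ⟨x, Subtype.ext hx⟩
  have hbij : Function.Bijective f' := by
    refine (Nat.bijective_iff_surjective_and_card f').2 ⟨hsurj, ?_⟩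
    rw [Nat.card_pi, hcard]
  refine ⟨MulEquiv.ofBijective f' hbij, fun i x => ?_⟩
  exact Subgroup.noncommPiCoprod_mulSingle i x

/-- Pass to the closure on one side at a time: the elements that commute with a given set form a
subgroup. -/
theorem commute_of_mem_closure {G : Type} [Group G] {S U : Set G}
    (h : ∀ x ∈ S, ∀ y ∈ U, Commute x y) {x y : G} (hx : x ∈ Subgroup.closure S)
    (hy : y ∈ Subgroup.closure U) : Commute x y := by
  have h1 : Subgroup.closure U ≤ Subgroup.centralizer S := by
    rw [Subgroup.closure_le]
    exact fun y hy => Subgroup.mem_centralizer_iff.2 fun x hx => h x hx y hy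
  have h2 : Subgroup.closure S ≤ Subgroup.centralizer (Subgroup.closure U : Set G) := by
    rw [Subgroup.closure_le]
    exact fun x hx => Subgroup.mem_centralizer_iff.2 fun y hy =>
      (Subgroup.mem_centralizer_iff.1 (h1 hy) x hx).symm
  exact (Subgroup.mem_centralizer_iff.1 (h2 hx) y hy).symm

/-- Subgroups with matching generators are isomorphic if the generators match in the graph of a
bijective correspondence. -/
theorem exists_mulEquiv_closure {G M ι : Type} [Group G] [Group M] {g : ι → G} {h : ι → M}
    {D : Subgroup (G × M)} (hD : ∀ k, (g k, h k) ∈ D) (h1 : ∀ x, (x, 1) ∈ D → x = 1)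
    (h2 : ∀ y, (1, y) ∈ D → y = 1) :
    ∃ e : Subgroup.closure (Set.range g) ≃* Subgroup.closure (Set.range h),
      ∀ x : Subgroup.closure (Set.range g), ((x : G), (e x : M)) ∈ D := by
  -- The pairs of generators generate a subgroup of `D`. Both projections are injective on it, so it
  -- is the graph of an isomorphism.
  let E := Subgroup.closure (Set.range fun k => (g k, h k))
  have hE : E ≤ D := by
    rw [Subgroup.closure_le]
    rintro _ ⟨k, rfl⟩
    exact hD k
  let p := (MonoidHom.fst G M).comp E.subtype
  let q := (MonoidHom.snd G M).comp E.subtype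
  have hp : Function.Injective p := by
    rw [injective_iff_map_eq_one]
    rintro ⟨⟨x, y⟩, hxy⟩ hx
    have hx : x = 1 := hx
    subst hx
    exact Subtype.ext (Prod.ext rfl (h2 y (hE hxy)))
  have hq : Function.Injective q := by
    rw [injective_iff_map_eq_one]
    rintro ⟨⟨x, y⟩, hxy⟩ hy
    have hy : y = 1 := hy
    subst hy
    exact Subtype.ext (Prod.ext (h1 x (hE hxy)) rfl)
  have hpr : p.range = Subgroup.closure (Set.range g) := by
    rw [MonoidHom.range_comp, Subgroup.range_subtype, MonoidHom.map_closure, ← Set.range_comp]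
    rfl
  have hqr : q.range = Subgroup.closure (Set.range h) := by
    rw [MonoidHom.range_comp, Subgroup.range_subtype, MonoidHom.map_closure, ← Set.range_comp]
    rfl
  let e := ((MulEquiv.subgroupCongr hpr.symm).trans (MonoidHom.ofInjective hp).symm).trans
    ((MonoidHom.ofInjective hq).trans (MulEquiv.subgroupCongr hqr))
  refine ⟨e, fun x => ?_⟩
  obtain ⟨z, hz⟩ := (MonoidHom.ofInjective hp).surjective ((MulEquiv.subgroupCongr hpr.symm) x)
  have hx : (x : G) = (z : G × M).1 := by
    have := congrArg Subtype.val hz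
    exact this.symm
  have he : (e x : M) = (z : G × M).2 := by
    change ((MulEquiv.subgroupCongr hqr) ((MonoidHom.ofInjective hq)
      ((MonoidHom.ofInjective hp).symm ((MulEquiv.subgroupCongr hpr.symm) x))) : M) = _
    rw [← hz, MulEquiv.symm_apply_apply]
    rfl
  rw [hx, he]
  exact hE z.2

/-- A family of maps from a set acted on by a group `M` to the set of weights identifies subgroups
of `W` and of `M` if it is equivariant on generators, and faithful. -/
theorem exists_mulEquiv_of_equivariant {M Y L ι : Type} [Group M] {g : ι → W} {h : ι → M}
    (ρ : M →* Function.End Y) (E : L → Y → Fin 27)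
    (hE : ∀ k l y, weightPerm (g k) (E l y) = E l (ρ (h k) y))
    (h1 : ∀ x : W, (∀ l y, weightPerm x (E l y) = E l y) → x = 1)
    (h2 : ∀ m : M, (∀ l y, E l (ρ m y) = E l y) → m = 1) :
    ∃ e : Subgroup.closure (Set.range g) ≃* Subgroup.closure (Set.range h),
      ∀ (x : Subgroup.closure (Set.range g)) (l) (y), weightPerm x (E l y) = E l (ρ (e x : M) y) := by
  -- The pairs that act compatibly through all maps `E l`. Faithfulness on either side says that
  -- each component determines the other.
  let D : Subgroup (W × M) :=
    { carrier := {p | ∀ l y, weightPerm p.1 (E l y) = E l (ρ p.2 y)}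
      one_mem' := fun l y => by
        rw [Prod.fst_one, Prod.snd_one, map_one, map_one]; rfl
      mul_mem' := fun {p q} hp hq l y => by
        rw [Prod.fst_mul, Prod.snd_mul, map_mul, map_mul, Equiv.Perm.mul_apply, hq, hp]; rfl
      inv_mem' := fun {p} hp l y => by
        have := hp l (ρ p.2⁻¹ y)
        have h : ρ p.2 (ρ p.2⁻¹ y) = y := by
          change (ρ p.2 * ρ p.2⁻¹) y = y
          rw [← map_mul, mul_inv_cancel, map_one]; rfl
        rw [h] at this
        rw [Prod.fst_inv, Prod.snd_inv, map_inv, ← this]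
        exact (weightPerm p.1).symm_apply_apply _ }
  obtain ⟨e, he⟩ := exists_mulEquiv_closure (D := D) (g := g) (h := h) hE
    (fun x hx => h1 x fun l y => by
      have := hx l y
      rw [map_one] at this
      exact this)
    (fun m hm => h2 m fun l y => by
      have := hm l y
      rw [map_one] at this
      exact this.symm)
  exact ⟨e, he⟩

/-! ### Wreath products -/

/-- A permutation wreath product is determined by its base group. -/
def wreathCongr {D E : Type} [Group D] [Group E] (e : D ≃* E) (n : ℕ) :
    Wreath D n ≃* Wreath E n :=
  SemidirectProduct.congr (MulEquiv.piCongrRight fun _ => e) (MulEquiv.refl _) (by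
    intro σ
    ext f i
    rfl)

/-- Since the stabiliser of the index 0 centralises `A`, the conjugates of `A` are permuted by `τ`
exactly as the indices, so `τ` and the product of the conjugates combine to a homomorphism from the
wreath product. That the base group meets `Q` trivially is not assumed; it follows from `A` being
nontrivial. -/
theorem isInternalWreathProduct {G : Type} [Group G] {n : ℕ} [NeZero n] {A Q Z : Subgroup G}
    (τ : Equiv.Perm (Fin n) →* G) (hτ : τ.range = Q) (hZ : A ⊔ Q = Z) (hA : A ≠ ⊥)
    (hstab : ∀ σ : Equiv.Perm (Fin n), σ 0 = 0 → ∀ a ∈ A, Commute (τ σ) a)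
    (hcomm : ∀ i ≠ 0, ∀ a ∈ A, ∀ b ∈ A,
      Commute a (τ (Equiv.swap 0 i) * b * (τ (Equiv.swap 0 i))⁻¹))
    (hind : iSupIndep fun i : Fin n => A.map (MulAut.conj (τ (Equiv.swap 0 i))).toMonoidHom) :
    IsInternalWreathProduct n A Q Z := by
  -- The conjugate of `a` under `τ σ` depends only on `σ 0`.
  have hconj (σ ρ : Equiv.Perm (Fin n)) (h : σ 0 = ρ 0) (a : G) (ha : a ∈ A) :
      τ σ * a * (τ σ)⁻¹ = τ ρ * a * (τ ρ)⁻¹ := by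
    have h0 : (ρ⁻¹ * σ) 0 = 0 := by
      rw [Equiv.Perm.mul_apply, h]; exact ρ.symm_apply_apply 0
    have := (hstab _ h0 a ha).eq
    rw [map_mul, map_inv] at this
    calc τ σ * a * (τ σ)⁻¹ = τ ρ * ((τ ρ)⁻¹ * τ σ * a) * (τ σ)⁻¹ := by group
      _ = τ ρ * (a * ((τ ρ)⁻¹ * τ σ)) * (τ σ)⁻¹ := by rw [this]
      _ = τ ρ * a * (τ ρ)⁻¹ := by group
  let c (i : Fin n) : A →* G := (MulAut.conj (τ (Equiv.swap 0 i))).toMonoidHom.comp A.subtype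
  have hc (i : Fin n) (a : A) : c i a = τ (Equiv.swap 0 i) * a * (τ (Equiv.swap 0 i))⁻¹ := rfl
  have hc' (σ : Equiv.Perm (Fin n)) (i : Fin n) (h : σ 0 = i) (a : A) :
      c i a = τ σ * a * (τ σ)⁻¹ := by
    rw [hc]
    exact hconj _ _ (by rw [Equiv.swap_apply_left, h]) a a.2
  have hcc : Pairwise fun i j => ∀ a b : A, Commute (c i a) (c j b) := by
    intro i j hij a b
    have h0 : ((Equiv.swap 0 i)⁻¹ * Equiv.swap 0 j) 0 ≠ 0 := by
      rw [Equiv.Perm.mul_apply, Equiv.swap_apply_left, Equiv.swap_inv]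
      intro h
      have := congrArg (Equiv.swap 0 i) h
      rw [Equiv.swap_apply_self, Equiv.swap_apply_left] at this
      exact hij this.symm
    have := hcomm _ h0 a a.2 b b.2
    rw [← hconj ((Equiv.swap 0 i)⁻¹ * Equiv.swap 0 j) _ (Equiv.swap_apply_left ..).symm b b.2]
      at this
    have h3 := this.map (MulAut.conj (τ (Equiv.swap 0 i)))
    rw [MulAut.conj_apply, MulAut.conj_apply] at h3
    rw [hc, hc]
    convert h3 using 1
    rw [map_mul, map_inv]
    group
  let f : (Fin n → A) →* G := MonoidHom.noncommPiCoprod c hcc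
  have hf1 (i : Fin n) (a : A) : f (Pi.mulSingle i a) = c i a :=
    MonoidHom.noncommPiCoprod_mulSingle ..
  have hfinj : Function.Injective f := by
    refine MonoidHom.injective_noncommPiCoprod_of_iSupIndep (ϕ := c) (hcomm := hcc) ?_ ?_
    · convert hind using 2 with i
      rw [MonoidHom.range_comp, Subgroup.range_subtype]
    · intro i
      exact (MulAut.conj _).injective.comp Subtype.val_injective
  have hfr : f.range = ⨆ i, (c i).range := MonoidHom.noncommPiCoprod_range ..
  clear_value f
  have hsingle (σ : Equiv.Perm (Fin n)) (i : Fin n) (a : A) :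
      (mulAutArrow σ : MulAut (Fin n → A)) (Pi.mulSingle i a) = Pi.mulSingle (σ i) a := by
    funext j
    change (Pi.mulSingle i a : Fin n → A) (σ⁻¹ • j) = _
    rw [Pi.mulSingle_apply, Pi.mulSingle_apply]
    have : σ⁻¹ • j = i ↔ j = σ i := by
      rw [Equiv.Perm.smul_def]
      exact Equiv.symm_apply_eq σ
    simp only [this]
  have hfc (σ : Equiv.Perm (Fin n)) : f.comp (mulAutArrow σ).toMonoidHom =
      (MulAut.conj (τ σ)).toMonoidHom.comp f := by
    refine MonoidHom.pi_ext fun i a => ?_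
    change f ((mulAutArrow σ : MulAut (Fin n → A)) (Pi.mulSingle i a)) =
      τ σ * f (Pi.mulSingle i a) * (τ σ)⁻¹
    rw [hsingle, hf1, hf1, hc i, hc' (σ * Equiv.swap 0 i) (σ i) (by simp), map_mul]
    group
  let F : Wreath A n →* G := SemidirectProduct.lift f τ hfc
  have hFl (x : Fin n → A) : F (SemidirectProduct.inl x) = f x := SemidirectProduct.lift_inl ..
  have hFr (σ : Equiv.Perm (Fin n)) : F (SemidirectProduct.inr σ) = τ σ :=
    SemidirectProduct.lift_inr ..
  have hFinj : Function.Injective F := by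
    rw [injective_iff_map_eq_one]
    intro x hx
    have hx' : f x.left * τ x.right = 1 := by
      rw [← SemidirectProduct.inl_left_mul_inr_right x, map_mul, hFl, hFr] at hx
      exact hx
    -- If `x` is in the kernel, then `τ x.right` lies in the image of the base group, so conjugation
    -- by it preserves each factor. If `x.right` moved `i`, the same conjugation would carry factor
    -- `i` to a different one, so that factor would be trivial.
    have hr : x.right = 1 := by
      by_contra hne
      obtain ⟨i, hi⟩ : ∃ i, x.right i ≠ i := by
        by_contra! h
        exact hne (Equiv.ext h)
      have e2 : τ x.right = f x.left⁻¹ := by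
        rw [map_inv]
        exact (inv_eq_of_mul_eq_one_right hx').symm
      refine hA ((Subgroup.eq_bot_iff_forall A).2 fun a ha => ?_)
      have e1 : f ((mulAutArrow x.right : MulAut (Fin n → A)) (Pi.mulSingle i ⟨a, ha⟩)) =
          τ x.right * f (Pi.mulSingle i ⟨a, ha⟩) * (τ x.right)⁻¹ :=
        DFunLike.congr_fun (hfc x.right) (Pi.mulSingle i ⟨a, ha⟩ : Fin n → A)
      rw [hsingle, e2, ← map_inv, ← map_mul, ← map_mul] at e1
      have e3 := congrFun (hfinj e1) i
      rw [Pi.mulSingle_eq_of_ne (Ne.symm hi), Pi.mul_apply, Pi.mul_apply,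
        Pi.mulSingle_eq_same, Pi.inv_apply, Pi.inv_apply] at e3
      have e4 : (⟨a, ha⟩ : A) = 1 := conj_eq_one_iff.1 e3.symm
      exact congrArg Subtype.val e4
    rw [hr, map_one, mul_one] at hx'
    have hl : x.left = 1 := hfinj (hx'.trans f.map_one.symm)
    exact SemidirectProduct.ext hl hr
  have hFrange : F.range = Z := by
    rw [← hZ]
    apply le_antisymm
    · rintro _ ⟨x, rfl⟩
      rw [← SemidirectProduct.inl_left_mul_inr_right x, map_mul, hFl, hFr]
      have hq (σ) : τ σ ∈ A ⊔ Q := (le_sup_right : Q ≤ A ⊔ Q) (hτ ▸ ⟨σ, rfl⟩)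
      refine mul_mem ?_ (hq _)
      have : f.range ≤ A ⊔ Q := by
        rw [hfr, iSup_le_iff]
        rintro i _ ⟨a, rfl⟩
        rw [hc]
        exact mul_mem (mul_mem (hq _) ((le_sup_left : A ≤ A ⊔ Q) a.2)) (inv_mem (hq _))
      exact this ⟨_, rfl⟩
    · refine sup_le (fun a ha => ⟨SemidirectProduct.inl (Pi.mulSingle 0 ⟨a, ha⟩), ?_⟩) ?_
      · rw [hFl, hf1, hc, Equiv.swap_self]
        simp [← Equiv.Perm.one_def]
      · rw [← hτ]
        rintro _ ⟨σ, rfl⟩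
        exact ⟨SemidirectProduct.inr σ, hFr σ⟩
  refine ⟨(MonoidHom.ofInjective hFinj).trans (MulEquiv.subgroupCongr hFrange),
    fun a => ?_, fun g => ?_⟩
  · change F _ = _
    rw [hFl, hf1, hc, Equiv.swap_self]
    simp [← Equiv.Perm.one_def]
  · rw [← hτ]
    refine exists_congr fun σ => ?_
    change _ ↔ F _ = g
    rw [hFr]

/-! ### Isomorphism types of the factors that are given by permutations -/

theorem setOf_mem_map_word (ws : List (List (Fin 7))) :
    {x | x ∈ ws.map word} = Set.range fun k : Fin ws.length => word (ws.get k) := by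
  ext x
  rw [Set.mem_ofPred_eq, List.mem_map, Set.mem_range]
  constructor
  · rintro ⟨l, hl, rfl⟩
    obtain ⟨i, hi⟩ := List.get_of_mem hl
    exact ⟨i, by rw [hi]⟩
  · rintro ⟨i, rfl⟩
    exact ⟨_, List.get_mem _ _, rfl⟩

theorem wordClosure_eq (ws : List (List (Fin 7))) :
    wordClosure ws = Subgroup.closure (Set.range fun k : Fin ws.length => word (ws.get k)) := by
  rw [wordClosure, setOf_mem_map_word]

theorem word_mem_wordClosure {ws : List (List (Fin 7))} (k : Fin ws.length) :
    word (ws.get k) ∈ wordClosure ws :=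
  Subgroup.subset_closure (List.mem_map_of_mem (List.get_mem _ _))

/-- Each `E l` maps a set with an action of `M` equivariantly to the weights. Rigidity of the images
gives faithfulness for `W`, the last hypothesis gives it for `M`, and matching generators then
determine the isomorphism. -/
theorem wordClosure_mulEquiv_of_check {M Y L : Type} [Group M] (ws : List (List (Fin 7)))
    (h : Fin ws.length → M) (htop : Subgroup.closure (Set.range h) = ⊤)
    (ρ : M →* Function.End Y) (E : L → Y → Fin 27)
    (hE : ∀ k l y, look (wordCode (ws.get k)) (E l y) = (E l (ρ (h k) y) : ℕ)) {pts : List ℕ}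
    (hr : rigid pts = true) (hpts : ∀ p ∈ pts, ∃ l y, (E l y : ℕ) = p)
    (h2 : ∀ m : M, (∀ l y, E l (ρ m y) = E l y) → m = 1) :
    ∃ e : wordClosure ws ≃* M, ∀ k, e ⟨word (ws.get k), word_mem_wordClosure k⟩ = h k := by
  have hE' : ∀ k l y, weightPerm (word (ws.get k)) (E l y) = E l (ρ (h k) y) := fun k l y => by
    apply Fin.ext
    rw [isCode_word, hE]
  obtain ⟨e, he⟩ := exists_mulEquiv_of_equivariant ρ E hE' (fun x hx => by
    refine eq_one_of_rigid hr fun p hp => ?_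
    obtain ⟨l, y, rfl⟩ := hpts p hp
    rw [act_fin, hx]) h2
  let e' := ((MulEquiv.subgroupCongr (wordClosure_eq ws)).trans e).trans
    ((MulEquiv.subgroupCongr htop).trans Subgroup.topEquiv)
  have he' (x : wordClosure ws) (l y) : weightPerm x (E l y) = E l (ρ (e' x) y) :=
    he (MulEquiv.subgroupCongr (wordClosure_eq ws) x) l y
  refine ⟨e', fun k => ?_⟩
  rw [← mul_inv_eq_one]
  refine h2 _ fun l y => ?_
  have h3 : ρ (h k) (ρ (h k)⁻¹ y) = y := by
    change (ρ (h k) * ρ (h k)⁻¹) y = y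
    rw [← map_mul, mul_inv_cancel, map_one]; rfl
  rw [map_mul]
  change E l (ρ _ (ρ _ y)) = _
  rw [← he', hE', h3]

theorem closure_adjacent_swaps (n : ℕ) : Subgroup.closure
    (Set.range fun i : Fin n => Equiv.swap i.castSucc i.succ) = ⊤ := by
  rw [eq_top_iff]
  intro σ _
  have h : σ ∈ Submonoid.closure (Set.range fun i : Fin n => Equiv.swap i.castSucc i.succ) := by
    rw [Equiv.Perm.mclosure_swap_castSucc_succ]; trivial
  exact Subgroup.le_closure_toSubmonoid _ h

/-- The twelve weights not orthogonal to `r₀` form a double six; its two halves are permuted in the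
same natural way. -/
theorem wordClosure_s1_s2_s3_s4_s5 :
    Nonempty (wordClosure [[1], [2], [3], [4], [5]] ≃* SymGrp 6) := by
  obtain ⟨e, -⟩ := wordClosure_mulEquiv_of_check [[1], [2], [3], [4], [5]]
    (fun i : Fin 5 => Equiv.swap i.castSucc i.succ) (closure_adjacent_swaps 5)
    (MulAction.toEndHom (α := Fin 6))
    (![![0, 21, 18, 16, 14, 12], ![1, 22, 19, 17, 15, 13]] : Fin 2 → Fin 6 → Fin 27)
    (by decide +kernel) (pts := [0, 21, 18, 16, 14, 12, 1, 22, 19, 17, 15, 13])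
    (by decide +kernel) (by decide +kernel) (fun m hm => Equiv.ext fun i => by
      have hinj : ∀ i j : Fin 6, (![0, 21, 18, 16, 14, 12] : Fin 6 → Fin 27) i =
        (![0, 21, 18, 16, 14, 12] : Fin 6 → Fin 27) j → i = j := by decide
      exact hinj _ _ (hm 0 i))
  exact ⟨e⟩

theorem wordClosure_s3_s4_s5 : Nonempty (wordClosure [[3], [4], [5]] ≃* SymGrp 4) := by
  obtain ⟨e, -⟩ := wordClosure_mulEquiv_of_check [[3], [4], [5]]
    (fun i : Fin 3 => Equiv.swap i.castSucc i.succ) (closure_adjacent_swaps 3)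
    (MulAction.toEndHom (α := Fin 4))
    (![![2, 3, 4, 5], ![0, 0, 0, 0], ![1, 1, 1, 1], ![18, 16, 14, 12], ![19, 17, 15, 13],
      ![23, 24, 25, 26]] : Fin 6 → Fin 4 → Fin 27)
    (by decide +kernel) (pts := [2, 3, 4, 5, 0, 1, 18, 16, 14, 12, 19, 17, 15, 13, 23, 24, 25, 26])
    (by decide +kernel) (by decide +kernel) (fun m hm => Equiv.ext fun i => by
      have hinj : ∀ i j : Fin 4, (![2, 3, 4, 5] : Fin 4 → Fin 27) i =
        (![2, 3, 4, 5] : Fin 4 → Fin 27) j → i = j := by decide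
      exact hinj _ _ (hm 0 i))
  exact ⟨e⟩

theorem wordClosure_s1_T_s5 : Nonempty (wordClosure [[1], TWord, [5]] ≃* SymGrp 4) := by
  obtain ⟨e, -⟩ := wordClosure_mulEquiv_of_check [[1], TWord, [5]]
    (fun i : Fin 3 => Equiv.swap i.castSucc i.succ) (closure_adjacent_swaps 3)
    (MulAction.toEndHom (α := Fin 4))
    (![![0, 21, 10, 9], ![2, 23, 15, 13], ![6, 6, 6, 6], ![11, 11, 11, 11], ![17, 17, 17, 17],
      ![22, 1, 7, 8], ![24, 3, 12, 14]] : Fin 7 → Fin 4 → Fin 27)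
    (by decide +kernel)
    (pts := [0, 21, 10, 9, 2, 23, 15, 13, 6, 11, 17, 22, 1, 7, 8, 24, 3, 12, 14])
    (by decide +kernel) (by decide +kernel) (fun m hm => Equiv.ext fun i => by
      have hinj : ∀ i j : Fin 4, (![0, 21, 10, 9] : Fin 4 → Fin 27) i =
        (![0, 21, 10, 9] : Fin 4 → Fin 27) j → i = j := by decide
      exact hinj _ _ (hm 0 i))
  exact ⟨e⟩

theorem wordClosure_s4_s5 : Nonempty (wordClosure [[4], [5]] ≃* SymGrp 3) := by
  obtain ⟨e, -⟩ := wordClosure_mulEquiv_of_check [[4], [5]]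
    (fun i : Fin 2 => Equiv.swap i.castSucc i.succ) (closure_adjacent_swaps 2)
    (MulAction.toEndHom (α := Fin 3))
    (![![3, 4, 5], ![0, 0, 0], ![1, 1, 1], ![2, 2, 2], ![6, 7, 8], ![11, 10, 9], ![16, 14, 12],
      ![17, 15, 13], ![18, 18, 18], ![19, 19, 19], ![24, 25, 26]] : Fin 11 → Fin 3 → Fin 27)
    (by decide +kernel)
    (pts := [3, 4, 5, 0, 1, 2, 6, 7, 8, 11, 10, 9, 16, 14, 12, 17, 15, 13, 18, 19, 24, 25, 26])
    (by decide +kernel) (by decide +kernel) (fun m hm => Equiv.ext fun i => by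
      have hinj : ∀ i j : Fin 3, (![3, 4, 5] : Fin 3 → Fin 27) i =
        (![3, 4, 5] : Fin 3 → Fin 27) j → i = j := by decide
      exact hinj _ _ (hm 0 i))
  exact ⟨e⟩

theorem wordClosure_s1_T : Nonempty (wordClosure [[1], TWord] ≃* SymGrp 3) := by
  obtain ⟨e, -⟩ := wordClosure_mulEquiv_of_check [[1], TWord]
    (fun i : Fin 2 => Equiv.swap i.castSucc i.succ) (closure_adjacent_swaps 2)
    (MulAction.toEndHom (α := Fin 3))
    (![![0, 21, 10], ![2, 23, 15], ![4, 25, 19], ![6, 6, 6], ![8, 8, 8], ![9, 9, 9],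
      ![11, 11, 11], ![13, 13, 13], ![22, 1, 7], ![24, 3, 12], ![26, 5, 16]] :
      Fin 11 → Fin 3 → Fin 27)
    (by decide +kernel)
    (pts := [0, 21, 10, 2, 23, 15, 4, 25, 19, 6, 8, 9, 11, 13, 22, 1, 7, 24, 3, 12, 26, 5, 16])
    (by decide +kernel) (by decide +kernel) (fun m hm => Equiv.ext fun i => by
      have hinj : ∀ i j : Fin 3, (![0, 21, 10] : Fin 3 → Fin 27) i =
        (![0, 21, 10] : Fin 3 → Fin 27) j → i = j := by decide
      exact hinj _ _ (hm 0 i))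
  exact ⟨e⟩

theorem closure_pair_swaps : Subgroup.closure
    (Set.range (![Equiv.swap 1 2, Equiv.swap 0 1] : Fin 2 → SymGrp 3)) = ⊤ := by
  rw [eq_top_iff, ← closure_adjacent_swaps 2, Subgroup.closure_le]
  rintro _ ⟨i, rfl⟩
  fin_cases i
  · exact Subgroup.subset_closure ⟨1, rfl⟩
  · exact Subgroup.subset_closure ⟨0, rfl⟩

/-- The diagonal action on pairs combines a natural orbit of length three and a regular orbit of
length six. It is recorded which transpositions correspond to `u₁` and `u₂`, because the wreath
product over `s 0` needs `u₁` to fix the index 0. -/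
theorem wordClosure_u₁_u₂ : ∃ e : wordClosure [u₁Word, u₂Word] ≃* SymGrp 3,
    ∀ k, e ⟨word ([u₁Word, u₂Word].get k), word_mem_wordClosure k⟩ =
      (![Equiv.swap 1 2, Equiv.swap 0 1] : Fin 2 → SymGrp 3) k := by
  refine wordClosure_mulEquiv_of_check [u₁Word, u₂Word] _ closure_pair_swaps
    (MulAction.toEndHom (α := Fin 3 × Fin 3))
    (![fun p => (![![4, 1, 12], ![21, 14, 5], ![15, 25, 22]] : Fin 3 → Fin 3 → Fin 27) p.1 p.2,
      fun p => (![![4, 2, 9], ![18, 14, 8], ![17, 24, 22]] : Fin 3 → Fin 3 → Fin 27) p.1 p.2] :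
      Fin 2 → Fin 3 × Fin 3 → Fin 27)
    (by decide +kernel)
    (pts := [4, 1, 12, 21, 14, 5, 15, 25, 22, 2, 9, 18, 8, 17, 24])
    (by decide +kernel) (by decide +kernel) (fun m hm => Equiv.ext fun i => ?_)
  have hinj : ∀ i j : Fin 3, (![![4, 1, 12], ![21, 14, 5], ![15, 25, 22]] :
    Fin 3 → Fin 3 → Fin 27) i i = (![![4, 1, 12], ![21, 14, 5], ![15, 25, 22]] :
    Fin 3 → Fin 3 → Fin 27) j j → i = j := by decide
  exact hinj _ _ (hm 0 (i, i))

/-- The action of `SL₂(𝔽₃)` on column vectors. -/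
def sl2Action : SpecialLinearGroup (Fin 2) (ZMod 3) →* Function.End (Fin 2 → ZMod 3) where
  toFun M v := M.1 *ᵥ v
  map_one' := by funext v; exact one_mulVec v
  map_mul' M N := by funext v; exact (mulVec_mulVec v M.1 N.1).symm

def sl2Generator : Fin 2 → SpecialLinearGroup (Fin 2) (ZMod 3) :=
  ![⟨!![1, 1; 0, 1], by decide⟩, ⟨!![1, 0; 2, 1], by decide⟩]

/-- Every matrix of determinant one over the field of three elements is a product upper · lower ·
upper · lower of unitriangular matrices; the exponents are found by enumeration. -/
theorem closure_sl2Generator : Subgroup.closure (Set.range sl2Generator) = ⊤ := by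
  rw [eq_top_iff]
  intro m _
  have h : ∀ a b c d : ZMod 3, a * d - b * c = 1 → ∃ i j k l : Fin 3,
      !![a, b; c, d] = (sl2Generator 0).1 ^ (i : ℕ) * (sl2Generator 1).1 ^ (j : ℕ) *
        (sl2Generator 0).1 ^ (k : ℕ) * (sl2Generator 1).1 ^ (l : ℕ) := by decide +kernel
  obtain ⟨i, j, k, l, h⟩ := h (m.1 0 0) (m.1 0 1) (m.1 1 0) (m.1 1 1)
    (by rw [← det_fin_two]; exact m.2)
  have hm : m = sl2Generator 0 ^ (i : ℕ) * sl2Generator 1 ^ (j : ℕ) *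
      sl2Generator 0 ^ (k : ℕ) * sl2Generator 1 ^ (l : ℕ) :=
    Subtype.ext (by rw [← eta_fin_two] at h; simpa using h)
  have hmem (i) : sl2Generator i ∈ Subgroup.closure (Set.range sl2Generator) :=
    Subgroup.subset_closure ⟨i, rfl⟩
  rw [hm]
  exact mul_mem (mul_mem (mul_mem (pow_mem (hmem _) _) (pow_mem (hmem _) _))
    (pow_mem (hmem _) _)) (pow_mem (hmem _) _)

/-- The 27 weights split into three copies of the plane over the field of three elements, on each of
which the group acts linearly; the three origins are the fixed weights. -/
theorem wordClosure_Ts3_s5s4 : Nonempty (wordClosure [TWord ++ [3], [5, 4]] ≃*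
    SpecialLinearGroup (Fin 2) (ZMod 3)) := by
  let E : Fin 3 → (Fin 2 → ZMod 3) → Fin 27 := ![
    fun v => (![![0, 18, 2], ![4, 5, 3], ![14, 16, 12]] : Fin 3 → Fin 3 → Fin 27) (v 0) (v 1),
    fun v => (![![20, 1, 21], ![6, 7, 8], ![11, 9, 10]] : Fin 3 → Fin 3 → Fin 27) (v 0) (v 1),
    fun v => (![![22, 19, 23], ![13, 17, 15], ![26, 25, 24]] :
      Fin 3 → Fin 3 → Fin 27) (v 0) (v 1)]
  obtain ⟨e, -⟩ := wordClosure_mulEquiv_of_check [TWord ++ [3], [5, 4]] sl2Generator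
    closure_sl2Generator sl2Action E (by decide +kernel)
    (pts := List.range 27) (by decide +kernel) (by decide +kernel) (fun m hm => by
      have hinj : ∀ v w, E 0 v = E 0 w → v = w := by decide +kernel
      have h (v : Fin 2 → ZMod 3) : m.1 *ᵥ v = v := hinj _ _ (hm 0 v)
      refine Subtype.ext (Matrix.ext_of_mulVec_single fun i => ?_)
      rw [h]; exact (one_mulVec _).symm)
  exact ⟨e⟩

/-! ### Cyclic factors -/

/-- The order of the element with the given word is `n`. -/
def checkOrder (l : List (Fin 7)) (n : ℕ) : Bool :=
  Nat.blt 0 n && Nat.beq (wordCode (List.replicate n l).flatten) (wordCode []) &&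
    (List.range n).all fun m => Nat.beq m 0 ||
      (List.range 27).any fun j => !Nat.beq (look (wordCode (List.replicate m l).flatten) j) j

theorem orderOf_word {l : List (Fin 7)} {n : ℕ} (h : checkOrder l n = true) :
    orderOf (word l) = n := by
  simp only [checkOrder, Bool.and_eq_true, Nat.blt_eq, Nat.beq_eq, List.all_eq_true] at h
  obtain ⟨⟨h1, h2⟩, h3⟩ := h
  rw [orderOf_eq_iff h1]
  refine ⟨by rw [word_pow, word_eq_word h2, word_nil], fun m hm hm0 hx => ?_⟩
  have := h3 m (List.mem_range.2 hm)
  rw [Bool.or_eq_true, Nat.beq_eq, List.any_eq_true] at this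
  obtain ⟨j, hj, h4⟩ := this.resolve_left hm0.ne'
  rw [word_pow] at hx
  rw [← (isCode_word _).act_eq (List.mem_range.1 hj), hx, act_one] at h4
  simp at h4

theorem wordClosure_singleton {l : List (Fin 7)} {n : ℕ} [NeZero n] (h : checkOrder l n = true) :
    Nonempty (wordClosure [l] ≃* Cyc n) := by
  have h1 : wordClosure [l] = Subgroup.zpowers (word l) := by
    rw [wordClosure, Subgroup.zpowers_eq_closure]
    simp
  have h2 : Nat.card (wordClosure [l]) = Nat.card (Cyc n) := by
    rw [h1, Nat.card_zpowers, orderOf_word h]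
    simp [Cyc]
  have h3 : IsCyclic (wordClosure [l]) := h1 ▸ inferInstance
  exact ⟨mulEquivOfCyclicCardEq h2⟩

/-! ### Wreath products in `W` -/

theorem closure_le_fixing {S : Set W} {pts : List ℕ} (h : ∀ x ∈ S, ∀ p ∈ pts, act x p = p) :
    Subgroup.closure S ≤ fixingCentralizer ⊤ pts := by
  rw [Subgroup.closure_le]
  exact fun x hx => ⟨trivial, h x hx⟩

/-- Independence is certified by fixed weights: the `i`-th conjugate fixes `P i`, all the other
conjugates fix `R i`, and the two lists together are rigid. -/
theorem isInternalWreathProduct_of_check {n : ℕ} [NeZero n] (ws qs : List (List (Fin 7)))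
    (τ : Equiv.Perm (Fin n) →* W) (hτ : τ.range = wordClosure qs) (v : Fin n → List (Fin 7))
    (hv : ∀ i, τ (Equiv.swap 0 i) = word (v i))
    (hne : ∃ w ∈ ws, ∃ j < 27, look (wordCode w) j ≠ j)
    (hstab : ∀ σ : Equiv.Perm (Fin n), σ 0 = 0 → ∀ w ∈ ws, Commute (τ σ) (word w))
    (hcomm : ∀ i ≠ 0, ∀ w ∈ ws, ∀ w' ∈ ws,
      wordCode (w ++ (v i ++ w' ++ (v i).reverse)) = wordCode ((v i ++ w' ++ (v i).reverse) ++ w))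
    (P R : Fin n → List ℕ) (hr : ∀ i, rigid (P i ++ R i) = true)
    (hP : ∀ i, ∀ w ∈ ws, ∀ p ∈ P i, look (wordCode (v i ++ w ++ (v i).reverse)) p = p)
    (hR : ∀ i j, i ≠ j → ∀ w ∈ ws, ∀ p ∈ R i, look (wordCode (v j ++ w ++ (v j).reverse)) p = p) :
    IsInternalWreathProduct n (wordClosure ws) (wordClosure qs) (wordClosure (ws ++ qs)) := by
  have hconj (i) (w) : word (v i ++ w ++ (v i).reverse) =
      τ (Equiv.swap 0 i) * word w * (τ (Equiv.swap 0 i))⁻¹ := by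
    rw [word_append, word_append, hv, word_inv]
  have hlt (i) : ∀ p ∈ P i ++ R i, p < 27 := fun p hp => by
    have := hr i
    rw [rigid, Bool.and_eq_true, List.all_eq_true] at this
    simpa [Nat.blt_eq] using this.1 p hp
  have hmap (i) : (wordClosure ws).map (MulAut.conj (τ (Equiv.swap 0 i))).toMonoidHom =
      Subgroup.closure ((fun x => τ (Equiv.swap 0 i) * x * (τ (Equiv.swap 0 i))⁻¹) ''
        {x | x ∈ ws.map word}) := by
    rw [wordClosure, MonoidHom.map_closure]; rfl
  refine isInternalWreathProduct τ hτ ?_ ?_ ?_ ?_ ?_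
  · rw [wordClosure, wordClosure, ← Subgroup.closure_union, wordClosure]
    congr 1
    ext x
    simp
  · obtain ⟨w, hw, j, hj, hne⟩ := hne
    intro hbot
    have h1 : word w ∈ wordClosure ws := Subgroup.subset_closure (List.mem_map_of_mem hw)
    rw [hbot, Subgroup.mem_bot] at h1
    exact hne (by rw [← (isCode_word w).act_eq hj, h1, act_one])
  · intro σ hσ a ha
    refine commute_of_mem_closure (S := {τ σ}) ?_
      (Subgroup.subset_closure (Set.mem_singleton _)) ha
    rintro _ rfl y hy
    obtain ⟨w, hw, rfl⟩ := List.mem_map.1 hy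
    exact hstab σ hσ w hw
  · intro i hi a ha b hb
    have hb' : τ (Equiv.swap 0 i) * b * (τ (Equiv.swap 0 i))⁻¹ ∈
        (wordClosure ws).map (MulAut.conj (τ (Equiv.swap 0 i))).toMonoidHom := ⟨b, hb, rfl⟩
    rw [hmap] at hb'
    refine commute_of_mem_closure ?_ ha hb'
    intro x hx y hy
    obtain ⟨w, hw, rfl⟩ := List.mem_map.1 hx
    obtain ⟨_, hy, rfl⟩ := hy
    obtain ⟨w', hw', rfl⟩ := List.mem_map.1 hy
    have := word_eq_word (hcomm i hi w hw w' hw')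
    rw [word_append, word_append _ w, hconj] at this
    exact this
  · intro i
    rw [Subgroup.disjoint_def]
    intro x hx1 hx2
    have h1 : x ∈ fixingCentralizer ⊤ (P i) := by
      beta_reduce at hx1
      rw [hmap] at hx1
      refine closure_le_fixing ?_ hx1
      rintro _ ⟨_, hy, rfl⟩ p hp
      obtain ⟨w, hw, rfl⟩ := List.mem_map.1 hy
      change act (_ * _ * _) p = p
      rw [← hconj, (isCode_word _).act_eq (hlt i p (List.mem_append_left _ hp))]
      exact hP i w hw p hp
    have h2 : x ∈ fixingCentralizer ⊤ (R i) := by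
      refine (iSup₂_le fun j hj => ?_ : (⨆ j, ⨆ _ : j ≠ i, _) ≤ fixingCentralizer ⊤ (R i)) hx2
      beta_reduce
      rw [hmap]
      refine closure_le_fixing ?_
      rintro _ ⟨_, hy, rfl⟩ p hp
      obtain ⟨w, hw, rfl⟩ := List.mem_map.1 hy
      change act (_ * _ * _) p = p
      rw [← hconj, (isCode_word _).act_eq (hlt i p (List.mem_append_right _ hp))]
      exact hR i j (Ne.symm hj) w hw p hp
    refine eq_one_of_rigid (hr i) fun p hp => ?_
    rcases List.mem_append.1 hp with hp | hp
    · exact h1.2 p hp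
    · exact h2.2 p hp

/-- The homomorphism from `S₂` that is given by an involution. -/
def permTwoHom {G : Type} [Group G] (u : G) (hu : u * u = 1) : Equiv.Perm (Fin 2) →* G :=
  MonoidHom.mk' (fun σ => if σ = 1 then 1 else u) (by
    have h : ∀ σ : Equiv.Perm (Fin 2), σ = 1 ∨ σ = Equiv.swap 0 1 := by decide
    have h1 : Equiv.swap (0 : Fin 2) 1 ≠ 1 := by decide
    intro σ ρ
    rcases h σ with rfl | rfl <;> rcases h ρ with rfl | rfl <;> simp [h1, hu])

theorem isInternalWreathProduct_two (ws : List (List (Fin 7))) (u : List (Fin 7))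
    (hu : wordCode (u ++ u) = wordCode [])
    (hne : ∃ w ∈ ws, ∃ j < 27, look (wordCode w) j ≠ j)
    (hcomm : ∀ w ∈ ws, ∀ w' ∈ ws,
      wordCode (w ++ (u ++ w' ++ u.reverse)) = wordCode ((u ++ w' ++ u.reverse) ++ w))
    (P R : List ℕ) (hr : rigid (P ++ R) = true) (hr' : rigid (R ++ P) = true)
    (hP : ∀ w ∈ ws, ∀ p ∈ P, look (wordCode w) p = p)
    (hR : ∀ w ∈ ws, ∀ p ∈ R, look (wordCode (u ++ w ++ u.reverse)) p = p) :
    IsInternalWreathProduct 2 (wordClosure ws) (wordClosure [u]) (wordClosure (ws ++ [u])) := by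
  have hu' : word u * word u = 1 := by rw [← word_append, word_eq_word hu, word_nil]
  have h1 : Equiv.swap (0 : Fin 2) 1 ≠ 1 := by decide
  have hswap : permTwoHom (word u) hu' (Equiv.swap 0 1) = word u :=
    if_neg (t := (1 : W)) h1
  refine isInternalWreathProduct_of_check ws [u] (permTwoHom (word u) hu') ?_ ![[], u] ?_ hne ?_
    ?_ ![P, R] ![R, P] ?_ ?_ ?_
  · have h : ∀ σ : Equiv.Perm (Fin 2), σ = 1 ∨ σ = Equiv.swap 0 1 := by decide
    apply le_antisymm
    · rintro _ ⟨σ, rfl⟩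
      rcases h σ with rfl | rfl
      · rw [map_one]; exact one_mem _
      · rw [hswap]
        exact Subgroup.subset_closure (by simp)
    · rw [wordClosure, Subgroup.closure_le]
      intro x hx
      have hx : x = word u := by simpa using hx
      exact ⟨Equiv.swap 0 1, by rw [hx, hswap]⟩
  · intro i
    fin_cases i
    · change permTwoHom (word u) hu' (Equiv.swap 0 0) = word []
      rw [Equiv.swap_self, ← Equiv.Perm.one_def, map_one, word_nil]
    · exact hswap
  · have h : ∀ σ : Equiv.Perm (Fin 2), σ 0 = 0 → σ = 1 := by decide
    intro σ hσ w _
    rw [h σ hσ, map_one]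
    exact Commute.one_left _
  · intro i hi
    fin_cases i
    · exact absurd rfl hi
    · exact hcomm
  · intro i
    fin_cases i
    · exact hr
    · exact hr'
  · intro i
    fin_cases i
    · intro w hw p hp
      simpa using hP w hw p hp
    · exact hR
  · intro i j hij
    fin_cases i <;> fin_cases j
    · exact absurd rfl hij
    · exact hR
    · intro w hw p hp
      simpa using hP w hw p hp
    · exact absurd rfl hij

theorem wreath_s0_u₂ : IsInternalWreathProduct 2 (wordClosure [[0]]) (wordClosure [u₂Word])
    (wordClosure [[0], u₂Word]) :=
  isInternalWreathProduct_two [[0]] u₂Word (by decide +kernel) (by decide +kernel)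
    (by decide +kernel) [2, 3, 4, 5, 6, 7, 8, 9, 10, 11, 20, 23, 24, 25, 26]
    [6, 7, 8, 9, 10, 11, 12, 13, 14, 15, 16, 17, 18, 19, 20] (by decide +kernel)
    (by decide +kernel) (by decide +kernel) (by decide +kernel)

theorem wreath_s1_s2_u₁ : IsInternalWreathProduct 2 (wordClosure [[1], [2]])
    (wordClosure [u₁Word]) (wordClosure [[1], [2], u₁Word]) :=
  isInternalWreathProduct_two [[1], [2]] u₁Word (by decide +kernel) (by decide +kernel)
    (by decide +kernel) [9, 10, 11, 12, 13, 14, 15, 16, 17] [0, 1, 2, 18, 19, 20, 21, 22, 23]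
    (by decide +kernel) (by decide +kernel) (by decide +kernel) (by decide +kernel)

theorem wreath_s1_u₁ : IsInternalWreathProduct 2 (wordClosure [[1]]) (wordClosure [u₁Word])
    (wordClosure [[1], u₁Word]) :=
  isInternalWreathProduct_two [[1]] u₁Word (by decide +kernel) (by decide +kernel)
    (by decide +kernel) [6, 7, 8, 9, 10, 11, 12, 13, 14, 15, 16, 17, 18, 19, 20]
    [0, 1, 2, 3, 6, 11, 16, 17, 18, 19, 20, 21, 22, 23, 24] (by decide +kernel)
    (by decide +kernel) (by decide +kernel) (by decide +kernel)

theorem wreath_s0s6_u₂ : IsInternalWreathProduct 2 (wordClosure [[0, 6]]) (wordClosure [u₂Word])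
    (wordClosure [[0, 6], u₂Word]) :=
  isInternalWreathProduct_two [[0, 6]] u₂Word (by decide +kernel) (by decide +kernel)
    (by decide +kernel) [3, 4, 5, 6, 7, 8, 24, 25, 26] [9, 10, 11, 12, 13, 14, 15, 16, 17]
    (by decide +kernel) (by decide +kernel) (by decide +kernel) (by decide +kernel)

/-- `u₁` centralises `s 0` because `r₀` is one of its four orthogonal roots, while `u₂` and `u₃`
conjugate `s 0` to `s 1` and `s 5`. -/
theorem wreath_s0_u₁_u₂ : IsInternalWreathProduct 3 (wordClosure [[0]])
    (wordClosure [u₁Word, u₂Word]) (wordClosure [[0], u₁Word, u₂Word]) := by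
  obtain ⟨e, he⟩ := wordClosure_u₁_u₂
  let τ : SymGrp 3 →* W := (wordClosure [u₁Word, u₂Word]).subtype.comp e.symm.toMonoidHom
  have hτ (k : Fin 2) : τ ((![Equiv.swap 1 2, Equiv.swap 0 1] : Fin 2 → SymGrp 3) k) =
      word ([u₁Word, u₂Word].get k) := by
    rw [← he]
    change ((e.symm (e _) : wordClosure [u₁Word, u₂Word]) : W) = _
    rw [MulEquiv.symm_apply_apply]
  have h12 : τ (Equiv.swap 1 2) = word u₁Word := hτ 0
  have h01 : τ (Equiv.swap 0 1) = word u₂Word := hτ 1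
  refine isInternalWreathProduct_of_check [[0]] [u₁Word, u₂Word] τ ?_
    ![[], u₂Word, u₁Word ++ u₂Word ++ u₁Word] ?_ (by decide +kernel) ?_ (by decide +kernel)
    ![[2, 3, 4, 5, 6, 7, 8, 9, 10, 11, 20, 23, 24, 25, 26],
      [6, 7, 8, 9, 10, 11, 12, 13, 14, 15, 16, 17, 18, 19, 20],
      [0, 1, 2, 3, 6, 11, 16, 17, 18, 19, 20, 21, 22, 23, 24]]
    ![[6, 11, 16, 17, 18, 19, 20], [2, 3, 6, 11, 20, 23, 24], [6, 7, 8, 9, 10, 11, 20]]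
    (by decide +kernel) (by decide +kernel) (by decide +kernel)
  · rw [MonoidHom.range_comp, MonoidHom.range_eq_top.2 e.symm.surjective, ← MonoidHom.range_eq_map,
      Subgroup.range_subtype]
  · intro i
    fin_cases i
    · change τ (Equiv.swap 0 0) = word []
      rw [Equiv.swap_self, ← Equiv.Perm.one_def, map_one, word_nil]
    · exact h01
    · change τ (Equiv.swap 0 2) = word (u₁Word ++ u₂Word ++ u₁Word)
      have : (Equiv.swap 0 2 : SymGrp 3) = Equiv.swap 1 2 * Equiv.swap 0 1 * Equiv.swap 1 2 := by
        decide
      rw [this, map_mul, map_mul, h12, h01, word_append, word_append]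
  · have h : ∀ σ : SymGrp 3, σ 0 = 0 → σ = 1 ∨ σ = Equiv.swap 1 2 := by decide
    intro σ hσ w hw
    rw [List.mem_singleton] at hw
    subst hw
    rcases h σ hσ with rfl | rfl
    · rw [map_one]
      exact Commute.one_left _
    · rw [h12, Commute, SemiconjBy, ← word_append, ← word_append]
      exact word_eq_word (by decide +kernel)

/-! ### Isomorphism types of the wreath products -/

theorem IsInternalWreathProduct.mulEquiv {G D : Type} [Group G] [Group D] {n : ℕ} [NeZero n]
    {A Q Z : Subgroup G} (h : IsInternalWreathProduct n A Q Z) (hA : Nonempty (A ≃* D)) :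
    Nonempty (Z ≃* Wreath D n) := by
  obtain ⟨e, -⟩ := h
  obtain ⟨f⟩ := hA
  exact ⟨e.symm.trans (wreathCongr f n)⟩

theorem wordClosure_s1_s2 : Nonempty (wordClosure [[1], [2]] ≃* SymGrp 3) := by
  obtain ⟨e, -⟩ := wordClosure_mulEquiv_of_check [[1], [2]]
    (fun i : Fin 2 => Equiv.swap i.castSucc i.succ) (closure_adjacent_swaps 2)
    (MulAction.toEndHom (α := Fin 3))
    (![![0, 21, 18], ![1, 22, 19], ![2, 23, 20], ![24, 3, 6], ![25, 4, 7], ![26, 5, 8], ![9,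
      9, 9], ![10, 10, 10], ![11, 11, 11], ![12, 12, 12], ![13, 13, 13], ![14, 14, 14],
      ![15, 15, 15], ![16, 16, 16], ![17, 17, 17]] : Fin 15 → Fin 3 → Fin 27)
    (by decide +kernel)
    (pts := [0, 1, 2, 3, 4, 5, 6, 7, 8, 9, 10, 11, 12, 13, 14, 15, 16, 17, 18, 19, 20, 21, 22, 23, 24,
      25, 26])
    (by decide +kernel) (by decide +kernel) (fun m hm => Equiv.ext fun i => by
      have hinj : ∀ i j : Fin 3, (![0, 21, 18] : Fin 3 → Fin 27) i =
        (![0, 21, 18] : Fin 3 → Fin 27) j → i = j := by decide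
      exact hinj _ _ (hm 0 i))
  exact ⟨e⟩

theorem card_wreath (D : Type) [Group D] (n : ℕ) :
    Nat.card (Wreath D n) = Nat.card D ^ n * n.factorial := by
  rw [SemidirectProduct.card, Nat.card_fun, Nat.card_perm, Nat.card_fin]

/-- The square of `x` is the central element with both coordinates nontrivial, so `x` has order four
and plays the rotation; `y` inverts it. -/
theorem dihedral_mulEquiv_wreath : Nonempty (Wreath (Cyc 2) 2 ≃* DihedralGroup 4) := by
  let x : Wreath (Cyc 2) 2 := ⟨![Multiplicative.ofAdd 1, 1], Equiv.swap 0 1⟩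
  let y : Wreath (Cyc 2) 2 := ⟨1, Equiv.swap 0 1⟩
  let f : DihedralGroup 4 → Wreath (Cyc 2) 2
    | .r i => x ^ i.val
    | .sr i => y * x ^ i.val
  have hmul : ∀ a b, (f (a * b)).left = (f a * f b).left ∧
      (f (a * b)).right = (f a * f b).right := by
    decide +kernel
  have hinj : ∀ a b, (f a).left = (f b).left ∧ (f a).right = (f b).right → a = b := by
    decide +kernel
  have hmul' (a b) : f (a * b) = f a * f b := SemidirectProduct.ext (hmul a b).1 (hmul a b).2
  have : Finite (Wreath (Cyc 2) 2) := Finite.of_equiv _ SemidirectProduct.equivProd.symm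
  have hbij : Function.Bijective (MonoidHom.mk' f hmul') := by
    refine (Nat.bijective_iff_injective_and_card _).2 ⟨fun a b h => hinj a b ?_, ?_⟩
    · exact ⟨congrArg _ h, congrArg _ h⟩
    · rw [DihedralGroup.nat_card, card_wreath]
      simp [Cyc, Nat.factorial]
  exact ⟨(MulEquiv.ofBijective _ hbij).symm⟩

/-! ### Subgroups of `W` as matrix groups -/

theorem word_flatten (l : List (List (Fin 7))) : word l.flatten = (l.map word).prod := by
  induction l with
  | nil => exact word_nil
  | cons a l ih => rw [List.flatten_cons, word_append, ih, List.map_cons, List.prod_cons]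

/-- The index lists `ks` write each generator of one group as a product of generators of the other.
-/
theorem wordClosure_le_of_words {ws vs : List (List (Fin 7))} (ks : Fin ws.length → List ℕ)
    (h : ∀ i, wordCode (ws.get i) = wordCode ((ks i).map fun k => vs.getD k []).flatten) :
    wordClosure ws ≤ wordClosure vs := by
  rw [wordClosure_eq ws, Subgroup.closure_le]
  rintro _ ⟨i, rfl⟩
  change word (ws.get i) ∈ wordClosure vs
  rw [word_eq_word (h i), word_flatten]
  refine Subgroup.list_prod_mem _ fun x hx => ?_
  obtain ⟨w, hw, rfl⟩ := List.mem_map.1 hx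
  obtain ⟨k, -, rfl⟩ := List.mem_map.1 hw
  by_cases hk : k < vs.length
  · rw [List.getD_eq_getElem _ _ hk]
    exact Subgroup.subset_closure (List.mem_map_of_mem (List.getElem_mem hk))
  · rw [List.getD_eq_default _ _ (not_lt.1 hk), word_nil]
    exact one_mem _

/-- The pairs of a group element and a matrix that agree on the columns of `Q`. -/
def intertwiners {G K : Type} [Group G] [CommRing K] {m n : ℕ} (A : G →* Matrix (Fin m) (Fin m) K)
    (Q : Matrix (Fin m) (Fin n) K) : Subgroup (G × GL (Fin n) K) where
  carrier := {p | A p.1 * Q = Q * (p.2 : Matrix (Fin n) (Fin n) K)}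
  one_mem' := by
    change A 1 * Q = Q * ((1 : GL (Fin n) K) : Matrix (Fin n) (Fin n) K)
    rw [map_one, Matrix.one_mul, Units.val_one, Matrix.mul_one]
  mul_mem' {p q} hp hq := by
    change A (p.1 * q.1) * Q = Q * ((p.2 * q.2 : GL (Fin n) K) : Matrix (Fin n) (Fin n) K)
    have hp : A p.1 * Q = _ := hp
    have hq : A q.1 * Q = _ := hq
    rw [map_mul, Matrix.mul_assoc, hq, ← Matrix.mul_assoc, hp, Matrix.mul_assoc, Units.val_mul]
  inv_mem' {p} hp := by
    change A p.1⁻¹ * Q = Q * ((p.2⁻¹ : GL (Fin n) K) : Matrix (Fin n) (Fin n) K)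
    have hp : A p.1 * Q = _ := hp
    have h1 : Q = A p.1 * Q * ((p.2⁻¹ : GL (Fin n) K) : Matrix (Fin n) (Fin n) K) := by
      rw [hp, Matrix.mul_assoc, ← Units.val_mul, mul_inv_cancel, Units.val_one, Matrix.mul_one]
    conv_lhs => rw [h1]
    rw [Matrix.mul_assoc, ← Matrix.mul_assoc, ← map_mul, inv_mul_cancel, map_one, Matrix.one_mul]

/-- Six of the weights form a basis with integral inverse, so they separate columns over every
commutative ring. -/
theorem eq_of_weights {R : Type} [CommRing R] {n : ℕ} {X Y : Matrix (Fin 6) (Fin n) R}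
    (h : ∀ j : Fin 27, (fun i => (wt j i : R)) ᵥ* X = (fun i => (wt j i : R)) ᵥ* Y) : X = Y := by
  let J : Fin 6 → Fin 27 := ![0, 1, 2, 3, 4, 8]
  let N : Matrix (Fin 6) (Fin 6) ℤ := ![![1, 0, 0, 0, 0, 0], ![2, 0, 0, -1, -1, -1],
    ![2, -1, -1, 0, 0, 0], ![1, -1, -1, 0, 1, 1], ![0, -1, -1, 1, 1, 2], ![1, -1, 0, 0, 0, 0]]
  have hN : N * Matrix.of (fun i => wt (J i)) = 1 := by decide +kernel
  have hN' : N.map (Int.castRingHom R) *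
      (Matrix.of (fun i => wt (J i))).map (Int.castRingHom R) = 1 := by
    rw [← Matrix.map_mul, hN, Matrix.map_one _ (map_zero _) (map_one _)]
  have h1 : (Matrix.of (fun i => wt (J i))).map (Int.castRingHom R) * X =
      (Matrix.of (fun i => wt (J i))).map (Int.castRingHom R) * Y :=
    funext fun i => h (J i)
  rw [← Matrix.one_mul X, ← hN', Matrix.mul_assoc, h1, ← Matrix.mul_assoc, hN', Matrix.one_mul]

theorem weight_vecMul_mat {R : Type} [CommRing R] (x : W) (j : Fin 27) :
    (fun i => (wt (weightPerm x j) i : R)) ᵥ* (mat x).map (Int.cast : ℤ → R) =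
      fun i => (wt j i : R) := by
  conv_rhs => rw [← wt_weightPerm x j]
  funext i
  exact (RingHom.map_vecMul (Int.castRingHom R) (mat x) (wt (weightPerm x j)) i).symm

/-- The action of a word on the columns is tested on the 27 weights, where it is a known
permutation, so the matrix of the word is never multiplied out. The scalar `d` clears the
denominators of `M`. -/
theorem mat_mul_of_weights {R : Type} [CommRing R] {n : ℕ} {w : List (Fin 7)} {d : R}
    {P : Matrix (Fin 6) (Fin n) R} {M : Matrix (Fin n) (Fin n) R}
    (h : ∀ j : Fin 27, d • ((fun i => (wt j i : R)) ᵥ* P) =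
      ((fun i => (wt (Fin.ofNat 27 (look (wordCode w) j)) i : R)) ᵥ* P) ᵥ* M) :
    d • ((mat (word w)).map (Int.cast : ℤ → R) * P) = P * M := by
  refine eq_of_weights fun j => ?_
  obtain ⟨j, rfl⟩ := (weightPerm (word w)).surjective j
  have h1 : Fin.ofNat 27 (look (wordCode w) j) = weightPerm (word w) j := by
    rw [← isCode_word w j]
    exact Fin.ofNat_val_eq_self _
  rw [vecMul_smul, ← Matrix.vecMul_vecMul, weight_vecMul_mat, h j, h1, Matrix.vecMul_vecMul]

/-- Let the generators of a subgroup of `W` map the columns of `P` to linear combinations of these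
columns. If the weights can be recovered from their values on the columns, then the subgroup is
isomorphic to the group that the matrices of these linear combinations generate. -/
theorem exists_mulEquiv_GL {K R : Type} [CommRing K] [IsDomain K] [CommRing R] (f : R →+* K)
    (hf : Function.Injective f) {n : ℕ} (ws : List (List (Fin 7)))
    (h : Fin ws.length → GL (Fin n) K) (S : GL (Fin n) K) (P : Matrix (Fin 6) (Fin n) R)
    {d e : R} (hd : f d ≠ 0) (he : f e ≠ 0) (M : Fin ws.length → Matrix (Fin n) (Fin n) R)
    (hM : ∀ k, f d • ((S : Matrix (Fin n) (Fin n) K) * (h k : Matrix (Fin n) (Fin n) K)) =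
      (M k).map f * (S : Matrix (Fin n) (Fin n) K))
    (hPM : ∀ k, ∀ j : Fin 27, d • ((fun i => (wt j i : R)) ᵥ* P) =
      ((fun i => (wt (Fin.ofNat 27 (look (wordCode (ws.get k)) j)) i : R)) ᵥ* P) ᵥ* M k)
    (L : Matrix (Fin n) (Fin 6) R) (hL : L * P = e • (1 : Matrix (Fin n) (Fin n) R))
    {pts : List (Fin 27)} (hr : rigid (pts.map Fin.val) = true)
    (huniq : ∀ p ∈ pts, ∀ j : Fin 27,
      (fun i => (wt j i : R)) ᵥ* P = (fun i => (wt p i : R)) ᵥ* P → j = p) :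
    ∃ φ : wordClosure ws ≃* Subgroup.closure (Set.range h),
      ∀ k, (φ ⟨word (ws.get k), word_mem_wordClosure k⟩ : GL (Fin n) K) = h k := by
  have hP (k) := mat_mul_of_weights (hPM k)
  let c : ℤ →+* R := Int.castRingHom R
  let A : W →* Matrix (Fin 6) (Fin 6) K :=
    f.mapMatrix.toMonoidHom.comp (c.mapMatrix.toMonoidHom.comp mat)
  -- `S` changes from the coordinates of the integral computation to those in which `h` is given.
  obtain ⟨Q, hQP⟩ : ∃ Q, Q = P.map f * (S : Matrix (Fin n) (Fin n) K) := ⟨_, rfl⟩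
  have hL' : L.map f * Q = f e • (S : Matrix (Fin n) (Fin n) K) := by
    have : L.map f * P.map f = f e • (1 : Matrix (Fin n) (Fin n) K) := by
      rw [← Matrix.map_mul, hL]
      ext i j
      simp [Matrix.one_apply, apply_ite f]
    rw [hQP, ← Matrix.mul_assoc, this, Matrix.smul_mul, Matrix.one_mul]
  have hQ (k) : A (word (ws.get k)) * Q = Q * (h k : Matrix (Fin n) (Fin n) K) := by
    have h1 : f d • (A (word (ws.get k)) * P.map f) = P.map f * (M k).map f := by
      rw [← Matrix.map_mul, ← hP k]
      ext i j
      rw [Matrix.smul_apply, Matrix.map_apply, Matrix.smul_apply, smul_eq_mul, smul_eq_mul, map_mul]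
      congr 1
      exact (congrFun (congrFun (Matrix.map_mul (f := f)) i) j).symm
    have h2 : f d • (A (word (ws.get k)) * Q) =
        f d • (Q * (h k : Matrix (Fin n) (Fin n) K)) := by
      rw [hQP, ← Matrix.mul_assoc, ← Matrix.smul_mul, h1, Matrix.mul_assoc, ← hM k, Matrix.mul_smul,
        Matrix.mul_assoc (P.map f)]
    exact smul_right_injective _ hd h2
  let D := intertwiners A Q
  -- Up to the nonzero scalar `e`, `L` is a left inverse of `P`; so the columns are independent and
  -- an element determines its matrix.
  have hD2 (m : GL (Fin n) K) (hm : (1, m) ∈ D) : m = 1 := by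
    have hm : A 1 * Q = Q * (m : Matrix (Fin n) (Fin n) K) := hm
    rw [map_one, Matrix.one_mul] at hm
    have h1 := congrArg (fun X => L.map f * X) hm
    beta_reduce at h1
    rw [← Matrix.mul_assoc, hL', Matrix.smul_mul] at h1
    have h2 : S * 1 = S * m := Units.ext (by
      rw [mul_one, Units.val_mul]
      exact smul_right_injective _ he h1)
    exact (mul_left_cancel h2).symm
  obtain ⟨φ, hφ⟩ := exists_mulEquiv_closure (D := D) (g := fun k => word (ws.get k)) (h := h) hQ
    (fun x hx => by
      have hx : A x * Q = Q * ((1 : GL (Fin n) K) : Matrix (Fin n) (Fin n) K) := hx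
      rw [Units.val_one, Matrix.mul_one, hQP, ← Matrix.mul_assoc] at hx
      have h1 : A x * P.map f = P.map f := by
        have h2 := congrArg (fun X => X * ((S⁻¹ : GL (Fin n) K) : Matrix (Fin n) (Fin n) K)) hx
        beta_reduce at h2
        rwa [Matrix.mul_assoc, Matrix.mul_assoc _ (S : Matrix (Fin n) (Fin n) K), ← Units.val_mul,
          mul_inv_cancel, Units.val_one, Matrix.mul_one, Matrix.mul_one] at h2
      have h3 : c.mapMatrix (mat x) * P = P := by
        apply Matrix.map_injective hf
        dsimp only
        rw [Matrix.map_mul]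
        exact h1
      -- An element that acts trivially on the columns preserves the values of every weight on them.
      -- The weights in `pts` are characterised by these values, hence fixed. So the action is
      -- faithful although the columns need not span the whole space.
      refine eq_one_of_rigid hr fun p hp => ?_
      obtain ⟨q, hq, rfl⟩ := List.mem_map.1 hp
      rw [act_fin]
      refine congrArg Fin.val (huniq q hq _ ?_)
      have h4 : (fun i => (wt (weightPerm x q) i : R)) ᵥ* c.mapMatrix (mat x) =
          fun i => (wt q i : R) := weight_vecMul_mat x q
      calc _ = (fun i => (wt (weightPerm x q) i : R)) ᵥ* (c.mapMatrix (mat x) * P) := by rw [h3]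
        _ = _ := by rw [← Matrix.vecMul_vecMul, h4]) hD2
  refine ⟨(MulEquiv.subgroupCongr (wordClosure_eq ws)).trans φ, fun k => ?_⟩
  have hk : (word (ws.get k), h k) ∈ D := hQ k
  have hφk := hφ (MulEquiv.subgroupCongr (wordClosure_eq ws) ⟨_, word_mem_wordClosure k⟩)
  rw [MulEquiv.trans_apply]
  generalize φ _ = y at hφk ⊢
  have hφk : (word (ws.get k), (y : GL (Fin n) K)) ∈ D := hφk
  have h1 := D.mul_mem (D.inv_mem hφk) hk
  rw [Prod.inv_mk, Prod.mk_mul_mk, inv_mul_cancel] at h1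
  exact inv_mul_eq_one.1 (hD2 _ h1)

/-! ### Unitary reflection groups -/

theorem unitaryReflection_mul {n : ℕ} {a : Fin n → ℂ} (ha : star a ⬝ᵥ a ≠ 0) (ζ η : ℂ) :
    unitaryReflection a ζ * unitaryReflection a η = unitaryReflection a (ζ * η) := by
  have h : vecMulVec a (star a) * vecMulVec a (star a) =
      (star a ⬝ᵥ a) • vecMulVec a (star a) := by
    rw [vecMulVec_mul_vecMulVec, vecMulVec_smul]
  rw [unitaryReflection, unitaryReflection, unitaryReflection, mul_sub, sub_mul, sub_mul, one_mul,
    mul_one, one_mul, smul_mul_assoc, mul_smul_comm, h, smul_smul, smul_smul, sub_sub,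
    ← add_sub_assoc, ← add_smul, ← sub_smul]
  congr 2
  field_simp
  ring

theorem unitaryReflection_one {n : ℕ} (a : Fin n → ℂ) : unitaryReflection a 1 = 1 := by
  rw [unitaryReflection, sub_self, zero_div, zero_smul, sub_zero]

/-- The unitary reflection as an invertible matrix. -/
noncomputable def unitaryReflectionUnit {n : ℕ} (a : Fin n → ℂ) (ha : star a ⬝ᵥ a ≠ 0) (ζ : ℂ) (hζ : ζ ≠ 0) :
    GL (Fin n) ℂ where
  val := unitaryReflection a ζ
  inv := unitaryReflection a ζ⁻¹
  val_inv := by rw [unitaryReflection_mul ha, mul_inv_cancel₀ hζ, unitaryReflection_one]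
  inv_val := by rw [unitaryReflection_mul ha, inv_mul_cancel₀ hζ, unitaryReflection_one]

theorem isReflection_unitaryReflectionUnit {n : ℕ} (a : Fin n → ℂ) (ha : star a ⬝ᵥ a ≠ 0)
    {ζ : ℂ} (hζ : ζ ≠ 0) (h1 : ζ ≠ 1) : IsReflection (unitaryReflectionUnit a ha ζ hζ) := by
  refine ⟨-((1 - ζ) / (star a ⬝ᵥ a)) • star a, a, ?_, ?_⟩
  · rw [smul_dotProduct, smul_eq_mul, neg_mul, div_mul_cancel₀ _ ha, neg_ne_zero, sub_ne_zero]
    exact h1.symm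
  · change unitaryReflection a ζ = _
    rw [unitaryReflection, vecMulVec_smul, neg_smul, sub_eq_add_neg]

theorem unitaryReflectionGroup_range {n m r : ℕ} (a : Fin r → Fin n → ℂ)
    (ha : ∀ i, star (a i) ⬝ᵥ a i ≠ 0) :
    unitaryReflectionGroup m (Set.range a) = Subgroup.closure (Set.range fun i =>
      unitaryReflectionUnit (a i) (ha i) (Complex.exp (2 * Real.pi * Complex.I / m))
        (Complex.exp_ne_zero _)) := by
  rw [unitaryReflectionGroup]
  congr 1
  ext g
  rw [Set.mem_ofPred_eq, Set.exists_range_iff, Set.mem_range]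
  exact exists_congr fun i => ⟨fun h => Units.ext h.symm, fun h => h ▸ rfl⟩

theorem isReflectionGroup_of_mulEquiv {k : Type} [Field k] {n : ℕ} {G H : Type} [Group G] [Group H]
    (e : G ≃* H) (h : IsReflectionGroupOfRank k n G) : IsReflectionGroupOfRank k n H := by
  obtain ⟨hfin, ρ, hρ, htop⟩ := h
  refine ⟨Finite.of_equiv G e.toEquiv, ρ.comp e.symm.toMonoidHom, hρ.comp e.symm.injective, ?_⟩
  have : {g : H | IsReflection (ρ.comp e.symm.toMonoidHom g)} = e '' {g | IsReflection (ρ g)} := by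
    ext g
    constructor
    · exact fun hg => ⟨e.symm g, hg, e.apply_symm_apply g⟩
    · rintro ⟨g, hg, rfl⟩
      change IsReflection (ρ (e.symm (e g)))
      rwa [e.symm_apply_apply]
  rw [this]
  have h2 := MonoidHom.map_closure e.toMonoidHom {g | IsReflection (ρ g)}
  rw [htop, ← MonoidHom.range_eq_map, MonoidHom.range_eq_top.2 e.surjective] at h2
  exact h2.symm

theorem isReflectionGroup_closure {k : Type} [Field k] {n : ℕ} {S : Set (GL (Fin n) k)}
    (hS : ∀ g ∈ S, IsReflection g) (hfin : Finite (Subgroup.closure S)) :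
    IsReflectionGroupOfRank k n (Subgroup.closure S) := by
  refine ⟨hfin, (Subgroup.closure S).subtype, Subtype.val_injective, ?_⟩
  rw [eq_top_iff, ← Subgroup.closure_closure_coe_preimage]
  exact Subgroup.closure_mono fun g hg => hS _ hg

/-- A generated subgroup of `W` as a unitary reflection group. In suitable coordinates the
`k`-th reflection is `1 - (1 - z) / (r k ⬝ᵥ v k) • vecMulVec (v k) (r k)`. -/
theorem wordClosure_mulEquiv_unitaryReflectionGroup {R : Type} [CommRing R] (f : R →+* ℂ)
    (hf : Function.Injective f) {n m : ℕ} {z : R} (hz1 : z ≠ 1)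
    (hz : Complex.exp (2 * Real.pi * Complex.I / m) = f z)
    (ws : List (List (Fin 7))) (a : Fin ws.length → Fin n → ℂ) (S : GL (Fin n) ℂ)
    (v r : Fin ws.length → Fin n → R) (c c' : Fin ws.length → ℂ)
    (hc : ∀ k, c k ≠ 0) (hc' : ∀ k, c' k ≠ 0)
    (hv : ∀ k, (S : Matrix (Fin n) (Fin n) ℂ) *ᵥ a k = c k • (f ∘ v k))
    (hr : ∀ k, star (a k) = (c' k • (f ∘ r k)) ᵥ* (S : Matrix (Fin n) (Fin n) ℂ))
    (hrv : ∀ k, r k ⬝ᵥ v k ≠ 0) (P : Matrix (Fin 6) (Fin n) R)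
    {d e : R} (hd : d ≠ 0) (he : e ≠ 0) (M : Fin ws.length → Matrix (Fin n) (Fin n) R)
    (hM : ∀ k, (r k ⬝ᵥ v k) • M k = d • ((r k ⬝ᵥ v k) • (1 : Matrix (Fin n) (Fin n) R) -
      (1 - z) • vecMulVec (v k) (r k)))
    (hP : ∀ k, ∀ j : Fin 27, d • ((fun i => (wt j i : R)) ᵥ* P) =
      ((fun i => (wt (Fin.ofNat 27 (look (wordCode (ws.get k)) j)) i : R)) ᵥ* P) ᵥ* M k)
    (L : Matrix (Fin n) (Fin 6) R) (hL : L * P = e • (1 : Matrix (Fin n) (Fin n) R))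
    {pts : List (Fin 27)} (hpts : rigid (pts.map Fin.val) = true)
    (huniq : ∀ p ∈ pts, ∀ j : Fin 27,
      (fun i => (wt j i : R)) ᵥ* P = (fun i => (wt p i : R)) ᵥ* P → j = p) :
    Nonempty (wordClosure ws ≃* unitaryReflectionGroup m (Set.range a)) ∧
      IsReflectionGroupOfRank ℂ n (wordClosure ws) := by
  have hf0 {x : R} (hx : x ≠ 0) : f x ≠ 0 := fun h => hx (hf (h.trans (map_zero f).symm))
  have hdot (k) : star (a k) ⬝ᵥ a k = c' k * c k * f (r k ⬝ᵥ v k) := by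
    rw [hr, ← dotProduct_mulVec, hv, smul_dotProduct, dotProduct_smul, RingHom.map_dotProduct,
      smul_eq_mul, smul_eq_mul, mul_assoc]
  have ha (k) : star (a k) ⬝ᵥ a k ≠ 0 := by
    rw [hdot]
    exact mul_ne_zero (mul_ne_zero (hc' k) (hc k)) (hf0 (hrv k))
  have hm : f z ≠ 1 := fun h => hz1 (hf (h.trans (map_one f).symm))
  obtain ⟨φ, -⟩ := exists_mulEquiv_GL f hf ws (fun i =>
      unitaryReflectionUnit (a i) (ha i) (Complex.exp (2 * Real.pi * Complex.I / m))
        (Complex.exp_ne_zero _)) S P (hf0 hd) (hf0 he) M (fun k => by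
      change f d • ((S : Matrix (Fin n) (Fin n) ℂ) * unitaryReflection (a k) _) = _
      have h1 : (f (r k ⬝ᵥ v k)) • (M k).map f = f d • ((f (r k ⬝ᵥ v k)) •
          (1 : Matrix (Fin n) (Fin n) ℂ) - (1 - f z) • vecMulVec (f ∘ v k) (f ∘ r k)) := by
        ext i j
        have := congrArg f (congrFun (congrFun (hM k) i) j)
        simpa [Matrix.one_apply, vecMulVec_apply, apply_ite f] using this
      -- In the coordinates given by `S` the rank one part of the reflection is the integral one up
      -- to a scalar, which cancels against the same scalar in the norm of the root.
      have h2 : vecMulVec (f ∘ v k) (f ∘ r k) * (S : Matrix (Fin n) (Fin n) ℂ) =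
          (c k * c' k)⁻¹ • ((S : Matrix (Fin n) (Fin n) ℂ) * vecMulVec (a k) (star (a k))) := by
        rw [mul_vecMulVec, hv, hr, vecMulVec_mul, smul_vecMul, smul_vecMulVec, vecMulVec_smul,
          smul_smul, smul_smul, mul_assoc, inv_mul_cancel₀, one_smul]
        exact mul_ne_zero (hc k) (hc' k)
      refine smul_right_injective _ (hf0 (hrv k)) ?_
      beta_reduce
      rw [← Matrix.smul_mul _ ((M k).map f), h1, Matrix.smul_mul, sub_mul, Matrix.smul_mul, Matrix.smul_mul,
        Matrix.one_mul, h2, unitaryReflection, hz, hdot, mul_sub, Matrix.mul_one, Matrix.mul_smul,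
        smul_comm, smul_sub, smul_smul, smul_smul]
      congr 3
      have := hc k
      have := hc' k
      have := hf0 (hrv k)
      field_simp) hP L hL hpts huniq
  refine ⟨⟨φ.trans (MulEquiv.subgroupCongr (unitaryReflectionGroup_range a ha).symm)⟩,
    isReflectionGroup_of_mulEquiv φ.symm (isReflectionGroup_closure ?_ ?_)⟩
  · rintro _ ⟨i, rfl⟩
    exact isReflection_unitaryReflectionUnit _ _ _ (hz ▸ hm)
  · exact Finite.of_equiv _ φ.toEquiv

/-! ### Quadratic integers -/

/-- The embedding of a quadratic ring into `ℂ` that maps the generator to `ζ`. -/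
noncomputable def quadraticEmbedding {a b : ℤ} (ζ : ℂ) (hζ : ζ * ζ = a + b * ζ) :
    QuadraticAlgebra ℤ a b →+* ℂ where
  toFun z := z.re + z.im * ζ
  map_zero' := by
    change ((0 : ℤ) : ℂ) + ((0 : ℤ) : ℂ) * ζ = 0
    simp
  map_one' := by
    change ((1 : ℤ) : ℂ) + ((0 : ℤ) : ℂ) * ζ = 1
    simp
  map_add' x y := by
    rw [QuadraticAlgebra.re_add, QuadraticAlgebra.im_add]
    push_cast
    ring
  map_mul' x y := by
    rw [QuadraticAlgebra.re_mul, QuadraticAlgebra.im_mul]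
    push_cast
    linear_combination (-(x.im : ℂ) * y.im) * hζ

theorem quadraticEmbedding_apply {a b : ℤ} (ζ : ℂ) (hζ : ζ * ζ = a + b * ζ)
    (z : QuadraticAlgebra ℤ a b) : quadraticEmbedding ζ hζ z = z.re + z.im * ζ := rfl

theorem quadraticEmbedding_injective {a b : ℤ} {ζ : ℂ} (hζ : ζ * ζ = a + b * ζ)
    (him : ζ.im ≠ 0) : Function.Injective (quadraticEmbedding ζ hζ) := by
  rw [injective_iff_map_eq_zero]
  intro z hz
  rw [quadraticEmbedding_apply] at hz
  have h1 : z.im = 0 := by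
    have := congrArg Complex.im hz
    simpa [him] using this
  have h2 : z.re = 0 := by
    rw [h1] at hz
    simpa using hz
  exact QuadraticAlgebra.ext h2 h1

theorem exp_two_pi_div_three_sq : Complex.exp (2 * Real.pi * Complex.I / (3 : ℕ)) *
    Complex.exp (2 * Real.pi * Complex.I / (3 : ℕ)) =
    ((-1 : ℤ) : ℂ) + ((-1 : ℤ) : ℂ) * Complex.exp (2 * Real.pi * Complex.I / (3 : ℕ)) := by
  have h := (Complex.isPrimitiveRoot_exp 3 (by norm_num)).geom_sum_eq_zero (by norm_num)
  rw [Finset.sum_range_succ, Finset.sum_range_succ, Finset.sum_range_one] at h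
  push_cast at h ⊢
  linear_combination h

theorem exp_two_pi_div_three_im : (Complex.exp (2 * Real.pi * Complex.I / (3 : ℕ))).im ≠ 0 := by
  intro h
  have h1 := congrArg Complex.re exp_two_pi_div_three_sq
  rw [Complex.mul_re, Complex.add_re, Complex.mul_re, h] at h1
  generalize (Complex.exp (2 * Real.pi * Complex.I / (3 : ℕ))).re = x at h1
  simp at h1
  nlinarith [sq_nonneg (x + 1 / 2)]

theorem exp_two_pi_div_four : Complex.exp (2 * Real.pi * Complex.I / (4 : ℕ)) = Complex.I := by
  conv_rhs => rw [← Complex.exp_pi_div_two_mul_I]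
  congr 1
  push_cast
  ring

theorem exp_two_pi_div_two : Complex.exp (2 * Real.pi * Complex.I / (2 : ℕ)) = -1 := by
  rw [← Complex.exp_pi_mul_I]
  congr 1
  push_cast
  ring

/-- The ring of Eisenstein integers. -/
abbrev Eisenstein : Type := QuadraticAlgebra ℤ (-1) (-1)

/-- The ring of Gaussian integers. -/
abbrev Gaussian : Type := QuadraticAlgebra ℤ (-1) 0

/-- The complex cube root of unity `exp(2πi/3)`. -/
noncomputable def cubeRoot : ℂ := Complex.exp (2 * Real.pi * Complex.I / (3 : ℕ))

noncomputable def eisensteinEmbedding : Eisenstein →+* ℂ :=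
  quadraticEmbedding cubeRoot exp_two_pi_div_three_sq

noncomputable def gaussianEmbedding : Gaussian →+* ℂ :=
  quadraticEmbedding Complex.I (by simp)

theorem eisensteinEmbedding_injective : Function.Injective eisensteinEmbedding :=
  quadraticEmbedding_injective _ exp_two_pi_div_three_im

theorem gaussianEmbedding_injective : Function.Injective gaussianEmbedding :=
  quadraticEmbedding_injective _ (by simp)

theorem eisensteinEmbedding_omega : eisensteinEmbedding ⟨0, 1⟩ = cubeRoot := by
  change ((0 : ℤ) : ℂ) + ((1 : ℤ) : ℂ) * cubeRoot = _
  simp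

theorem gaussianEmbedding_omega : gaussianEmbedding ⟨0, 1⟩ = Complex.I := by
  change ((0 : ℤ) : ℂ) + ((1 : ℤ) : ℂ) * Complex.I = _
  simp

/-! ### Shephard–Todd groups as centralisers of regular elements -/

theorem G25_eq_range : G25 = unitaryReflectionGroup 3
    (Set.range ![![1, 0, 0], ![1, 1, 1], ![0, 0, 1]]) := by
  rw [G25, range_cons, range_cons, range_cons, range_empty, Set.union_empty]
  rfl

/-- One eigenvector from each of the three orthogonal planes of type `A₂`. Together they span an
eigenspace of the representative of `A₂³` for a primitive cube root of unity, scaled so that the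
generators become the standard reflections of `G25`. -/
def columns25 : Matrix (Fin 6) (Fin 3) Eisenstein :=
  !![⟨1, -1⟩, ⟨-1, 1⟩, ⟨0, 0⟩; ⟨2, -2⟩, ⟨1, 2⟩, ⟨0, 0⟩; ⟨3, -3⟩, ⟨0, 0⟩, ⟨0, 0⟩;
    ⟨2, -2⟩, ⟨0, 0⟩, ⟨1, 2⟩; ⟨1, -1⟩, ⟨0, 0⟩, ⟨-1, 1⟩; ⟨3, 0⟩, ⟨0, 0⟩, ⟨0, 0⟩]

def coordinates25 : Matrix (Fin 3) (Fin 6) Eisenstein :=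
  !![⟨0, 1⟩, ⟨1, 0⟩, ⟨0, 0⟩, ⟨0, 0⟩, ⟨0, 0⟩, ⟨0, 0⟩;
    ⟨-2, 0⟩, ⟨1, 0⟩, ⟨0, 0⟩, ⟨0, 0⟩, ⟨0, 0⟩, ⟨0, 0⟩;
    ⟨-2, 0⟩, ⟨2, 2⟩, ⟨0, 0⟩, ⟨-1, -2⟩, ⟨0, 0⟩, ⟨0, 0⟩]

theorem wordClosure_G25 :
    Nonempty (wordClosure [[0, 6], TWord ++ [3], [5, 4]] ≃* G25) ∧
      IsReflectionGroupOfRank ℂ 3 (wordClosure [[0, 6], TWord ++ [3], [5, 4]]) := by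
  rw [G25_eq_range]
  refine wordClosure_mulEquiv_unitaryReflectionGroup eisensteinEmbedding
    eisensteinEmbedding_injective (z := ⟨0, 1⟩) (by decide) (eisensteinEmbedding_omega.symm)
    [[0, 6], TWord ++ [3], [5, 4]] ![![1, 0, 0], ![1, 1, 1], ![0, 0, 1]] 1
    ![![1, 0, 0], ![1, 1, 1], ![0, 0, 1]] ![![1, 0, 0], ![1, 1, 1], ![0, 0, 1]]
    (fun _ => 1) (fun _ => 1) (fun _ => one_ne_zero) (fun _ => one_ne_zero) ?_ ?_
    (by decide +kernel) columns25 (d := 3) (e := 3) (by decide) (by decide)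
    ![!![⟨0, 3⟩, ⟨0, 0⟩, ⟨0, 0⟩; ⟨0, 0⟩, ⟨3, 0⟩, ⟨0, 0⟩; ⟨0, 0⟩, ⟨0, 0⟩, ⟨3, 0⟩],
      !![⟨2, 1⟩, ⟨-1, 1⟩, ⟨-1, 1⟩; ⟨-1, 1⟩, ⟨2, 1⟩, ⟨-1, 1⟩; ⟨-1, 1⟩, ⟨-1, 1⟩, ⟨2, 1⟩],
      !![⟨3, 0⟩, ⟨0, 0⟩, ⟨0, 0⟩; ⟨0, 0⟩, ⟨3, 0⟩, ⟨0, 0⟩; ⟨0, 0⟩, ⟨0, 0⟩, ⟨0, 3⟩]]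
    (by decide +kernel) (by decide +kernel) coordinates25 (by decide +kernel)
    (pts := [22, 23, 24, 25, 26]) (by decide +kernel) (by decide +kernel)
  · intro k
    fin_cases k <;> ext i <;> fin_cases i <;> simp
  · intro k
    fin_cases k <;> ext i <;> fin_cases i <;> simp

/-- This is the Shephard–Todd group `G₄ ≅ SL₂(3)`, generated by two adjacent reflections among the
three generators of `G25`, so the same columns serve. -/
theorem isReflectionGroup_Ts3_s5s4 :
    IsReflectionGroupOfRank ℂ 3 (wordClosure [TWord ++ [3], [5, 4]]) := by
  refine (wordClosure_mulEquiv_unitaryReflectionGroup eisensteinEmbedding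
    eisensteinEmbedding_injective (z := ⟨0, 1⟩) (by decide) (eisensteinEmbedding_omega.symm)
    [TWord ++ [3], [5, 4]] ![![1, 1, 1], ![0, 0, 1]] 1
    ![![1, 1, 1], ![0, 0, 1]] ![![1, 1, 1], ![0, 0, 1]]
    (fun _ => 1) (fun _ => 1) (fun _ => one_ne_zero) (fun _ => one_ne_zero) ?_ ?_
    (by decide +kernel) columns25 (d := 3) (e := 3) (by decide) (by decide)
    ![!![⟨2, 1⟩, ⟨-1, 1⟩, ⟨-1, 1⟩; ⟨-1, 1⟩, ⟨2, 1⟩, ⟨-1, 1⟩; ⟨-1, 1⟩, ⟨-1, 1⟩, ⟨2, 1⟩],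
      !![⟨3, 0⟩, ⟨0, 0⟩, ⟨0, 0⟩; ⟨0, 0⟩, ⟨3, 0⟩, ⟨0, 0⟩; ⟨0, 0⟩, ⟨0, 0⟩, ⟨0, 3⟩]]
    (by decide +kernel) (by decide +kernel) coordinates25 (by decide +kernel)
    (pts := [22, 23, 24, 25, 26]) (by decide +kernel) (by decide +kernel)).2
  · intro k
    fin_cases k <;> ext i <;> fin_cases i <;> simp
  · intro k
    fin_cases k <;> ext i <;> fin_cases i <;> simp

/-- Words for reflections that generate the centraliser of `rep .cE6a2`. -/
def words5 : List (List (Fin 7)) :=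
  [TWord ++ [3], repWord .cE6a2 ++ repWord .cE6a2 ++ [5, 4, 5, 4]]

/-- The square of the representative is a scalar of order three on the eigenspace in question;
multiplied by it, the inverse of `s 5 * s 4` becomes a reflection of that plane. The index lists
express either set of generators through the other. -/
theorem centralizer_cE6a2 :
    Subgroup.centralizer {rep .cE6a2} = wordClosure words5 := by
  rw [centralizer_rep]
  apply le_antisymm
  · exact wordClosure_le_of_words (ws := (factorWords .cE6a2).flatten) (vs := words5)
      ![[0, 0, 1, 0, 1, 1, 0, 1], [0], [0, 0, 1, 0, 1, 1, 0]] (by decide +kernel)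
  · exact wordClosure_le_of_words (ws := words5) (vs := (factorWords .cE6a2).flatten)
      ![[1], [0, 2, 2]] (by decide +kernel)

theorem G5_eq_range : G5 = unitaryReflectionGroup 3
    (Set.range ![![1, 0], ![(Real.sqrt 2 : ℂ), 1]]) := by
  rw [G5, range_cons, range_cons, range_empty, Set.union_empty]
  rfl

theorem sqrt_two_ne_zero : (Real.sqrt 2 : ℂ) ≠ 0 := by
  simp

theorem sqrt_two_mul_self : (Real.sqrt 2 : ℂ) * Real.sqrt 2 = 2 := by
  rw [← Complex.ofReal_mul, Real.mul_self_sqrt (by norm_num)]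
  norm_num

theorem wordClosure_G5 : Nonempty (wordClosure words5 ≃* G5) ∧
      IsReflectionGroupOfRank ℂ 2 (wordClosure words5) := by
  rw [G5_eq_range]
  -- Rescaling the first coordinate by the inverse of `√2` makes the roots proportional to `(1, 0)`
  -- and `(1, 1)`, so that the remaining computation stays within the Eisenstein integers.
  let S : GL (Fin 2) ℂ := ⟨!![(Real.sqrt 2 : ℂ)⁻¹, 0; 0, 1], !![(Real.sqrt 2 : ℂ), 0; 0, 1],
    by simp [one_fin_two], by simp [one_fin_two]⟩
  have hS : (S : Matrix (Fin 2) (Fin 2) ℂ) = !![(Real.sqrt 2 : ℂ)⁻¹, 0; 0, 1] := rfl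
  refine wordClosure_mulEquiv_unitaryReflectionGroup eisensteinEmbedding
    eisensteinEmbedding_injective (z := ⟨0, 1⟩) (by decide) (eisensteinEmbedding_omega.symm)
    words5 ![![1, 0], ![(Real.sqrt 2 : ℂ), 1]] S
    ![![1, 0], ![1, 1]] ![![1, 0], ![2, 1]]
    ![(Real.sqrt 2 : ℂ)⁻¹, 1] ![(Real.sqrt 2 : ℂ), 1] ?_ ?_ ?_ ?_
    (by decide +kernel) !![⟨0, 0⟩, ⟨0, 0⟩; ⟨2, 0⟩, ⟨1, 0⟩; ⟨2, -2⟩, ⟨1, -1⟩; ⟨2, 0⟩, ⟨0, -2⟩;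
      ⟨0, 0⟩, ⟨1, -1⟩; ⟨2, 0⟩, ⟨1, 0⟩] (d := 3) (e := 6) (by decide) (by decide)
    ![!![⟨0, 3⟩, ⟨0, 0⟩; ⟨0, 0⟩, ⟨3, 0⟩], !![⟨1, 2⟩, ⟨-1, 1⟩; ⟨-2, 2⟩, ⟨2, 1⟩]]
    (by decide +kernel) (by decide +kernel)
    !![⟨0, 0⟩, ⟨4, 2⟩, ⟨0, 0⟩, ⟨-1, -2⟩, ⟨0, 0⟩, ⟨0, 0⟩;
      ⟨0, 0⟩, ⟨-2, -4⟩, ⟨0, 0⟩, ⟨2, 4⟩, ⟨0, 0⟩, ⟨0, 0⟩] (by decide +kernel)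
    (pts := [21, 23, 24, 25, 26]) (by decide +kernel) (by decide +kernel)
  · change ∀ k : Fin 2, _
    intro k
    fin_cases k <;> simp
  · change ∀ k : Fin 2, _
    intro k
    fin_cases k <;> simp
  · change ∀ k : Fin 2, _
    intro k
    rw [hS]
    fin_cases k <;> ext i <;> fin_cases i <;> simp
  · change ∀ k : Fin 2, _
    intro k
    rw [hS]
    fin_cases k <;> ext i <;> fin_cases i <;> simp [vecHead, vecTail]
    rw [map_ofNat, eq_mul_inv_iff_mul_eq₀ sqrt_two_ne_zero, sqrt_two_mul_self]

/-- Words for reflections that generate the centraliser of `rep .cD4a1`. -/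
def words8 : List (List (Fin 7)) :=
  [repWord .cD4a1 ++ repWord .cD4a1 ++ [5] ++ u₁Word ++ u₂Word ++ u₁Word,
    repWord .cD4a1 ++ repWord .cD4a1 ++ u₁Word.reverse ++ TWord ++ [5] ++ TWord]

/-- The representative has order four and acts on the eigenspace as a scalar, so its square acts as
-1. This sign turns the listed generators, the second one inverted, into reflections. -/
theorem centralizer_cD4a1 :
    Subgroup.centralizer {rep .cD4a1} = wordClosure words8 := by
  rw [centralizer_rep]
  apply le_antisymm
  · exact wordClosure_le_of_words (ws := (factorWords .cD4a1).flatten) (vs := words8)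
      ![[0, 0, 0, 1, 1, 0, 0, 1, 1], [0, 0, 1, 1, 0, 0, 1]] (by decide +kernel)
  · exact wordClosure_le_of_words (ws := words8) (vs := (factorWords .cD4a1).flatten)
      ![[0, 0, 1, 0, 1, 0, 1], [0, 1, 0, 1, 0]] (by decide +kernel)

theorem G8_eq_range : G8 = unitaryReflectionGroup 4 (Set.range ![![0, 1], ![1, -1]]) := by
  rw [G8, range_cons, range_cons, range_empty, Set.union_empty]
  rfl

theorem wordClosure_G8 : Nonempty (wordClosure words8 ≃* G8) ∧
      IsReflectionGroupOfRank ℂ 2 (wordClosure words8) := by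
  rw [G8_eq_range]
  refine wordClosure_mulEquiv_unitaryReflectionGroup gaussianEmbedding
    gaussianEmbedding_injective (z := ⟨0, 1⟩) (by decide)
    (exp_two_pi_div_four.trans gaussianEmbedding_omega.symm)
    words8 ![![0, 1], ![1, -1]] 1 ![![0, 1], ![1, -1]] ![![0, 1], ![1, -1]]
    (fun _ => 1) (fun _ => 1) (fun _ => one_ne_zero) (fun _ => one_ne_zero) ?_ ?_
    (by decide +kernel) !![⟨0, 1⟩, ⟨-1, 0⟩; ⟨0, 0⟩, ⟨-2, 0⟩; ⟨-1, 0⟩, ⟨-3, 0⟩; ⟨0, 0⟩, ⟨-2, 0⟩;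
      ⟨0, 0⟩, ⟨-1, 1⟩; ⟨0, 0⟩, ⟨-2, 0⟩] (d := 2) (e := 2) (by decide) (by decide)
    ![!![⟨2, 0⟩, ⟨0, 0⟩; ⟨0, 0⟩, ⟨0, 2⟩], !![⟨1, 1⟩, ⟨1, -1⟩; ⟨1, -1⟩, ⟨1, 1⟩]]
    (by decide +kernel) (by decide +kernel)
    !![⟨0, -2⟩, ⟨0, 1⟩, ⟨0, 0⟩, ⟨0, 0⟩, ⟨0, 0⟩, ⟨0, 0⟩;
      ⟨0, 0⟩, ⟨-1, 0⟩, ⟨0, 0⟩, ⟨0, 0⟩, ⟨0, 0⟩, ⟨0, 0⟩] (by decide +kernel)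
    (pts := [22, 23, 24, 25, 26]) (by decide +kernel) (by decide +kernel)
  · change ∀ k : Fin 2, _
    intro k
    fin_cases k <;> ext i <;> fin_cases i <;> simp
  · change ∀ k : Fin 2, _
    intro k
    fin_cases k <;> ext i <;> fin_cases i <;> simp

/-- Words for reflections of a four-dimensional space that generate the centraliser of
`rep .cA1A1A1A1`. -/
def words28 : List (List (Fin 7)) :=
  [TWord, [0], repWord .cA1A1A1A1 ++ u₂Word, repWord .cA1A1A1A1 ++ u₁Word]

/-- The representative is -1 on a four-dimensional space, where `-u₁` and `-u₂` are reflections. -/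
theorem centralizer_cA1A1A1A1 :
    Subgroup.centralizer {rep .cA1A1A1A1} = wordClosure words28 := by
  rw [centralizer_rep]
  apply le_antisymm
  · exact wordClosure_le_of_words (ws := (factorWords .cA1A1A1A1).flatten) (vs := words28)
      ![[1], [2, 1, 2], [3, 2, 1, 2, 3], [0],
        [0, 1, 0, 2, 1, 0, 2, 1, 2, 3, 2, 1, 0, 2, 1, 2, 3, 2, 1, 0, 2, 1, 2],
        [0, 1, 0, 2, 1, 0, 2, 1, 3, 2, 1, 0, 2, 1, 2, 3, 2, 1, 0, 2, 1, 2, 3]]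
      (by decide +kernel)
  · exact wordClosure_le_of_words (ws := words28) (vs := (factorWords .cA1A1A1A1).flatten)
      ![[3], [0], [0, 1, 2, 3, 0, 1, 2, 3, 0, 1, 2, 3, 5], [0, 1, 2, 3, 0, 1, 2, 3, 0, 1, 2, 3, 4]]
      (by decide +kernel)

theorem G28_eq_range : G28 = unitaryReflectionGroup 2
    (Set.range ![![0, 1, -1, 0], ![0, 0, 1, -1], ![0, 0, 0, 1], ![1, -1, -1, -1]]) := by
  rw [G28, range_cons, range_cons, range_cons, range_cons, range_empty, Set.union_empty]
  rfl

/-- The columns `r₅ - r₃`, `-r₃ - r₅`, `r₀ + r₁`, `r₁ - r₀` are an orthogonal basis, with equal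
norms, of the -1-eigenspace of the representative. -/
def columns28 : Matrix (Fin 6) (Fin 4) ℤ :=
  !![0, 0, 0, 2; 0, 0, -2, 2; -1, -1, -3, 3; 0, 0, -2, 2; 1, -1, -1, 1; 0, 0, -2, 2]

def coordinates28 : Matrix (Fin 4) (Fin 6) ℤ :=
  !![0, 1, -1, 0, 1, 0; 0, 2, -1, 0, -1, 0; 1, -1, 0, 0, 0, 0; 1, 0, 0, 0, 0, 0]

/-- These are twice the reflections, to keep the entries integral; this explains the factor `d = 2`
below. -/
def reflections28 : Fin 4 → Matrix (Fin 4) (Fin 4) ℤ :=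
  ![!![2, 0, 0, 0; 0, 0, 2, 0; 0, 2, 0, 0; 0, 0, 0, 2],
    !![2, 0, 0, 0; 0, 2, 0, 0; 0, 0, 0, 2; 0, 0, 2, 0],
    !![2, 0, 0, 0; 0, 2, 0, 0; 0, 0, 2, 0; 0, 0, 0, -2],
    !![1, 1, 1, 1; 1, 1, -1, -1; 1, -1, 1, -1; 1, -1, -1, 1]]

theorem wordClosure_G28 : Nonempty (wordClosure words28 ≃* G28) ∧
      IsReflectionGroupOfRank ℂ 4 (wordClosure words28) := by
  rw [G28_eq_range]
  refine wordClosure_mulEquiv_unitaryReflectionGroup (Int.castRingHom ℂ)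
    Int.cast_injective (z := -1) (by decide) (by rw [exp_two_pi_div_two]; simp)
    words28 ![![0, 1, -1, 0], ![0, 0, 1, -1], ![0, 0, 0, 1], ![1, -1, -1, -1]] 1
    ![![0, 1, -1, 0], ![0, 0, 1, -1], ![0, 0, 0, 1], ![1, -1, -1, -1]]
    ![![0, 1, -1, 0], ![0, 0, 1, -1], ![0, 0, 0, 1], ![1, -1, -1, -1]]
    (fun _ => 1) (fun _ => 1) (fun _ => one_ne_zero) (fun _ => one_ne_zero) ?_ ?_
    (by decide +kernel) columns28 (d := 2) (e := 2) (by decide) (by decide) reflections28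
    (by decide +kernel) (by decide +kernel) coordinates28 (by decide +kernel)
    (pts := [22, 23, 24, 25, 26]) (by decide +kernel) (by decide +kernel)
  · change ∀ k : Fin 4, _
    intro k
    fin_cases k <;> ext i <;> fin_cases i <;> simp
  · change ∀ k : Fin 4, _
    intro k
    fin_cases k <;> ext i <;> fin_cases i <;> simp

theorem isReflectionGroup_real_words28 : IsReflectionGroupOfRank ℝ 4 (wordClosure words28) := by
  let c : Matrix (Fin 4) (Fin 4) ℤ →+* Matrix (Fin 4) (Fin 4) ℝ :=
    (Int.castRingHom ℝ).mapMatrix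
  have hsq (k) : ((2 : ℝ)⁻¹ • c (reflections28 k)) * ((2 : ℝ)⁻¹ • c (reflections28 k)) = 1 := by
    have : reflections28 k * reflections28 k = 4 := by revert k; decide +kernel
    rw [smul_mul_smul_comm, ← map_mul, this, map_ofNat]
    ext i j
    rw [← Matrix.diagonal_ofNat]
    by_cases h : i = j
    · subst h; norm_num
    · simp [h]
  let g (k : Fin 4) : GL (Fin 4) ℝ := ⟨_, _, hsq k, hsq k⟩
  obtain ⟨φ, -⟩ := exists_mulEquiv_GL (Int.castRingHom ℝ) Int.cast_injective words28 g 1 columns28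
    (d := 2) (e := 2) (by norm_num) (by norm_num) reflections28 (fun k => by
      change _ • (_ * (2 : ℝ)⁻¹ • c (reflections28 k)) = c (reflections28 k) * _
      rw [Units.val_one, Matrix.one_mul, Matrix.mul_one, smul_smul]
      norm_num)
    (by decide +kernel) coordinates28 (by decide +kernel)
    (pts := [22, 23, 24, 25, 26]) (by decide +kernel) (by decide +kernel)
  refine isReflectionGroup_of_mulEquiv φ.symm (isReflectionGroup_closure ?_
    (Finite.of_equiv _ φ.toEquiv))
  rintro _ ⟨k, rfl⟩
  let a : Fin 4 → Fin 4 → ℤ := ![![0, 1, -1, 0], ![0, 0, 1, -1], ![0, 0, 0, 1], ![1, -1, -1, -1]]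
  have ha (k) : (a k ⬝ᵥ a k : ℤ) ≠ 0 := by revert k; decide +kernel
  have ha' : ((a k ⬝ᵥ a k : ℤ) : ℝ) ≠ 0 := Int.cast_ne_zero.2 (ha k)
  have hdot : (fun i => (a k i : ℝ)) ⬝ᵥ (fun i => (a k i : ℝ)) = ((a k ⬝ᵥ a k : ℤ) : ℝ) :=
    (RingHom.map_dotProduct (Int.castRingHom ℝ) (a k) (a k)).symm
  refine ⟨-(2 / ((a k ⬝ᵥ a k : ℤ) : ℝ)) • (fun i => (a k i : ℝ)), fun i => (a k i : ℝ), ?_, ?_⟩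
  · rw [smul_dotProduct, hdot, smul_eq_mul, neg_mul, div_mul_cancel₀ _ ha']
    norm_num
  · change (2 : ℝ)⁻¹ • c (reflections28 k) = _
    have h : ∀ k, (a k ⬝ᵥ a k) • reflections28 k = (2 : ℤ) • ((a k ⬝ᵥ a k) • (1 : Matrix _ _ ℤ) -
        (2 : ℤ) • vecMulVec (a k) (a k)) := by decide +kernel
    ext i j
    have h2 := congrArg (Int.cast : ℤ → ℝ) (congrFun (congrFun (h k) i) j)
    generalize a k ⬝ᵥ a k = t at ha' h2 ⊢
    simp only [Matrix.smul_apply, smul_eq_mul, Matrix.sub_apply, Matrix.add_apply,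
      vecMulVec_apply, Pi.smul_apply, c, RingHom.mapMatrix_apply, Matrix.map_apply] at h2 ⊢
    push_cast at h2
    have h3 : (((1 : Matrix (Fin 4) (Fin 4) ℤ) i j : ℤ) : ℝ) = (1 : Matrix (Fin 4) (Fin 4) ℝ) i j := by
      rw [Matrix.one_apply, Matrix.one_apply]; split_ifs <;> simp
    rw [h3] at h2
    field_simp
    rw [eq_intCast]
    linear_combination h2

/-! ### Constructions of reflection groups -/

theorem isReflectionGroup_closure_of_hom {k G : Type} [Field k] [Group G] {n : ℕ}
    (ρ : G →* GL (Fin n) k) (hρ : Function.Injective ρ) {S : Set G}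
    (hS : ∀ g ∈ S, IsReflection (ρ g)) (hfin : Finite (Subgroup.closure S)) :
    IsReflectionGroupOfRank k n (Subgroup.closure S) := by
  refine ⟨hfin, ρ.comp (Subgroup.closure S).subtype, hρ.comp Subtype.val_injective, ?_⟩
  rw [eq_top_iff, ← Subgroup.closure_closure_coe_preimage]
  exact Subgroup.closure_mono fun g hg => hS _ hg

theorem IsReflectionGroup.of_mulEquiv {k G H : Type} [Field k] [Group G] [Group H]
    (h : IsReflectionGroup k G) (e : G ≃* H) : IsReflectionGroup k H := by
  obtain ⟨n, h⟩ := h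
  exact ⟨n, isReflectionGroup_of_mulEquiv e h⟩

/-- Subgroups of `W` generated by reflections in roots. -/
theorem isReflectionGroup_of_roots (k : Type) [Field k] [CharZero k] (ws : List (List (Fin 7)))
    (r : Fin ws.length → Fin 6 → ℤ) (hr : ∀ i, r i ⬝ᵥ cartanE6 *ᵥ r i = 2)
    (h : ∀ i, mat (word (ws.get i)) = 1 - vecMulVec (r i) (cartanE6 *ᵥ r i)) :
    IsReflectionGroupOfRank k 6 (wordClosure ws) := by
  let ρ : W →* GL (Fin 6) k :=
    (Matrix.GeneralLinearGroup.map (Int.castRingHom k)).comp (weylGroup cartanE6).subtype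
  have hρ (x : W) : (ρ x : Matrix (Fin 6) (Fin 6) k) = (mat x).map (Int.castRingHom k) := rfl
  refine isReflectionGroup_closure_of_hom ρ (fun x y hxy => mat_injective ?_) ?_ inferInstance
  · have := congrArg Units.val hxy
    rw [hρ, hρ] at this
    exact Matrix.map_injective Int.cast_injective this
  · intro g hg
    obtain ⟨w, hw, rfl⟩ := List.mem_map.1 hg
    obtain ⟨i, rfl⟩ := List.get_of_mem hw
    refine ⟨fun j => ((-(cartanE6 *ᵥ r i) j : ℤ) : k), fun j => ((r i j : ℤ) : k), ?_, ?_⟩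
    · have h1 : (fun j => ((-(cartanE6 *ᵥ r i) j : ℤ) : k)) ⬝ᵥ (fun j => ((r i j : ℤ) : k)) =
          (((-(cartanE6 *ᵥ r i)) ⬝ᵥ r i : ℤ) : k) :=
        (RingHom.map_dotProduct (Int.castRingHom k) _ _).symm
      rw [h1, neg_dotProduct, dotProduct_comm, hr]
      norm_num
    · rw [hρ, h]
      ext a b
      simp [vecMulVec_apply, Matrix.one_apply, apply_ite (Int.cast : ℤ → k), sub_eq_add_neg]

/-- Use the block diagonal sum. A reflection in one block remains a reflection when its vector and
covector are extended by zero, and the factors generate the product. -/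
theorem isReflectionGroup_pi {k : Type} [Field k] {m : ℕ} {H : Fin m → Type}
    [∀ i, Group (H i)] (h : ∀ i, IsReflectionGroup k (H i)) : IsReflectionGroup k (∀ i, H i) := by
  choose n hfin ρ hρ htop using h
  let e : (Σ i, Fin (n i)) ≃ Fin (∑ i, n i) := finSigmaFinEquiv
  let R : (∀ i, H i) →* Matrix (Fin (∑ i, n i)) (Fin (∑ i, n i)) k :=
    { toFun x := Matrix.reindex e e (blockDiagonal' fun i => (ρ i (x i)).val)
      map_one' := by
        have : (fun i => (ρ i ((1 : ∀ i, H i) i)).val) = 1 := by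
          funext i; rw [Pi.one_apply, map_one]; rfl
        rw [this, blockDiagonal'_one]
        simp
      map_mul' x y := by
        have : (fun i => (ρ i ((x * y) i)).val) =
            fun i => (ρ i (x i)).val * (ρ i (y i)).val := by
          funext i; rw [Pi.mul_apply, map_mul]; rfl
        rw [this, blockDiagonal'_mul]
        simp [Matrix.submatrix_mul_equiv] }
  have hR (x) : R x = Matrix.reindex e e (blockDiagonal' fun i => (ρ i (x i)).val) := rfl
  refine ⟨_, inferInstance, R.toHomUnits, fun x y hxy => ?_, ?_⟩
  · have h1 : R x = R y := congrArg Units.val hxy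
    rw [hR, hR] at h1
    have h2 := blockDiagonal'_injective ((Matrix.reindex e e).injective h1)
    funext i
    exact hρ i (Units.ext (congrFun h2 i))
  · rw [eq_top_iff]
    intro x _
    refine Subgroup.pi_mem_of_mulSingle_mem x fun i => ?_
    have h1 : Subgroup.closure {g | IsReflection (ρ i g)} ≤
        (Subgroup.closure {g | IsReflection (R.toHomUnits g)}).comap (MonoidHom.mulSingle H i) := by
      rw [Subgroup.closure_le]
      rintro g ⟨f, v, hfv, hg⟩
      refine Subgroup.subset_closure ?_
      obtain ⟨ext', hext⟩ : ∃ ext' : (Fin (n i) → k) → Fin (∑ i, n i) → k, ∀ u j y,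
          ext' u (e ⟨j, y⟩) = (Pi.single i u : ∀ j, Fin (n j) → k) j y :=
        ⟨fun u a => (Pi.single i u : ∀ j, Fin (n j) → k) (e.symm a).1 (e.symm a).2,
          fun u j y => congrArg (fun p : Σ j, Fin (n j) =>
            (Pi.single i u : ∀ j, Fin (n j) → k) p.1 p.2) (e.symm_apply_apply ⟨j, y⟩)⟩
      refine ⟨ext' f, ext' v, ?_, ?_⟩
      · have : ext' f ⬝ᵥ ext' v = f ⬝ᵥ v := by
          rw [dotProduct, ← e.sum_comp, Fintype.sum_sigma, Finset.sum_eq_single i]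
          · simp [hext, dotProduct]
          · intro j _ hj
            simp [hext, Pi.single_eq_of_ne hj]
          · simp
        rwa [this]
      · change R (Pi.mulSingle i g) = _
        rw [hR]
        have h2 : (blockDiagonal' fun j => (ρ j (Pi.mulSingle i g j)).val) =
            1 + blockDiagonal' (Pi.single i (vecMulVec v f) : ∀ j, Matrix (Fin (n j)) (Fin (n j)) k) := by
          rw [← blockDiagonal'_one, ← blockDiagonal'_add]
          congr 1
          funext j
          by_cases hj : j = i
          · subst hj; simp [hg]
          · simp [hj]
        rw [h2]
        ext a b
        obtain ⟨⟨a, a'⟩, rfl⟩ := e.surjective a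
        obtain ⟨⟨b, b'⟩, rfl⟩ := e.surjective b
        simp only [reindex_apply, submatrix_apply, Equiv.symm_apply_apply, Matrix.add_apply,
          vecMulVec_apply, hext, Matrix.one_apply, e.injective.eq_iff]
        congr 1
        rw [blockDiagonal'_apply]
        by_cases ha : a = i
        · subst ha
          by_cases hb : a = b
          · subst hb; simp [vecMulVec_apply]
          · simp [hb]
        · simp [Pi.single_eq_of_ne ha]
    have h2 : x i ∈ Subgroup.closure {g | IsReflection (ρ i g)} := by rw [htop]; trivial
    exact h1 h2

/-! ### Monomial representations -/

/-- The monomial matrices of a permutation wreath product. -/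
def monomialHom {D k : Type} [Group D] [Field k] (χ : D →* kˣ) (n : ℕ) :
    Wreath D n →* Matrix (Fin n) (Fin n) k where
  toFun x := Matrix.of fun i j => if x.right j = i then (χ (x.left i) : k) else 0
  map_one' := by
    ext i j
    rw [Matrix.one_apply]
    simp [eq_comm]
  map_mul' x y := by
    ext i j
    rw [Matrix.mul_apply, Finset.sum_eq_single (y.right j)]
    · simp only [Matrix.of_apply, if_true, SemidirectProduct.mul_right, SemidirectProduct.mul_left, Equiv.Perm.mul_apply,
        Pi.mul_apply, map_mul, Units.val_mul]
      split_ifs with h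
      · congr 3
        change y.left (x.right.symm i) = _
        rw [← h, Equiv.symm_apply_apply]
      · rw [zero_mul]
    · intro b _ hb
      rw [Matrix.of_apply (fun _ _ => ite (y.right _ = _) _ _), if_neg hb.symm, mul_zero]
    · simp

theorem monomialHom_apply {D k : Type} [Group D] [Field k] (χ : D →* kˣ) (n : ℕ) (x : Wreath D n)
    (i j : Fin n) : monomialHom χ n x i j = if x.right j = i then (χ (x.left i) : k) else 0 := rfl

/-- Diagonal matrices with one nontrivial entry generate the base group, and transpositions generate
the permutations. A transposition has root `e_i - e_j`, on which its covector takes the value -2;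
this is where `2 ≠ 0` is needed. -/
theorem isReflectionGroup_wreath {D k : Type} [Group D] [Finite D] [Field k] [NeZero (2 : k)]
    (χ : D →* kˣ) (hχ : Function.Injective χ) (n : ℕ) :
    IsReflectionGroupOfRank k n (Wreath D n) := by
  refine ⟨Finite.of_equiv _ SemidirectProduct.equivProd.symm, (monomialHom χ n).toHomUnits, ?_, ?_⟩
  · rw [injective_iff_map_eq_one]
    intro x hx
    have h1 : monomialHom χ n x = 1 := congrArg Units.val hx
    have hr (j) : x.right j = j := by
      have := congrFun (congrFun h1 (x.right j)) j
      rw [monomialHom_apply, if_pos rfl, Matrix.one_apply] at this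
      by_contra h
      rw [if_neg h] at this
      exact Units.ne_zero _ this
    have hl (j) : x.left j = 1 := by
      have := congrFun (congrFun h1 j) j
      rw [monomialHom_apply, if_pos (hr j), Matrix.one_apply_eq, ← Units.val_one,
        Units.val_inj, ← map_one χ] at this
      exact hχ this
    exact SemidirectProduct.ext (funext hl) (Equiv.ext hr)
  · let C := Subgroup.closure {g | IsReflection ((monomialHom χ n).toHomUnits g)}
    have hC (x) (h : IsReflection ((monomialHom χ n).toHomUnits x)) : x ∈ C :=
      Subgroup.subset_closure h
    have hl (x : Fin n → D) : (SemidirectProduct.inl x : Wreath D n) ∈ C := by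
      have h1 : x ∈ C.comap SemidirectProduct.inl := by
        refine Subgroup.pi_mem_of_mulSingle_mem x fun i => ?_
        by_cases hi : x i = 1
        · rw [hi, Pi.mulSingle_one]; exact one_mem _
        · refine hC _ ⟨Pi.single i 1, Pi.single i ((χ (x i) : k) - 1), ?_, ?_⟩
          · rw [single_dotProduct, Pi.single_eq_same, one_mul, sub_ne_zero]
            exact fun h => hi (hχ (Units.ext (by rw [h, map_one]; rfl)))
          · ext a b
            change monomialHom χ n _ a b = _
            rw [monomialHom_apply, Matrix.add_apply, vecMulVec_apply, Matrix.one_apply]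
            by_cases hab : b = a
            · subst hab
              by_cases hb : b = i
              · subst hb; simp
              · simp [hb]
            · by_cases ha : a = i
              · subst ha; simp [hab, Ne.symm hab]
              · simp [ha, hab, Ne.symm hab]
      exact h1
    have hr (σ : Equiv.Perm (Fin n)) : (SemidirectProduct.inr σ : Wreath D n) ∈ C := by
      have h1 : Subgroup.closure {τ : Equiv.Perm (Fin n) | τ.IsSwap} ≤
          C.comap SemidirectProduct.inr := by
        rw [Subgroup.closure_le]
        rintro _ ⟨i, j, hij, rfl⟩
        refine hC _ ⟨Pi.single j 1 - Pi.single i 1, Pi.single i 1 - Pi.single j 1, ?_, ?_⟩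
        · rw [sub_dotProduct, single_dotProduct, single_dotProduct]
          simp [hij, hij.symm]
          intro h
          refine NeZero.ne (2 : k) ?_
          linear_combination -h
        · ext a b
          change monomialHom χ n _ a b = _
          rw [monomialHom_apply, Matrix.add_apply, vecMulVec_apply, Matrix.one_apply]
          simp only [SemidirectProduct.right_inr, SemidirectProduct.left_inr, Pi.one_apply, map_one,
            Units.val_one, Pi.sub_apply, Pi.single_apply, Equiv.swap_apply_def]
          grind
      rw [Equiv.Perm.closure_isSwap] at h1
      exact h1 (Subgroup.mem_top σ)
    rw [eq_top_iff]
    intro x _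
    rw [← SemidirectProduct.inl_left_mul_inr_right x]
    exact mul_mem (hl _) (hr _)

/-- On a line every scalar other than 1 is a reflection, the fixed hyperplane being zero. -/
theorem isReflectionGroup_of_character {D k : Type} [Group D] [Finite D] [Field k]
    (χ : D →* kˣ) (hχ : Function.Injective χ) : IsReflectionGroupOfRank k 1 D := by
  let R : D →* Matrix (Fin 1) (Fin 1) k :=
    (Matrix.scalar (Fin 1)).toMonoidHom.comp ((Units.coeHom k).comp χ)
  have hR (x) : R x = Matrix.scalar (Fin 1) (χ x : k) := rfl
  refine ⟨inferInstance, R.toHomUnits, fun x y hxy => ?_, ?_⟩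
  · have h1 : R x = R y := congrArg Units.val hxy
    rw [hR, hR] at h1
    exact hχ (Units.ext (Matrix.scalar_inj.1 h1))
  · rw [eq_top_iff]
    intro x _
    by_cases hx : x = 1
    · rw [hx]; exact one_mem _
    · refine Subgroup.subset_closure ⟨fun _ => 1, fun _ => (χ x : k) - 1, ?_, ?_⟩
      · rw [dotProduct, Fin.sum_univ_one, one_mul, sub_ne_zero]
        exact fun h => hx (hχ (Units.ext (by rw [h, map_one]; rfl)))
      · change R x = _
        rw [hR]
        ext i j
        simp [vecMulVec_apply, Matrix.scalar_apply, Subsingleton.elim i j]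

/-- A faithful character of a cyclic group. -/
theorem exists_character {k : Type} [Field k] {m : ℕ} [NeZero m] {ζ : k}
    (hζ : IsPrimitiveRoot ζ m) : ∃ χ : Cyc m →* kˣ, Function.Injective χ := by
  obtain ⟨u, rfl⟩ := hζ.isUnit (NeZero.ne m)
  have hu : IsPrimitiveRoot u m := IsPrimitiveRoot.coe_units_iff.1 hζ
  let e := AddEquiv.toMultiplicativeLeft hu.zmodEquivZPowers
  exact ⟨(Subgroup.zpowers u).subtype.comp e.toMonoidHom, Subtype.val_injective.comp e.injective⟩

theorem exists_complex_character (m : ℕ) [NeZero m] :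
    ∃ χ : Cyc m →* ℂˣ, Function.Injective χ :=
  exists_character (Complex.isPrimitiveRoot_exp m (NeZero.ne m))

theorem exists_real_character : ∃ χ : Cyc 2 →* ℝˣ, Function.Injective χ :=
  exists_character (IsPrimitiveRoot.neg_one 0 (by norm_num))

/-! ### The table of centralisers -/

theorem forall₂_factors (c : CarterType) :
    List.Forall₂ (fun F ws => F.sub = wordClosure ws) (factors c) (factorWords c) := by
  have h := map_factors_sub c
  rw [← List.forall₂_eq_eq_eq, List.forall₂_map_left_iff, List.forall₂_map_right_iff] at h
  exact h

theorem wordClosure_generators_eq_top :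
    wordClosure [[1], [2], [3], [4], [5], [6]] = ⊤ := by
  have h := centralizer_rep .c1
  change Subgroup.centralizer {(1 : W)} = wordClosure [[1], [2], [3], [4], [5], [6]] at h
  rw [← h, eq_top_iff]
  intro x _
  rw [Subgroup.mem_centralizer_singleton_iff, mul_one, one_mul]

theorem wordClosure_s0_u₂ : Nonempty (wordClosure [[0], u₂Word] ≃* DihedralGroup 4) := by
  obtain ⟨e⟩ := wreath_s0_u₂.mulEquiv (wordClosure_singleton (n := 2) (by decide +kernel))
  obtain ⟨f⟩ := dihedral_mulEquiv_wreath
  exact ⟨e.trans f⟩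

theorem wordClosure_s1_u₁ : Nonempty (wordClosure [[1], u₁Word] ≃* DihedralGroup 4) := by
  obtain ⟨e⟩ := wreath_s1_u₁.mulEquiv (wordClosure_singleton (n := 2) (by decide +kernel))
  obtain ⟨f⟩ := dihedral_mulEquiv_wreath
  exact ⟨e.trans f⟩

theorem wordClosure_s0s6_u₂ : Nonempty (wordClosure [[0, 6], u₂Word] ≃* Wreath (Cyc 3) 2) :=
  wreath_s0s6_u₂.mulEquiv (wordClosure_singleton (by decide +kernel))

theorem wordClosure_cA1A1A1A1 :
    Nonempty (wordClosure [[0], [1], [5], TWord, u₁Word, u₂Word] ≃* G28) := by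
  obtain ⟨e⟩ := wordClosure_G28.1
  have h : wordClosure [[0], [1], [5], TWord, u₁Word, u₂Word] = wordClosure words28 :=
    (centralizer_rep .cA1A1A1A1).symm.trans centralizer_cA1A1A1A1
  exact ⟨(MulEquiv.subgroupCongr h).trans e⟩

theorem wordClosure_cD4a1 : Nonempty (wordClosure
    [[5] ++ u₁Word ++ u₂Word ++ u₁Word, TWord ++ [5] ++ TWord ++ u₁Word] ≃* G8) := by
  obtain ⟨e⟩ := wordClosure_G8.1
  have h : wordClosure [[5] ++ u₁Word ++ u₂Word ++ u₁Word, TWord ++ [5] ++ TWord ++ u₁Word] =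
      wordClosure words8 :=
    (centralizer_rep .cD4a1).symm.trans centralizer_cD4a1
  exact ⟨(MulEquiv.subgroupCongr h).trans e⟩

theorem forall₂_cons {S : Subgroup W} {M : Type} [Group M] {ws : List (List (Fin 7))}
    {L : List Factor} {L' : List (List (List (Fin 7)))} (h : Nonempty (wordClosure ws ≃* M))
    (h' : List.Forall₂ (fun F ws => Nonempty (wordClosure ws ≃* F.Model)) L L') :
    List.Forall₂ (fun F ws => Nonempty (wordClosure ws ≃* F.Model)) (⟨S, M⟩ :: L) (ws :: L') :=
  .cons h h'

theorem nonempty_wordClosure_mulEquiv (c : CarterType) :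
    List.Forall₂ (fun F ws => Nonempty (wordClosure ws ≃* F.Model)) (factors c) (factorWords c) :=
  match c with
  | .c1 => forall₂_cons ⟨(MulEquiv.subgroupCongr wordClosure_generators_eq_top).trans
      Subgroup.topEquiv⟩ .nil
  | .cA1 => forall₂_cons (wordClosure_singleton (by decide +kernel))
      (forall₂_cons wordClosure_s1_s2_s3_s4_s5 .nil)
  | .cA1A1 => forall₂_cons wordClosure_s0_u₂ (forall₂_cons wordClosure_s3_s4_s5 .nil)
  | .cA2 => forall₂_cons (wordClosure_singleton (by decide +kernel))
      (forall₂_cons (wreath_s1_s2_u₁.mulEquiv wordClosure_s1_s2) .nil)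
  | .cA1A1A1 => .cons
      (wreath_s0_u₁_u₂.mulEquiv (wordClosure_singleton (by decide +kernel)))
      (forall₂_cons (wordClosure_singleton (by decide +kernel)) .nil)
  | .cA2A1 => forall₂_cons (wordClosure_singleton (by decide +kernel))
      (forall₂_cons (wordClosure_singleton (by decide +kernel)) (forall₂_cons wordClosure_s4_s5 .nil))
  | .cA3 => forall₂_cons (wordClosure_singleton (by decide +kernel)) (forall₂_cons wordClosure_s1_u₁ .nil)
  | .cA1A1A1A1 => forall₂_cons wordClosure_cA1A1A1A1 .nil
  | .cA2A1A1 => forall₂_cons (wordClosure_singleton (by decide +kernel)) (forall₂_cons wordClosure_s1_u₁ .nil)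
  | .cA2A2 => forall₂_cons wordClosure_s0s6_u₂ (forall₂_cons wordClosure_s4_s5 .nil)
  | .cA3A1 => forall₂_cons (wordClosure_singleton (by decide +kernel))
      (forall₂_cons (wordClosure_singleton (by decide +kernel))
        (forall₂_cons (wordClosure_singleton (by decide +kernel)) .nil))
  | .cA4 => forall₂_cons (wordClosure_singleton (by decide +kernel))
      (forall₂_cons (wordClosure_singleton (by decide +kernel)) .nil)
  | .cD4 => forall₂_cons (wordClosure_singleton (by decide +kernel))
      (forall₂_cons ⟨wordClosure_u₁_u₂.choose⟩ .nil)
  | .cD4a1 => forall₂_cons wordClosure_cD4a1 .nil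
  | .cA2A2A1 => forall₂_cons wordClosure_s0s6_u₂
      (forall₂_cons (wordClosure_singleton (by decide +kernel)) .nil)
  | .cA3A1A1 => forall₂_cons (wordClosure_singleton (by decide +kernel)) (forall₂_cons wordClosure_s1_T_s5 .nil)
  | .cA4A1 => forall₂_cons (wordClosure_singleton (by decide +kernel))
      (forall₂_cons (wordClosure_singleton (by decide +kernel)) .nil)
  | .cA5 => forall₂_cons (wordClosure_singleton (by decide +kernel))
      (forall₂_cons (wordClosure_singleton (by decide +kernel)) .nil)
  | .cD5 => forall₂_cons (wordClosure_singleton (by decide +kernel)) .nil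
  | .cD5a1 => forall₂_cons (wordClosure_singleton (by decide +kernel)) .nil
  | .cA2A2A2 => forall₂_cons wordClosure_G25.1 .nil
  | .cA5A1 => forall₂_cons (wordClosure_singleton (by decide +kernel)) (forall₂_cons wordClosure_s1_T .nil)
  | .cE6 => forall₂_cons (wordClosure_singleton (by decide +kernel)) .nil
  | .cE6a1 => forall₂_cons (wordClosure_singleton (by decide +kernel)) .nil
  | .cE6a2 => forall₂_cons (wordClosure_singleton (by decide +kernel)) (forall₂_cons wordClosure_Ts3_s5s4 .nil)

theorem forall_mem_of_forall₂ {A B : Type*} {R S : A → B → Prop} {Q : A → Prop}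
    (h : ∀ a b, R a b → S a b → Q a) :
    ∀ {l : List A} {m : List B}, List.Forall₂ R l m → List.Forall₂ S l m → ∀ a ∈ l, Q a
  | _, _, .nil, .nil => by simp
  | _, _, .cons h1 h2, .cons h3 h4 => by
    rintro a (_ | ⟨_, ha⟩)
    · exact h _ _ h1 h3
    · exact forall_mem_of_forall₂ h h2 h4 a ha

theorem nonempty_factor_mulEquiv (c : CarterType) :
    ∀ F ∈ factors c, Nonempty (F.sub ≃* F.Model) :=
  forall_mem_of_forall₂ (fun _ _ h ⟨e⟩ => ⟨(MulEquiv.subgroupCongr h).trans e⟩)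
    (forall₂_factors c) (nonempty_wordClosure_mulEquiv c)

/-! ### Direct products -/

theorem iSup_wordClosure (L : List (List (List (Fin 7)))) :
    ⨆ i : Fin L.length, wordClosure (L.get i) = wordClosure L.flatten := by
  have : {x | x ∈ L.flatten.map word} = ⋃ i : Fin L.length, {x | x ∈ (L.get i).map word} := by
    ext x
    simp only [List.mem_map, List.mem_flatten, Set.mem_ofPred_eq, Set.mem_iUnion]
    constructor
    · rintro ⟨w, ⟨l, hl, hw⟩, rfl⟩
      obtain ⟨i, rfl⟩ := List.get_of_mem hl
      exact ⟨i, w, hw, rfl⟩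
    · rintro ⟨i, w, hw, rfl⟩
      exact ⟨w, ⟨_, List.get_mem _ _, hw⟩, rfl⟩
  simp only [wordClosure]
  rw [this, Subgroup.closure_iUnion]

theorem checkCommute (c : CarterType) : ∀ i j : Fin (factorWords c).length, i ≠ j →
    ∀ w ∈ (factorWords c).get i, ∀ v ∈ (factorWords c).get j,
      wordCode (w ++ v) = wordCode (v ++ w) := by
  cases c <;> decide +kernel

theorem card_symGrp (n : ℕ) : Nat.card (SymGrp n) = n.factorial := by
  rw [Nat.card_perm, Nat.card_fin]

theorem card_cyc (n : ℕ) : Nat.card (Cyc n) = n :=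
  Nat.card_zmod n

theorem card_sl2 : Nat.card (SpecialLinearGroup (Fin 2) (ZMod 3)) = 24 := by
  rw [Nat.card_eq_fintype_card]
  decide +kernel

/-- With several factors the orders come from the models. -/
theorem prod_card_wordClosure (c : CarterType) :
    ((factorWords c).map fun ws => Nat.card (wordClosure ws)).prod = centralizerOrder c := by
  have h1 {ws} (h : factorWords c = [ws]) :
      ((factorWords c).map fun ws => Nat.card (wordClosure ws)).prod = centralizerOrder c := by
    rw [← card_centralizer_rep c, centralizer_rep, h]
    simp
  have h2 : ∀ {L : List Factor} {L' : List (List (List (Fin 7)))},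
      List.Forall₂ (fun F ws => Nonempty (wordClosure ws ≃* F.Model)) L L' →
        (L'.map fun ws => Nat.card (wordClosure ws)).prod =
          (L.map fun F => Nat.card F.Model).prod := by
    intro L L' h
    induction h with
    | nil => rfl
    | cons h _ ih =>
      obtain ⟨e⟩ := h
      rw [List.map_cons, List.prod_cons, List.map_cons, List.prod_cons, ih,
        Nat.card_congr e.toEquiv]
  cases c
  -- A single factor is the whole centraliser, whose order is known; so no separate computation of
  -- the orders of `W`, `G28`, `G8`, `G25` is required.
  case c1 | cA1A1A1A1 | cD4a1 | cD5 | cD5a1 | cA2A2A2 | cE6 | cE6a1 => exact h1 rfl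
  all_goals
    rw [h2 (nonempty_wordClosure_mulEquiv _)]
    simp only [factors, List.map_cons, List.map_nil, List.prod_cons, List.prod_nil, card_cyc,
      card_symGrp, card_wreath, DihedralGroup.nat_card, card_sl2, centralizerOrder]
    rfl

theorem isInternalDirectProduct_wordClosure (c : CarterType) :
    IsInternalDirectProduct (fun i => wordClosure ((factorWords c).get i))
      (Subgroup.centralizer {rep c}) := by
  refine isInternalDirectProduct_of_card ?_ ?_ ?_
  · intro i j hij x y hx hy
    refine commute_of_mem_closure ?_ hx hy
    intro a ha b hb
    obtain ⟨w, hw, rfl⟩ := List.mem_map.1 ha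
    obtain ⟨v, hv, rfl⟩ := List.mem_map.1 hb
    have := word_eq_word (checkCommute c i j hij w hw v hv)
    rw [word_append, word_append] at this
    exact this
  · rw [iSup_wordClosure, centralizer_rep]
  · rw [card_centralizer_rep, ← prod_card_wordClosure, ← List.prod_ofFn]
    congr 1
    conv_rhs => rw [← List.ofFn_get (factorWords c), List.map_ofFn]
    rfl

theorem isInternalDirectProduct_factors (c : CarterType) :
    IsInternalDirectProduct (fun i => ((factors c).get i).sub)
      (Subgroup.centralizer {rep c}) := by
  have hlen := (forall₂_factors c).length_eq
  have h := isInternalDirectProduct_wordClosure c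
  have key : ∀ {n m : ℕ} (hnm : n = m) (H : Fin m → Subgroup W) (K : Fin n → Subgroup W),
      (∀ i, K i = H (Fin.cast hnm i)) → IsInternalDirectProduct H (Subgroup.centralizer {rep c}) →
      IsInternalDirectProduct K (Subgroup.centralizer {rep c}) := by
    rintro n _ rfl H K hK h
    have : K = H := funext hK
    rwa [this]
  refine key hlen _ _ (fun i => ?_) h
  exact (forall₂_factors c).get i.2 (hlen ▸ i.2)

/-! ### The factors as reflection groups -/

/-- The symmetric group is the wreath product with trivial base, so permutation matrices are a
special case of monomial ones. -/
theorem isReflectionGroup_symGrp (k : Type) [Field k] [NeZero (2 : k)] (n : ℕ) :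
    IsReflectionGroup k (SymGrp n) := by
  let e : Wreath (Cyc 1) n ≃* SymGrp n := MulEquiv.ofBijective SemidirectProduct.rightHom
    ⟨fun x y h => SemidirectProduct.ext (Subsingleton.elim _ _) h,
      SemidirectProduct.rightHom_surjective⟩
  exact IsReflectionGroup.of_mulEquiv
    ⟨n, isReflectionGroup_wreath (1 : Cyc 1 →* kˣ) (Function.injective_of_subsingleton _) n⟩ e

theorem isReflectionGroup_dihedral {k : Type} [Field k] [NeZero (2 : k)]
    (h : ∃ χ : Cyc 2 →* kˣ, Function.Injective χ) : IsReflectionGroup k (DihedralGroup 4) := by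
  obtain ⟨χ, hχ⟩ := h
  obtain ⟨e⟩ := dihedral_mulEquiv_wreath
  exact IsReflectionGroup.of_mulEquiv ⟨2, isReflectionGroup_wreath χ hχ 2⟩ e

theorem isReflectionGroup_W (k : Type) [Field k] [CharZero k] : IsReflectionGroup k W := by
  refine IsReflectionGroup.of_mulEquiv ⟨6, isReflectionGroup_of_roots k
    [[1], [2], [3], [4], [5], [6]] (fun i => Pi.single i 1) (by decide) (by decide +kernel)⟩
    ((MulEquiv.subgroupCongr wordClosure_generators_eq_top).trans Subgroup.topEquiv)

theorem isReflectionGroup_cyc (m : ℕ) [NeZero m] : IsReflectionGroup ℂ (Cyc m) := by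
  obtain ⟨χ, hχ⟩ := exists_complex_character m
  exact ⟨1, isReflectionGroup_of_character χ hχ⟩

theorem isReflectionGroup_wreath_cyc (m n : ℕ) [NeZero m] :
    IsReflectionGroup ℂ (Wreath (Cyc m) n) := by
  obtain ⟨χ, hχ⟩ := exists_complex_character m
  exact ⟨n, isReflectionGroup_wreath χ hχ n⟩

theorem isReflectionGroup_real_cyc_two : IsReflectionGroup ℝ (Cyc 2) := by
  obtain ⟨χ, hχ⟩ := exists_real_character
  exact ⟨1, isReflectionGroup_of_character χ hχ⟩

theorem isReflectionGroup_G28 : IsReflectionGroup ℂ G28 :=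
  IsReflectionGroup.of_mulEquiv ⟨4, wordClosure_G28.2⟩ wordClosure_G28.1.some

theorem isReflectionGroup_real_G28 : IsReflectionGroup ℝ G28 :=
  IsReflectionGroup.of_mulEquiv ⟨4, isReflectionGroup_real_words28⟩ wordClosure_G28.1.some

theorem isReflectionGroup_G8 : IsReflectionGroup ℂ G8 :=
  IsReflectionGroup.of_mulEquiv ⟨2, wordClosure_G8.2⟩ wordClosure_G8.1.some

theorem isReflectionGroup_G25 : IsReflectionGroup ℂ G25 :=
  IsReflectionGroup.of_mulEquiv ⟨3, wordClosure_G25.2⟩ wordClosure_G25.1.some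

theorem isReflectionGroup_sl2 :
    IsReflectionGroup ℂ (SpecialLinearGroup (Fin 2) (ZMod 3)) :=
  IsReflectionGroup.of_mulEquiv ⟨3, isReflectionGroup_Ts3_s5s4⟩ wordClosure_Ts3_s5s4.some

theorem isReflectionGroup_model (c : CarterType) (hc : c ≠ .cA2) :
    ∀ F ∈ factors c, IsReflectionGroup ℂ F.Model := by
  have h1 {S : Subgroup W} {M : Type} [Group M] (h : IsReflectionGroup ℂ M) :
      ∀ G ∈ [(⟨S, M⟩ : Factor)], IsReflectionGroup ℂ G.Model := by simpa using h
  have h2 {S S' : Subgroup W} {M M' : Type} [Group M] [Group M'] (h : IsReflectionGroup ℂ M)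
      (h' : IsReflectionGroup ℂ M') :
      ∀ G ∈ [(⟨S, M⟩ : Factor), ⟨S', M'⟩], IsReflectionGroup ℂ G.Model := by simpa using ⟨h, h'⟩
  have h3 {S S' S'' : Subgroup W} {M M' M'' : Type} [Group M] [Group M'] [Group M'']
      (h : IsReflectionGroup ℂ M) (h' : IsReflectionGroup ℂ M') (h'' : IsReflectionGroup ℂ M'') :
      ∀ G ∈ [(⟨S, M⟩ : Factor), ⟨S', M'⟩, ⟨S'', M''⟩], IsReflectionGroup ℂ G.Model := by
    simpa using ⟨h, h', h''⟩
  have hD : IsReflectionGroup ℂ (DihedralGroup 4) :=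
    isReflectionGroup_dihedral (exists_complex_character 2)
  cases c with
  | c1 => exact h1 (isReflectionGroup_W ℂ)
  | cA1 => exact h2 (isReflectionGroup_cyc 2) (isReflectionGroup_symGrp ℂ 6)
  | cA1A1 => exact h2 hD (isReflectionGroup_symGrp ℂ 4)
  | cA2 => exact absurd rfl hc
  | cA1A1A1 => exact h2 (isReflectionGroup_wreath_cyc 2 3) (isReflectionGroup_cyc 2)
  | cA2A1 =>
    exact h3 (isReflectionGroup_cyc 3) (isReflectionGroup_cyc 2) (isReflectionGroup_symGrp ℂ 3)
  | cA3 => exact h2 (isReflectionGroup_cyc 4) hD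
  | cA1A1A1A1 => exact h1 isReflectionGroup_G28
  | cA2A1A1 => exact h2 (isReflectionGroup_cyc 3) hD
  | cA2A2 => exact h2 (isReflectionGroup_wreath_cyc 3 2) (isReflectionGroup_symGrp ℂ 3)
  | cA3A1 => exact h3 (isReflectionGroup_cyc 4) (isReflectionGroup_cyc 2) (isReflectionGroup_cyc 2)
  | cA4 => exact h2 (isReflectionGroup_cyc 5) (isReflectionGroup_cyc 2)
  | cD4 => exact h2 (isReflectionGroup_cyc 6) (isReflectionGroup_symGrp ℂ 3)
  | cD4a1 => exact h1 isReflectionGroup_G8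
  | cA2A2A1 => exact h2 (isReflectionGroup_wreath_cyc 3 2) (isReflectionGroup_cyc 2)
  | cA3A1A1 => exact h2 (isReflectionGroup_cyc 4) (isReflectionGroup_symGrp ℂ 4)
  | cA4A1 => exact h2 (isReflectionGroup_cyc 5) (isReflectionGroup_cyc 2)
  | cA5 => exact h2 (isReflectionGroup_cyc 6) (isReflectionGroup_cyc 2)
  | cD5 => exact h1 (isReflectionGroup_cyc 8)
  | cD5a1 => exact h1 (isReflectionGroup_cyc 12)
  | cA2A2A2 => exact h1 isReflectionGroup_G25
  | cA5A1 => exact h2 (isReflectionGroup_cyc 6) (isReflectionGroup_symGrp ℂ 3)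
  | cE6 => exact h1 (isReflectionGroup_cyc 12)
  | cE6a1 => exact h1 (isReflectionGroup_cyc 9)
  | cE6a2 => exact h2 (isReflectionGroup_cyc 3) isReflectionGroup_sl2

theorem sq_rep_eq_one (c : CarterType) (h : rep c ^ 2 = 1) :
    c = .c1 ∨ c = .cA1 ∨ c = .cA1A1 ∨ c = .cA1A1A1 ∨ c = .cA1A1A1A1 := by
  -- For every other representative the square visibly moves some weight.
  have h1 : (c = .c1 ∨ c = .cA1 ∨ c = .cA1A1 ∨ c = .cA1A1A1 ∨ c = .cA1A1A1A1) ∨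
      ∃ j < 27, look (wordCode (repWord c ++ repWord c)) j ≠ j := by
    cases c <;> first | (left; simp; done) | (right; decide +kernel)
  refine h1.resolve_right fun ⟨j, hj, hne⟩ => hne ?_
  rw [← (isCode_word _).act_eq hj, word_append, word_repWord, ← sq, h, act_one]

theorem isReflectionGroup_real_model (c : CarterType) (hc : rep c ^ 2 = 1) :
    ∀ F ∈ factors c, IsReflectionGroup ℝ F.Model := by
  have h1 {S : Subgroup W} {M : Type} [Group M] (h : IsReflectionGroup ℝ M) :
      ∀ G ∈ [(⟨S, M⟩ : Factor)], IsReflectionGroup ℝ G.Model := by simpa using h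
  have h2 {S S' : Subgroup W} {M M' : Type} [Group M] [Group M'] (h : IsReflectionGroup ℝ M)
      (h' : IsReflectionGroup ℝ M') :
      ∀ G ∈ [(⟨S, M⟩ : Factor), ⟨S', M'⟩], IsReflectionGroup ℝ G.Model := by simpa using ⟨h, h'⟩
  rcases sq_rep_eq_one c hc with rfl | rfl | rfl | rfl | rfl
  · exact h1 (isReflectionGroup_W ℝ)
  · exact h2 isReflectionGroup_real_cyc_two (isReflectionGroup_symGrp ℝ 6)
  · exact h2 (isReflectionGroup_dihedral exists_real_character) (isReflectionGroup_symGrp ℝ 4)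
  · obtain ⟨χ, hχ⟩ := exists_real_character
    exact h2 ⟨3, isReflectionGroup_wreath χ hχ 3⟩ isReflectionGroup_real_cyc_two
  · exact h1 isReflectionGroup_real_G28

theorem isReflectionGroup_centralizer_rep {k : Type} [Field k] (c : CarterType)
    (h : ∀ F ∈ factors c, IsReflectionGroup k F.Model) :
    IsReflectionGroup k (Subgroup.centralizer {rep c}) := by
  obtain ⟨e, -⟩ := isInternalDirectProduct_factors c
  refine IsReflectionGroup.of_mulEquiv (isReflectionGroup_pi fun i => ?_) e
  obtain ⟨f⟩ := nonempty_factor_mulEquiv c _ (List.get_mem _ i)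
  exact (h _ (List.get_mem _ i)).of_mulEquiv f.symm

/-! ### The subgroup of type `D₄` -/

def simpleReflectionD4 (i : Fin 4) : GL (Fin 4) ℤ where
  val := 1 - vecMulVec (Pi.single i 1) (CartanMatrix.D 4 i)
  inv := 1 - vecMulVec (Pi.single i 1) (CartanMatrix.D 4 i)
  val_inv := by revert i; decide +kernel
  inv_val := by revert i; decide +kernel

theorem weylGroup_D4_eq :
    weylGroup (CartanMatrix.D 4) = Subgroup.closure (Set.range simpleReflectionD4) := by
  rw [weylGroup]
  congr 1
  ext g
  exact exists_congr fun i => ⟨fun h => Units.ext h.symm, fun h => h ▸ rfl⟩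

/-- The columns are `r₀, -r_T, r₁, r₅`, a system of simple roots of type `D₄` with `-r_T` as central
node; the generators are reordered accordingly. -/
theorem wordClosure_D4 :
    Nonempty (wordClosure [[0], [1], [5], TWord] ≃* weylGroup (CartanMatrix.D 4)) := by
  obtain ⟨φ, -⟩ := exists_mulEquiv_GL (RingHom.id ℤ) Function.injective_id
    [[0], TWord, [1], [5]] simpleReflectionD4 1
    !![-1, 0, 1, 0; -2, 1, 0, 0; -3, 1, 0, 0; -2, 1, 0, 0; -1, 0, 0, 1; -2, 1, 0, 0]
    (d := 1) (e := 1) one_ne_zero one_ne_zero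
    (fun i => 1 - vecMulVec (Pi.single i 1) (CartanMatrix.D 4 i)) (fun k => by
      rw [Units.val_one, Matrix.one_mul, Matrix.mul_one, map_one, one_smul]
      rfl) (by decide +kernel)
    !![0, 1, -1, 0, 0, 0; 0, 3, -2, 0, 0, 0; 1, 1, -1, 0, 0, 0; 0, 1, -1, 0, 1, 0]
    (by decide +kernel) (pts := [22, 23, 24, 25, 26]) (by decide +kernel) (by decide +kernel)
  have h : wordClosure [[0], [1], [5], TWord] = wordClosure [[0], TWord, [1], [5]] :=
    le_antisymm
      (wordClosure_le_of_words (ws := [[0], [1], [5], TWord]) (vs := [[0], TWord, [1], [5]])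
        ![[0], [2], [3], [1]] (by decide +kernel))
      (wordClosure_le_of_words (ws := [[0], TWord, [1], [5]]) (vs := [[0], [1], [5], TWord])
        ![[0], [3], [1], [2]] (by decide +kernel))
  exact ⟨((MulEquiv.subgroupCongr h).trans φ).trans (MulEquiv.subgroupCongr weylGroup_D4_eq.symm)⟩

/-- The conjugating generators are involutions, so the inclusion under conjugation in one direction
also gives the reverse one. -/
theorem wordClosure_le_normalizer {ws us : List (List (Fin 7))}
    (hu : ∀ u ∈ us, wordCode (u ++ u) = wordCode [])
    (h : ∀ u ∈ us, ∀ w ∈ ws, ∃ w' ∈ ws, wordCode (u ++ w ++ u) = wordCode w') :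
    wordClosure us ≤ Subgroup.normalizer (wordClosure ws : Set W) := by
  rw [wordClosure, Subgroup.closure_le]
  intro g hg
  obtain ⟨u, hu', rfl⟩ := List.mem_map.1 hg
  have h1 : word u * word u = 1 := by
    rw [← word_append, word_eq_word (hu u hu'), word_nil]
  have hinv : (word u)⁻¹ = word u := inv_eq_of_mul_eq_one_right h1
  have h2 : wordClosure ws ≤ (wordClosure ws).comap (MulAut.conj (word u)).toMonoidHom := by
    rw [wordClosure, Subgroup.closure_le]
    intro x hx
    obtain ⟨w, hw, rfl⟩ := List.mem_map.1 hx
    obtain ⟨w', hw', hc⟩ := h u hu' w hw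
    have : word u * word w * (word u)⁻¹ = word w' := by
      rw [hinv, ← word_eq_word hc, word_append, word_append]
    change word u * word w * (word u)⁻¹ ∈ wordClosure ws
    rw [this]
    exact Subgroup.subset_closure (List.mem_map_of_mem hw')
  have h3 (x) (hx : x ∈ wordClosure ws) : word u * x * word u ∈ wordClosure ws := by
    have : word u * x * (word u)⁻¹ ∈ wordClosure ws := h2 hx
    rwa [hinv] at this
  refine Subgroup.mem_normalizer_iff.2 fun x => ?_
  rw [hinv]
  refine ⟨h3 x, fun hx => ?_⟩
  have := h3 _ hx
  rwa [← mul_assoc, ← mul_assoc, h1, one_mul, mul_assoc, h1, mul_one] at this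

theorem mem_wordClosure_u₁_u₂ {x : W} (hx : x ∈ wordClosure [u₁Word, u₂Word]) :
    ∃ w ∈ [[], u₁Word, u₂Word, u₁Word ++ u₂Word, u₂Word ++ u₁Word, u₁Word ++ u₂Word ++ u₁Word],
      x = word w := by
  obtain ⟨e, he⟩ := wordClosure_u₁_u₂
  let g (k) : wordClosure [u₁Word, u₂Word] := ⟨word ([u₁Word, u₂Word].get k), word_mem_wordClosure k⟩
  have h1 : e (g 0) = Equiv.swap 1 2 := he 0
  have h2 : e (g 1) = Equiv.swap 0 1 := he 1
  have h : ∀ σ : SymGrp 3, σ = 1 ∨ σ = Equiv.swap 1 2 ∨ σ = Equiv.swap 0 1 ∨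
      σ = Equiv.swap 1 2 * Equiv.swap 0 1 ∨ σ = Equiv.swap 0 1 * Equiv.swap 1 2 ∨
      σ = Equiv.swap 1 2 * Equiv.swap 0 1 * Equiv.swap 1 2 := by decide
  have h3 := h (e ⟨x, hx⟩)
  rw [← h1, ← h2, ← map_mul, ← map_mul, ← map_mul, ← map_one e] at h3
  simp only [e.injective.eq_iff] at h3
  have hv {y : wordClosure [u₁Word, u₂Word]} (hy : ⟨x, hx⟩ = y) : x = y := congrArg Subtype.val hy
  rcases h3 with h3 | h3 | h3 | h3 | h3 | h3
  · exact ⟨[], by simp, (hv h3).trans word_nil.symm⟩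
  · exact ⟨u₁Word, by simp, hv h3⟩
  · exact ⟨u₂Word, by simp, hv h3⟩
  · exact ⟨u₁Word ++ u₂Word, by simp, (hv h3).trans (word_append _ _).symm⟩
  · exact ⟨u₂Word ++ u₁Word, by simp, (hv h3).trans (word_append _ _).symm⟩
  · exact ⟨u₁Word ++ u₂Word ++ u₁Word, by simp,
      (hv h3).trans (by rw [word_append, word_append]; rfl)⟩

/-- The subgroup of type `D₄` fixes the weights numbered 6, 11 and 20, while each nontrivial element
of the complement moves 6 or 11. -/
theorem isInternalSemidirectProduct_D4 :
    IsInternalSemidirectProduct (wordClosure [[0], [1], [5], TWord])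
      (wordClosure [u₁Word, u₂Word]) (Subgroup.centralizer {rep .cA1A1A1A1}) := by
  refine ⟨wordClosure_le_normalizer (by decide +kernel) (by decide +kernel), ?_, ?_⟩
  · rw [Subgroup.disjoint_def]
    intro x hx1 hx2
    have h1 : x ∈ fixingCentralizer ⊤ [6, 11, 20] := by
      refine closure_le_fixing ?_ hx1
      intro y hy p hp
      obtain ⟨w, hw, rfl⟩ := List.mem_map.1 hy
      have hlt : ∀ p ∈ [6, 11, 20], p < 27 := by decide
      rw [(isCode_word w).act_eq (hlt p hp)]
      revert w p
      decide +kernel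
    obtain ⟨w, hw, rfl⟩ := mem_wordClosure_u₁_u₂ hx2
    have h2 : ∀ w ∈ [[], u₁Word, u₂Word, u₁Word ++ u₂Word, u₂Word ++ u₁Word,
        u₁Word ++ u₂Word ++ u₁Word], w = [] ∨ look (wordCode w) 6 ≠ 6 ∨
          look (wordCode w) 11 ≠ 11 := by decide +kernel
    rcases h2 w hw with rfl | h | h
    · exact word_nil
    · refine absurd (h1.2 6 (by simp)) ?_
      rwa [(isCode_word w).act_eq (by norm_num)]
    · refine absurd (h1.2 11 (by simp)) ?_
      rwa [(isCode_word w).act_eq (by norm_num)]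
  · rw [centralizer_rep, wordClosure, wordClosure, ← Subgroup.closure_union, wordClosure]
    congr 1
    ext x
    simp [factorWords, or_assoc]

/-! ### The affine group of the plane over the field of three elements -/

/-- The affine permutations of `𝔽₃²` given by `Wreath (SymGrp 3) 2`, as matrices. -/
def affineMatrix (x : Wreath (SymGrp 3) 2) : Matrix (Fin 3) (Fin 3) (ZMod 3) :=
  let a (i : Fin 2) : ZMod 3 := x.left i 1 - x.left i 0
  let b (i : Fin 2) : ZMod 3 := x.left i 0
  !![if x.right 0 = 0 then a 0 else 0, if x.right 1 = 0 then a 0 else 0, b 0;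
    if x.right 0 = 1 then a 1 else 0, if x.right 1 = 1 then a 1 else 0, b 1; 0, 0, 1]

def affinePoint (y : Fin 2 → Fin 3) : Fin 3 → ZMod 3 := ![y 0, y 1, 1]

/-- The product action on nine points. Each permutation of the field of three elements is affine, so
this is an action by affine maps of the plane. -/
def wreathAct (x : Wreath (SymGrp 3) 2) (y : Fin 2 → Fin 3) (i : Fin 2) : Fin 3 :=
  x.left i (y (x.right.symm i))

theorem affineMatrix_mulVec (x : Wreath (SymGrp 3) 2) (y : Fin 2 → Fin 3) :
    affineMatrix x *ᵥ affinePoint y = affinePoint (wreathAct x y) := by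
  have h : ∀ (f0 f1 : SymGrp 3) (τ : Equiv.Perm (Fin 2)) (y0 y1 : Fin 3),
      affineMatrix ⟨![f0, f1], τ⟩ *ᵥ affinePoint ![y0, y1] =
        affinePoint (wreathAct ⟨![f0, f1], τ⟩ ![y0, y1]) := by decide +kernel
  have hx : x = ⟨![x.left 0, x.left 1], x.right⟩ :=
    SemidirectProduct.ext (by funext i; fin_cases i <;> rfl) rfl
  have hy : y = ![y 0, y 1] := by funext i; fin_cases i <;> rfl
  rw [hx, hy]
  exact h _ _ _ _ _

theorem wreathAct_mul (x z : Wreath (SymGrp 3) 2) (y : Fin 2 → Fin 3) :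
    wreathAct (x * z) y = wreathAct x (wreathAct z y) := rfl

theorem eq_of_affinePoint {A B : Matrix (Fin 3) (Fin 3) (ZMod 3)}
    (h : ∀ y, A *ᵥ affinePoint y = B *ᵥ affinePoint y) : A = B := by
  have h0 : (Pi.single 2 1 : Fin 3 → ZMod 3) = affinePoint ![0, 0] := by decide
  have h1 : (Pi.single 0 1 : Fin 3 → ZMod 3) = affinePoint ![1, 0] - affinePoint ![0, 0] := by decide
  have h2 : (Pi.single 1 1 : Fin 3 → ZMod 3) = affinePoint ![0, 1] - affinePoint ![0, 0] := by decide
  refine Matrix.ext_of_mulVec_single fun i => ?_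
  fin_cases i
  · change A *ᵥ Pi.single 0 1 = B *ᵥ Pi.single 0 1
    rw [h1, mulVec_sub, mulVec_sub, h, h]
  · change A *ᵥ Pi.single 1 1 = B *ᵥ Pi.single 1 1
    rw [h2, mulVec_sub, mulVec_sub, h, h]
  · change A *ᵥ Pi.single 2 1 = B *ᵥ Pi.single 2 1
    rw [h0, h]

def affineHom : Wreath (SymGrp 3) 2 →* Matrix (Fin 3) (Fin 3) (ZMod 3) where
  toFun := affineMatrix
  map_one' := eq_of_affinePoint fun y => by
    rw [affineMatrix_mulVec, one_mulVec]; rfl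
  map_mul' x z := eq_of_affinePoint fun y => by
    rw [affineMatrix_mulVec, wreathAct_mul, ← mulVec_mulVec, affineMatrix_mulVec,
      affineMatrix_mulVec]

/-- A transposition in one coordinate is `x ↦ b - x`, and interchanging the coordinates is a
reflection too. Embedding the affine plane at height 1 makes both linear reflections in dimension
three, and they generate. -/
theorem isReflectionGroup_wreath_symGrp_three :
    IsReflectionGroupOfRank (ZMod 3) 3 (Wreath (SymGrp 3) 2) := by
  refine ⟨Finite.of_equiv _ SemidirectProduct.equivProd.symm, affineHom.toHomUnits, ?_, ?_⟩
  · rw [injective_iff_map_eq_one]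
    intro x hx
    have h1 : affineMatrix x = 1 := congrArg Units.val hx
    have hpt : ∀ y z, affinePoint y = affinePoint z → y = z := by decide
    have h2 (y) : wreathAct x y = y := hpt _ _ (by rw [← affineMatrix_mulVec, h1, one_mulVec])
    have h : ∀ (f0 f1 : SymGrp 3) (τ : Equiv.Perm (Fin 2)),
        (∀ y, wreathAct ⟨![f0, f1], τ⟩ y = y) → f0 = 1 ∧ f1 = 1 ∧ τ = 1 := by decide +kernel
    have hx : x = ⟨![x.left 0, x.left 1], x.right⟩ :=
      SemidirectProduct.ext (by funext i; fin_cases i <;> rfl) rfl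
    obtain ⟨e0, e1, e2⟩ := h (x.left 0) (x.left 1) x.right (by rwa [← hx])
    exact SemidirectProduct.ext (by funext i; fin_cases i; exacts [e0, e1]) e2
  · let C := Subgroup.closure {g | IsReflection (affineHom.toHomUnits g)}
    have hC (x) (h : IsReflection (affineHom.toHomUnits x)) : x ∈ C :=
      Subgroup.subset_closure h
    -- The matrix differs from 1 only in row `i`: the covector collects the linear coefficient minus
    -- one and the translation.
    have hswap : ∀ (i : Fin 2) (j k : Fin 3), j ≠ k →
        (Pi.single i.castSucc (Equiv.swap j k 1 - Equiv.swap j k 0 - 1) +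
            Pi.single 2 (Equiv.swap j k 0) : Fin 3 → ZMod 3) ⬝ᵥ Pi.single i.castSucc 1 ≠ 0 ∧
          affineMatrix ⟨Pi.mulSingle i (Equiv.swap j k), 1⟩ =
            1 + vecMulVec (Pi.single i.castSucc 1)
              (Pi.single i.castSucc (Equiv.swap j k 1 - Equiv.swap j k 0 - 1) +
                Pi.single 2 (Equiv.swap j k 0) : Fin 3 → ZMod 3) := by decide +kernel
    have hl (f : Fin 2 → SymGrp 3) : (SemidirectProduct.inl f : Wreath (SymGrp 3) 2) ∈ C := by
      have h1 : f ∈ C.comap SemidirectProduct.inl := by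
        refine Subgroup.pi_mem_of_mulSingle_mem f fun i => ?_
        have h2 : Subgroup.closure {τ : SymGrp 3 | τ.IsSwap} ≤
            (C.comap SemidirectProduct.inl).comap (MonoidHom.mulSingle (fun _ => SymGrp 3) i) := by
          rw [Subgroup.closure_le]
          rintro _ ⟨j, k, hjk, rfl⟩
          exact hC _ ⟨_, _, hswap i j k hjk⟩
        rw [Equiv.Perm.closure_isSwap] at h2
        exact h2 (Subgroup.mem_top (f i))
      exact h1
    have hr (σ : Equiv.Perm (Fin 2)) : (SemidirectProduct.inr σ : Wreath (SymGrp 3) 2) ∈ C := by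
      have h : ∀ σ : Equiv.Perm (Fin 2), σ = 1 ∨ σ = Equiv.swap 0 1 := by decide
      rcases h σ with rfl | rfl
      · rw [map_one]; exact one_mem _
      -- Modulo 3 the covector is `(1, -1, 0)` and the vector `(-1, 1, 0)`.
      · refine hC _ ⟨![1, 2, 0], ![2, 1, 0], by decide, ?_⟩
        change affineMatrix ⟨1, Equiv.swap 0 1⟩ = _
        decide +kernel
    rw [eq_top_iff]
    intro x _
    rw [← SemidirectProduct.inl_left_mul_inr_right x]
    exact mul_mem (hl _) (hr _)

/-! ### Consequences of being generated by reflections -/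

theorem IsReflection.conj {k : Type} [Field k] {n : ℕ} {g : GL (Fin n) k} (hg : IsReflection g)
    (h : GL (Fin n) k) : IsReflection (h * g * h⁻¹) := by
  obtain ⟨f, v, hfv, e⟩ := hg
  refine ⟨f ᵥ* (h⁻¹ : GL (Fin n) k).val, h.val *ᵥ v, ?_, ?_⟩
  · rwa [← dotProduct_mulVec, mulVec_mulVec, Units.inv_mul, one_mulVec]
  · rw [Units.val_mul, Units.val_mul, e, mul_add, add_mul, mul_one, Units.mul_inv,
      mul_vecMulVec, vecMulVec_mul]

theorem exists_pow_eq_one_add_smul {k : Type} [Field k] {n : ℕ} (f v : Fin n → k) (j : ℕ) :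
    ∃ c : k, (1 + vecMulVec v f) ^ j = 1 + c • vecMulVec v f := by
  induction j with
  | zero => exact ⟨0, by simp⟩
  | succ j ih =>
    obtain ⟨c, hc⟩ := ih
    refine ⟨c + 1 + c * (f ⬝ᵥ v), ?_⟩
    rw [pow_succ, hc, add_mul, mul_add, mul_add, one_mul, mul_one, one_mul, smul_mul_assoc,
      vecMulVec_mul_vecMulVec, vecMulVec_smul, smul_smul]
    module

/-- A nontrivial power of `1 + v f` is `1 + c v f` with `c ≠ 0`, so commuting with either means
commuting with `v f`. This is a purely group-theoretic obstruction to being a reflection. -/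
theorem IsReflection.commute_of_pow {k : Type} [Field k] {n : ℕ} {g h : GL (Fin n) k}
    (hg : IsReflection g) {j : ℕ} (hj : g ^ j ≠ 1) (hc : Commute h (g ^ j)) : Commute h g := by
  obtain ⟨f, v, -, e⟩ := hg
  obtain ⟨c, hc'⟩ := exists_pow_eq_one_add_smul f v j
  have e' : (g ^ j).val = 1 + c • vecMulVec v f := by rw [Units.val_pow_eq_pow_val, e, hc']
  have hc0 : c ≠ 0 := fun h0 => hj (Units.ext (by rw [e', h0, zero_smul, add_zero, Units.val_one]))
  have h1 := congrArg Units.val hc.eq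
  rw [Units.val_mul, Units.val_mul, e', mul_add, add_mul, mul_one, one_mul, add_right_inj,
    mul_smul_comm, smul_mul_assoc] at h1
  refine Units.ext ?_
  rw [Units.val_mul, Units.val_mul, e, mul_add, add_mul, mul_one, one_mul,
    smul_right_injective _ hc0 h1]

/-- A central element has every root as an eigenvector, with an eigenvalue that is a real root of
unity, hence ±1. So `Z ^ 2 - 1` kills all roots and is unchanged when multiplied on the right by
group elements. -/
theorem pow_eq_one_of_isReflectionGroup_real {G : Type} [Group G] (hG : IsReflectionGroup ℝ G)
    {z : G} (hz : ∀ g, Commute z g) : z ^ 2 = 1 := by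
  obtain ⟨n, hfin, ρ, hρ, hcl⟩ := hG
  set Z : Matrix (Fin n) (Fin n) ℝ := (ρ z).val with hZ
  have hm : orderOf z ≠ 0 := (orderOf_pos z).ne'
  have hZm : Z ^ orderOf z = 1 := by
    rw [hZ, ← Units.val_pow_eq_pow_val, ← map_pow, pow_orderOf_eq_one, map_one, Units.val_one]
  have key (g : G) : (Z ^ 2 - 1) * (ρ g).val = Z ^ 2 - 1 := by
    have hg : g ∈ Subgroup.closure {g : G | IsReflection (ρ g)} := hcl ▸ Subgroup.mem_top g
    induction hg using Subgroup.closure_induction with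
    | one => rw [map_one, Units.val_one, mul_one]
    | mul a b _ _ ha hb => rw [map_mul, Units.val_mul, ← mul_assoc, ha, hb]
    | inv a _ ha =>
      nth_rewrite 1 [← ha]
      rw [mul_assoc, ← Units.val_mul, ← map_mul, mul_inv_cancel, map_one, Units.val_one, mul_one]
    | mem r hr =>
      obtain ⟨f, v, hfv, e⟩ := hr
      have h1 : Z * (ρ r).val = (ρ r).val * Z := by
        rw [hZ, ← Units.val_mul, ← Units.val_mul, ← map_mul, ← map_mul, (hz r).eq]
      rw [e, mul_add, add_mul, mul_one, one_mul, add_right_inj, mul_vecMulVec,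
        vecMulVec_mul] at h1
      have h2 : (f ⬝ᵥ v) • (Z *ᵥ v) = (f ⬝ᵥ Z *ᵥ v) • v := by
        have := congrArg (· *ᵥ v) h1
        simpa [vecMulVec_mulVec, dotProduct_mulVec] using this
      have h3 : Z *ᵥ v = ((f ⬝ᵥ v)⁻¹ * (f ⬝ᵥ Z *ᵥ v)) • v := by
        rw [mul_smul, ← h2, smul_smul, inv_mul_cancel₀ hfv, one_smul]
      generalize (f ⬝ᵥ v)⁻¹ * (f ⬝ᵥ Z *ᵥ v) = c at h3
      have hpow (j : ℕ) : (Z ^ j) *ᵥ v = c ^ j • v := by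
        induction j with
        | zero => simp
        | succ j ih => rw [pow_succ, ← mulVec_mulVec, h3, mulVec_smul, ih, smul_smul, pow_succ']
      have hv : v ≠ 0 := by rintro rfl; simp at hfv
      have hc : c ^ orderOf z = 1 := by
        have := hpow (orderOf z)
        rw [hZm, one_mulVec] at this
        exact smul_left_injective ℝ hv (by simpa using this.symm)
      have hc2 : c ^ 2 = 1 := by
        rw [← sq_abs, (pow_eq_one_iff_of_nonneg (abs_nonneg c) hm).1
          (by rw [← abs_pow, hc, abs_one]), one_pow]
      rw [e, mul_add, mul_one, mul_vecMulVec, sub_mulVec, one_mulVec, hpow, hc2, one_smul,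
        sub_self, zero_vecMulVec, add_zero]
  -- Applied to `z ^ 2` itself this gives `A ^ 2 = 0`, so `Z ^ 2 = 1 + A` is unipotent. Being of
  -- finite order in characteristic zero, it is 1.
  have h0 := key (z ^ 2)
  rw [map_pow, Units.val_pow_eq_pow_val, ← hZ] at h0
  obtain ⟨A, hA⟩ : ∃ A, A = Z ^ 2 - 1 := ⟨_, rfl⟩
  have hZA : Z ^ 2 = 1 + A := by rw [hA]; abel
  rw [hZA, add_sub_cancel_left, mul_add, mul_one, add_eq_left] at h0
  have hpow (j : ℕ) : (1 + A) ^ j = 1 + (j : ℝ) • A := by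
    induction j with
    | zero => simp
    | succ j ih =>
      rw [pow_succ, ih, mul_add, mul_one, add_mul, one_mul, smul_mul_assoc, h0]
      push_cast
      module
  have h1 := hpow (orderOf z)
  rw [← hZA, ← pow_mul, mul_comm, pow_mul, hZm, one_pow, left_eq_add] at h1
  have h2 : A = 0 := (smul_eq_zero.1 h1).resolve_left (Nat.cast_ne_zero.2 hm)
  refine hρ (Units.ext ?_)
  rw [map_pow, Units.val_pow_eq_pow_val, ← hZ, hZA, h2, add_zero, map_one, Units.val_one]

/-! ### Commuting and braiding reflections of order two -/

section

variable {k : Type} [Field k] {n : ℕ}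

theorem dotProduct_eq_neg_two {f v : Fin n → k} (hfv : f ⬝ᵥ v ≠ 0)
    (h : (1 + vecMulVec v f) * (1 + vecMulVec v f) = 1) : f ⬝ᵥ v = -2 := by
  have h1 := congrArg (fun M => f ⬝ᵥ M *ᵥ v) h
  simp only [← mulVec_mulVec, add_mulVec, one_mulVec, vecMulVec_mulVec, mulVec_add,
    dotProduct_add, op_smul_eq_smul, dotProduct_smul, smul_eq_mul, mulVec_smul] at h1
  have h2 : (f ⬝ᵥ v) * (f ⬝ᵥ v) * (f ⬝ᵥ v + 2) = 0 := by linear_combination h1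
  have := (mul_eq_zero.1 h2).resolve_left (mul_ne_zero hfv hfv)
  linear_combination this

variable [CharZero k]

/-- If the pairing were nonzero, comparing the rank one products in both orders would make the two
vectors, and likewise the two covectors, proportional with reciprocal scalars, and the reflections
would coincide. -/
theorem dotProduct_eq_zero_of_commute {f v g w : Fin n → k} (hf : f ⬝ᵥ v = -2) (hg : g ⬝ᵥ w = -2)
    (hc : Commute (1 + vecMulVec v f) (1 + vecMulVec w g))
    (hne : 1 + vecMulVec v f ≠ 1 + vecMulVec w g) : f ⬝ᵥ w = 0 := by
  by_contra h0
  have h1 := hc.eq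
  have h2 : (f ⬝ᵥ w) • vecMulVec v g = (g ⬝ᵥ v) • vecMulVec w f := by
    have h3 : vecMulVec v f * vecMulVec w g = vecMulVec w g * vecMulVec v f := by
      have e1 : (1 + vecMulVec v f) * (1 + vecMulVec w g) =
        1 + vecMulVec v f + vecMulVec w g + vecMulVec v f * vecMulVec w g := by noncomm_ring
      have e2 : (1 + vecMulVec w g) * (1 + vecMulVec v f) =
        1 + vecMulVec v f + vecMulVec w g + vecMulVec w g * vecMulVec v f := by noncomm_ring
      rw [e1, e2] at h1
      exact add_left_cancel h1
    simpa [vecMulVec_mul_vecMulVec, vecMulVec_smul] using h3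
  have hv : v = (-(g ⬝ᵥ v) / 2) • w := by
    have := congrArg (· *ᵥ w) h2
    simp only [smul_mulVec, vecMulVec_mulVec, op_smul_eq_smul, smul_smul, hg] at this
    have h4 : (f ⬝ᵥ w) • v = (f ⬝ᵥ w) • (-(g ⬝ᵥ v) / 2) • w := by
      trans (-1 / 2 : k) • (f ⬝ᵥ w * -2) • v
      · module
      · rw [this]; module
    exact smul_right_injective _ h0 h4
  have hgf : g = (-(g ⬝ᵥ v) / 2) • f := by
    have := congrArg (f ᵥ* ·) h2
    simp only [vecMul_smul, vecMul_vecMulVec, smul_smul, hf] at this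
    have h4 : (f ⬝ᵥ w) • g = (f ⬝ᵥ w) • (-(g ⬝ᵥ v) / 2) • f := by
      trans (-1 / 2 : k) • (f ⬝ᵥ w * -2) • g
      · module
      · rw [this]; module
    exact smul_right_injective _ h0 h4
  refine hne (congrArg (1 + ·) ?_)
  conv_lhs => rw [hv]
  conv_rhs => rw [hgf]
  rw [smul_vecMulVec, vecMulVec_smul]

/-- When the product of the two mixed pairings is 4, the product of the reflections is unipotent,
with `N ^ 3 = 0`. A unipotent element whose cube is 1 is trivial in characteristic zero. -/
theorem eq_of_braid {f v f' v' : Fin n → k} (hf : f ⬝ᵥ v = -2) (hf' : f' ⬝ᵥ v' = -2)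
    (hpq : (f ⬝ᵥ v') * (f' ⬝ᵥ v) = 4)
    (hb : ((1 + vecMulVec v f) * (1 + vecMulVec v' f')) ^ 3 = 1) :
    (1 + vecMulVec v f) * (1 + vecMulVec v' f') = 1 := by
  set A := vecMulVec v f with hA
  set B := vecMulVec v' f' with hB
  have AA : A * A = (-2 : k) • A := by rw [hA, vecMulVec_mul_vecMulVec, hf, vecMulVec_smul]
  have BB : B * B = (-2 : k) • B := by rw [hB, vecMulVec_mul_vecMulVec, hf', vecMulVec_smul]
  have ABA : A * B * A = (4 : k) • A := by
    rw [hA, hB, vecMulVec_mul_vecMulVec, vecMulVec_smul, smul_mul_assoc, vecMulVec_mul_vecMulVec,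
      vecMulVec_smul, smul_smul, hpq]
  have BAB : B * A * B = (4 : k) • B := by
    rw [hA, hB, vecMulVec_mul_vecMulVec, vecMulVec_smul, smul_mul_assoc, vecMulVec_mul_vecMulVec,
      vecMulVec_smul, smul_smul, mul_comm, hpq]
  obtain ⟨N, hN⟩ : ∃ N, N = A + B + A * B := ⟨_, rfl⟩
  have hC : (1 + A) * (1 + B) = 1 + N := by rw [hN]; noncomm_ring
  have N2 : N * N = (2 : k) • A + (2 : k) • B + A * B + B * A := by
    have : N * N = A * A + A * B + A * A * B + B * A + B * B + B * A * B + A * B * A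
      + A * (B * B) + A * B * A * B := by rw [hN]; noncomm_ring
    rw [this, ABA, BAB, AA, BB]
    simp only [smul_mul_assoc, mul_smul_comm]
    module
  have N3 : N * N * N = 0 := by
    have : N * N * N = (2 : k) • (A * A) + (2 : k) • (A * B) + (2 : k) • (A * A * B) +
      (2 : k) • (B * A) + (2 : k) • (B * B) + (2 : k) • (B * A * B) + A * B * A + A * (B * B) +
      A * B * A * B + B * (A * A) + B * A * B + B * (A * A) * B := by
      rw [N2, hN]
      simp only [mul_add, add_mul, smul_mul_assoc, mul_assoc]
      abel
    rw [this, ABA, BAB, AA, BB]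
    simp only [smul_mul_assoc, mul_smul_comm, BAB]
    module
  have h1 : (1 + N) ^ 3 = 1 + (3 : k) • (N + N * N) + N * N * N := by
    have : (1 + N) ^ 3 = 1 + (N + N + N + (N * N + N * N + N * N)) + N * N * N := by noncomm_ring
    rw [this]
    congr 2
    module
  rw [hC] at hb
  rw [h1, N3, add_zero, add_eq_left, smul_eq_zero] at hb
  have h2 : N + N * N = 0 := hb.resolve_left (by norm_num)
  have h3 : N * N = 0 := by
    have := congrArg (· * N) h2
    simpa [add_mul, N3] using this
  rw [h3, add_zero] at h2
  rw [hC, h2, add_zero]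

end

/-! ### The wreath product `S₃ ≀ C₂` is not a complex reflection group -/

/-- `S` and `S'` generate a group of type `S₃`, and `t` carries it to a copy that commutes with it.
Commuting makes each covector vanish on `t v` and `t v'`. If `t` is a reflection, `t v - v` and `t
v' - v'` are multiples of one vector, and this degeneracy contradicts the braid relation. -/
theorem not_isReflection_of_swap {k : Type} [Field k] [CharZero k] {n : ℕ} {S S' t : GL (Fin n) k}
    (hS : IsReflection S) (hS' : IsReflection S') (ht : IsReflection t)
    (hS2 : S * S = 1) (hS2' : S' * S' = 1) (ht2 : t * t = 1) (hne : S ≠ S')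
    (hb : (S * S') ^ 3 = 1) (h1 : Commute S (t * S * t)) (h2 : Commute S (t * S' * t))
    (h3 : Commute S' (t * S * t)) (h4 : Commute S' (t * S' * t)) (n1 : S ≠ t * S * t)
    (n2 : S ≠ t * S' * t) (n3 : S' ≠ t * S * t) (n4 : S' ≠ t * S' * t) : False := by
  obtain ⟨f, v, hfv, eS⟩ := hS
  obtain ⟨f', v', hfv', eS'⟩ := hS'
  obtain ⟨h, w, -, et⟩ := ht
  have val_ne {x y : GL (Fin n) k} (hxy : x ≠ y) : x.val ≠ y.val := fun e => hxy (Units.ext e)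
  have hf : f ⬝ᵥ v = -2 := dotProduct_eq_neg_two hfv (by
    rw [← eS, ← Units.val_mul, hS2, Units.val_one])
  have hf' : f' ⬝ᵥ v' = -2 := dotProduct_eq_neg_two hfv' (by
    rw [← eS', ← Units.val_mul, hS2', Units.val_one])
  have htt : t.val * t.val = 1 := by rw [← Units.val_mul, ht2, Units.val_one]
  have conj {R : GL (Fin n) k} {g x : Fin n → k} (e : R.val = 1 + vecMulVec x g) :
      (t * R * t).val = 1 + vecMulVec (t.val *ᵥ x) (g ᵥ* t.val) := by
    rw [Units.val_mul, Units.val_mul, e, mul_add, add_mul, mul_one, htt, mul_vecMulVec,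
      vecMulVec_mul]
  have dot (g x : Fin n → k) : (g ᵥ* t.val) ⬝ᵥ (t.val *ᵥ x) = g ⬝ᵥ x := by
    rw [← dotProduct_mulVec, mulVec_mulVec, htt, one_mulVec]
  have key {P R : GL (Fin n) k} {g x g' x' : Fin n → k} (eP : P.val = 1 + vecMulVec x g)
      (eR : R.val = 1 + vecMulVec x' g') (hg : g ⬝ᵥ x = -2) (hg' : g' ⬝ᵥ x' = -2)
      (hc : Commute P (t * R * t)) (hn : P ≠ t * R * t) : g ⬝ᵥ (t.val *ᵥ x') = 0 := by
    refine dotProduct_eq_zero_of_commute hg ((dot g' x').trans hg') ?_ ?_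
    · rw [← eP, ← conj eR]
      exact congrArg Units.val hc.eq
    · rw [← eP, ← conj eR]
      exact val_ne hn
  have k1 := key eS eS hf hf h1 n1
  have k2 := key eS eS' hf hf' h2 n2
  have k3 := key eS' eS hf' hf h3 n3
  have k4 := key eS' eS' hf' hf' h4 n4
  rw [et] at k1 k2 k3 k4
  simp only [add_mulVec, one_mulVec, vecMulVec_mulVec, op_smul_eq_smul, dotProduct_add,
    dotProduct_smul, smul_eq_mul] at k1 k2 k3 k4
  rw [hf] at k1
  rw [hf'] at k4
  have ha : h ⬝ᵥ v ≠ 0 := fun h0 => by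
    rw [h0, zero_mul, add_zero] at k1
    norm_num at k1
  have hb' : h ⬝ᵥ v' ≠ 0 := fun h0 => by
    rw [h0, zero_mul, add_zero] at k4
    norm_num at k4
  -- The four equations exhibit the 2 × 2 matrix of pairings of `f, f'` with `v, v'` as having rank
  -- one. Its diagonal entries are -2, so the off-diagonal entries multiply to 4.
  have e1 : (h ⬝ᵥ v) * (f ⬝ᵥ v') = -2 * (h ⬝ᵥ v') := by
    linear_combination (h ⬝ᵥ v) * k2 - (h ⬝ᵥ v') * k1
  have e2 : (h ⬝ᵥ v') * (f' ⬝ᵥ v) = -2 * (h ⬝ᵥ v) := by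
    linear_combination (h ⬝ᵥ v') * k3 - (h ⬝ᵥ v) * k4
  have hpq : (f ⬝ᵥ v') * (f' ⬝ᵥ v) = 4 := by
    refine mul_left_cancel₀ (mul_ne_zero ha hb') ?_
    linear_combination (h ⬝ᵥ v') * (f' ⬝ᵥ v) * e1 - 2 * (h ⬝ᵥ v') * e2
  have h5 := eq_of_braid hf hf' hpq (by
    rw [← eS, ← eS', ← Units.val_mul, ← Units.val_pow_eq_pow_val, hb, Units.val_one])
  rw [← eS, ← eS', ← Units.val_mul] at h5
  have h6 : S * S' = 1 := Units.ext h5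
  exact hne (mul_right_cancel (h6.trans hS2'.symm))

/-- Otherwise all reflections, and with them the whole group, would lie in the kernel. -/
theorem exists_isReflection_map_ne_one {k G M : Type} [Field k] [Group G] [Group M] {n : ℕ}
    {ρ : G →* GL (Fin n) k} (hρ : Subgroup.closure {g : G | IsReflection (ρ g)} = ⊤)
    (χ : G →* M) {x : G} (hx : χ x ≠ 1) : ∃ g, IsReflection (ρ g) ∧ χ g ≠ 1 := by
  by_contra! h
  have : Subgroup.closure {g : G | IsReflection (ρ g)} ≤ χ.ker :=
    (Subgroup.closure_le _).2 fun g hg => h g hg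
  rw [hρ] at this
  exact hx (this (Subgroup.mem_top x))

abbrev CycWreath : Type := Cyc 3 × Wreath (SymGrp 3) 2

def cycWreath (c : Cyc 3) (a b : SymGrp 3) (τ : Equiv.Perm (Fin 2)) : CycWreath :=
  (c, ⟨![a, b], τ⟩)

theorem exists_cycWreath (x : CycWreath) : ∃ c a b,
    x = cycWreath c a b 1 ∨ x = cycWreath c a b (Equiv.swap 0 1) := by
  obtain ⟨c, ⟨f, τ⟩⟩ := x
  have h : ∀ τ : Equiv.Perm (Fin 2), τ = 1 ∨ τ = Equiv.swap 0 1 := by decide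
  have hf : f = ![f 0, f 1] := by funext i; fin_cases i <;> rfl
  refine ⟨c, f 0, f 1, (h τ).imp ?_ ?_⟩
  all_goals
    rintro rfl
    rw [cycWreath, ← hf]

theorem cycWreath_inj {c c' : Cyc 3} {a b a' b' : SymGrp 3} {τ τ' : Equiv.Perm (Fin 2)} :
    cycWreath c a b τ = cycWreath c' a' b' τ' ↔ c = c' ∧ a = a' ∧ b = b' ∧ τ = τ' := by
  constructor
  · intro h
    have h1 := congrArg (fun x => x.2.left) h
    exact ⟨congrArg Prod.fst h, congrFun h1 0, congrFun h1 1, congrArg (fun x => x.2.right) h⟩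
  · rintro ⟨rfl, rfl, rfl, rfl⟩
    rfl

theorem cycWreath_one : (1 : CycWreath) = cycWreath 1 1 1 1 :=
  Prod.ext rfl (SemidirectProduct.ext (by funext i; fin_cases i <;> rfl) rfl)

theorem cycWreath_mul (c c' : Cyc 3) (a b a' b' : SymGrp 3) (τ : Equiv.Perm (Fin 2)) :
    cycWreath c a b 1 * cycWreath c' a' b' τ = cycWreath (c * c') (a * a') (b * b') τ :=
  Prod.ext rfl (SemidirectProduct.ext (by funext i; fin_cases i <;> rfl) (one_mul _))

theorem cycWreath_swap_mul (c c' : Cyc 3) (a b a' b' : SymGrp 3) (τ : Equiv.Perm (Fin 2)) :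
    cycWreath c a b (Equiv.swap 0 1) * cycWreath c' a' b' τ =
      cycWreath (c * c') (a * b') (b * a') (Equiv.swap 0 1 * τ) :=
  Prod.ext rfl (SemidirectProduct.ext (by funext i; fin_cases i <;> rfl) rfl)

/-- Taking the product of the signs over both coordinates makes it insensitive to their interchange.
-/
def signWreath : Wreath (SymGrp 3) 2 →* ℤˣ where
  toFun x := ∏ i, Equiv.Perm.sign (x.left i)
  map_one' := by simp
  map_mul' x y := by
    rw [SemidirectProduct.mul_left]
    simp only [Pi.mul_apply, map_mul, Finset.prod_mul_distrib]
    congr 1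
    exact Equiv.prod_comp (x.right⁻¹) fun i => Equiv.Perm.sign (y.left i)

theorem signWreath_cycWreath (c : Cyc 3) (a b : SymGrp 3) (τ : Equiv.Perm (Fin 2)) :
    signWreath (cycWreath c a b τ).2 = Equiv.Perm.sign a * Equiv.Perm.sign b :=
  Fin.prod_univ_two fun i => Equiv.Perm.sign ((![a, b] : Fin 2 → SymGrp 3) i)

-- The interchange character and the sign character are nontrivial, so each is nontrivial on some
-- reflection. Comparing centralisers of elements and of their powers leaves, up to conjugacy, only
-- the plain interchange and a transposition in one factor, and these cannot all be reflections. The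
-- factor `Cyc 3` is carried along because the claim concerns the whole centraliser.
set_option synthInstance.maxHeartbeats 400000 in
set_option synthInstance.maxSize 1000 in
theorem not_isReflectionGroup_cycWreath : ¬ IsReflectionGroup ℂ CycWreath := by
  rintro ⟨n, -, ρ, hρ, hcl⟩
  have comm {g h : CycWreath} (hg : IsReflection (ρ g)) (j : ℕ) (hj : g ^ j ≠ 1)
      (hc : h * g ^ j = g ^ j * h) : h * g = g * h := by
    refine hρ ?_
    rw [map_mul, map_mul]
    refine hg.commute_of_pow (j := j) ?_ ?_
    · rwa [← map_pow, ← map_one ρ, hρ.ne_iff]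
    · rw [← map_pow, Commute, SemiconjBy, ← map_mul, hc, map_mul]
  have conj {g h : CycWreath} (x : CycWreath) (hg : IsReflection (ρ g)) (e : x * g = h * x) :
      IsReflection (ρ h) := by
    have := hg.conj (ρ x)
    rwa [← map_mul, e, map_mul, mul_inv_cancel_right] at this
  have ht : IsReflection (ρ (cycWreath 1 1 1 (Equiv.swap 0 1))) := by
    obtain ⟨g, hg, hne⟩ := exists_isReflection_map_ne_one hcl
      (SemidirectProduct.rightHom.comp (MonoidHom.snd (Cyc 3) (Wreath (SymGrp 3) 2)))
      (x := cycWreath 1 1 1 (Equiv.swap 0 1)) (by decide)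
    obtain ⟨c, a, b, rfl | rfl⟩ := exists_cycWreath g
    · exact absurd rfl hne
    -- Unless `c = 1` and `b * a = 1`, the square is nontrivial and commutes with some element that
    -- the interchange itself does not commute with. In the exceptional case the element is
    -- conjugate to the plain interchange.
    · have h : ∀ c a b, (c = 1 ∧ b * a = 1) ∨ cycWreath c a b (Equiv.swap 0 1) ^ 2 ≠ 1 ∧
          ∃ x, cycWreath 1 x 1 1 * cycWreath c a b (Equiv.swap 0 1) ^ 2 =
              cycWreath c a b (Equiv.swap 0 1) ^ 2 * cycWreath 1 x 1 1 ∧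
            cycWreath 1 x 1 1 * cycWreath c a b (Equiv.swap 0 1) ≠
              cycWreath c a b (Equiv.swap 0 1) * cycWreath 1 x 1 1 := by
        simp only [cycWreath_one, pow_two, cycWreath_mul, cycWreath_swap_mul, ne_eq,
          Equiv.swap_mul_self, mul_one, one_mul, cycWreath_inj]
        decide +kernel
      rcases h c a b with ⟨rfl, hab⟩ | ⟨h2, x, h3, h4⟩
      · refine conj (cycWreath 1 1 a 1) hg ?_
        rw [cycWreath_mul, cycWreath_swap_mul, cycWreath_inj]
        simpa using mul_eq_one_comm.1 hab
      · exact absurd (comm hg 2 h2 h3) h4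
  have hs : ∃ a : SymGrp 3, Equiv.Perm.sign a ≠ 1 ∧ IsReflection (ρ (cycWreath 1 a 1 1)) := by
    obtain ⟨g, hg, hne⟩ := exists_isReflection_map_ne_one hcl
      (signWreath.comp (MonoidHom.snd (Cyc 3) (Wreath (SymGrp 3) 2)))
      (x := cycWreath 1 (Equiv.swap 0 1) 1 1) (by
        change signWreath (cycWreath 1 (Equiv.swap 0 1) 1 1).2 ≠ 1
        rw [signWreath_cycWreath]
        decide)
    obtain ⟨c, a, b, rfl | rfl⟩ := exists_cycWreath g
    -- An element of nontrivial sign with a component in `Cyc 3`, or with both coordinates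
    -- nontrivial, is excluded by its square or its cube.
    · have h : ∀ c a b, signWreath (cycWreath c a b 1).2 = 1 ∨ (c = 1 ∧ (a = 1 ∨ b = 1)) ∨
          (cycWreath c a b 1 ^ 2 ≠ 1 ∧ ∃ x y,
            cycWreath 1 x y 1 * cycWreath c a b 1 ^ 2 =
              cycWreath c a b 1 ^ 2 * cycWreath 1 x y 1 ∧
            cycWreath 1 x y 1 * cycWreath c a b 1 ≠ cycWreath c a b 1 * cycWreath 1 x y 1) ∨
          (cycWreath c a b 1 ^ 3 ≠ 1 ∧ ∃ x y,
            cycWreath 1 x y 1 * cycWreath c a b 1 ^ 3 =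
              cycWreath c a b 1 ^ 3 * cycWreath 1 x y 1 ∧
            cycWreath 1 x y 1 * cycWreath c a b 1 ≠ cycWreath c a b 1 * cycWreath 1 x y 1) := by
        simp only [signWreath_cycWreath, cycWreath_one, pow_two, pow_three, cycWreath_mul, ne_eq,
          mul_one, one_mul, cycWreath_inj]
        decide +kernel
      rcases h c a b with h | ⟨rfl, rfl | rfl⟩ | ⟨h2, x, y, h3, h4⟩ | ⟨h2, x, y, h3, h4⟩
      · exact absurd h hne
      · refine ⟨b, ?_, ?_⟩
        · change signWreath (cycWreath 1 1 b 1).2 ≠ 1 at hne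
          rwa [signWreath_cycWreath, Equiv.Perm.sign_one, one_mul] at hne
        · refine conj (cycWreath 1 1 1 (Equiv.swap 0 1)) hg ?_
          rw [cycWreath_mul, cycWreath_swap_mul, cycWreath_inj]
          simp
      · refine ⟨a, ?_, hg⟩
        change signWreath (cycWreath 1 a 1 1).2 ≠ 1 at hne
        rwa [signWreath_cycWreath, Equiv.Perm.sign_one, mul_one] at hne
      · exact absurd (comm hg 2 h2 h3) h4
      · exact absurd (comm hg 3 h2 h3) h4
    -- With an interchange, nontrivial sign excludes `b * a = 1`, and the square again gives the
    -- obstruction.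
    · have h : ∀ c a b, signWreath (cycWreath c a b (Equiv.swap 0 1)).2 = 1 ∨
          cycWreath c a b (Equiv.swap 0 1) ^ 2 ≠ 1 ∧
          ∃ x, cycWreath 1 x 1 1 * cycWreath c a b (Equiv.swap 0 1) ^ 2 =
              cycWreath c a b (Equiv.swap 0 1) ^ 2 * cycWreath 1 x 1 1 ∧
            cycWreath 1 x 1 1 * cycWreath c a b (Equiv.swap 0 1) ≠
              cycWreath c a b (Equiv.swap 0 1) * cycWreath 1 x 1 1 := by
        simp only [signWreath_cycWreath, cycWreath_one, pow_two, cycWreath_mul, cycWreath_swap_mul,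
          ne_eq, Equiv.swap_mul_self, mul_one, one_mul, cycWreath_inj]
        decide +kernel
      rcases h c a b with h | ⟨h2, x, h3, h4⟩
      · exact absurd h hne
      · exact absurd (comm hg 2 h2 h3) h4
  obtain ⟨a, ha, hs⟩ := hs
  have hs' (b : SymGrp 3) (hb : Equiv.Perm.sign b ≠ 1) : IsReflection (ρ (cycWreath 1 b 1 1)) := by
    have h : ∀ a b : SymGrp 3, Equiv.Perm.sign a ≠ 1 → Equiv.Perm.sign b ≠ 1 → ∃ x,
        cycWreath 1 x 1 1 * cycWreath 1 a 1 1 = cycWreath 1 b 1 1 * cycWreath 1 x 1 1 := by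
        simp only [cycWreath_mul, ne_eq, mul_one, cycWreath_inj]
        decide +kernel
    obtain ⟨x, hx⟩ := h a b ha hb
    exact conj _ hs hx
  have e {x y : CycWreath} (h : x = y) : ρ x = ρ y := congrArg ρ h
  have ne {x y : CycWreath} (h : x ≠ y) : ρ x ≠ ρ y := hρ.ne h
  have hS := hs' (Equiv.swap 0 1) (by decide)
  have hS' := hs' (Equiv.swap 1 2) (by decide)
  refine not_isReflection_of_swap hS hS' ht ?_ ?_ ?_ (ne ?_) ?_ ?_ ?_ ?_ ?_ ?_ ?_ ?_ ?_
  all_goals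
    simp only [Commute, SemiconjBy, ← map_mul, ← map_one ρ, ne_eq, hρ.eq_iff,
      cycWreath_one, pow_three, cycWreath_mul, cycWreath_swap_mul, Equiv.swap_mul_self, mul_one,
      one_mul, cycWreath_inj] <;> decide

/-! ### Generators of the subgroups -/

theorem isInternalWreathProduct_factors :
    IsInternalWreathProduct 2 (gp {s 0}) (gp {u₂}) (gp {s 0, u₂}) ∧
      IsInternalWreathProduct 2 (gp {s 1, s 2}) (gp {u₁}) (gp {s 1, s 2, u₁}) ∧
      IsInternalWreathProduct 3 (gp {s 0}) (gp {u₁, u₂}) (gp {s 0, u₁, u₂}) ∧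
      IsInternalWreathProduct 2 (gp {s 1}) (gp {u₁}) (gp {s 1, u₁}) ∧
      IsInternalWreathProduct 2 (gp {s 0 * s 6}) (gp {u₂}) (gp {s 0 * s 6, u₂}) := by
  have h := And.intro wreath_s0_u₂ <| And.intro wreath_s1_s2_u₁ <| And.intro wreath_s0_u₁_u₂ <|
    And.intro wreath_s1_u₁ wreath_s0s6_u₂
  simpa only [wordClosure, List.map_cons, List.map_nil, setOf_mem_cons, setOf_mem_nil,
    insert_empty_eq, word_cons, word_nil, mul_one, word_u₁Word, word_u₂Word] using h

theorem wordClosure_D4_S3 :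
    wordClosure [[0], [1], [5], TWord] = gp {s 0, s 1, s 5, T} ∧
      wordClosure [u₁Word, u₂Word] = gp {u₁, u₂} := by
  simp only [wordClosure, List.map_cons, List.map_nil, setOf_mem_cons, setOf_mem_nil,
    insert_empty_eq, word_cons, word_nil, mul_one, word_u₁Word, word_u₂Word, word_TWord, and_self]

/-! ### Transport along conjugation -/

theorem IsInternalDirectProduct.map {G : Type} [Group G] {m : ℕ} {H : Fin m → Subgroup G}
    {Z : Subgroup G} (h : IsInternalDirectProduct H Z) (φ : G ≃* G) :
    IsInternalDirectProduct (fun i => (H i).map (φ : G →* G)) (Z.map (φ : G →* G)) := by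
  obtain ⟨e, he⟩ := h
  refine ⟨((MulEquiv.piCongrRight fun i => φ.subgroupMap (H i)).symm.trans e).trans
    (φ.subgroupMap Z), fun i x => ?_⟩
  obtain ⟨y, rfl⟩ := (φ.subgroupMap (H i)).surjective x
  have : (MulEquiv.piCongrRight fun i => φ.subgroupMap (H i)).symm
      (Pi.mulSingle i (φ.subgroupMap (H i) y)) = Pi.mulSingle i y := by
    rw [MulEquiv.symm_apply_eq]
    funext j
    rcases eq_or_ne j i with rfl | hj
    · simp
    · simp [Pi.mulSingle_eq_of_ne hj]
  rw [MulEquiv.trans_apply, MulEquiv.trans_apply, this]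
  exact congrArg φ (he i y)

theorem map_conj_centralizer {G : Type} [Group G] (g x : G) :
    (Subgroup.centralizer {x}).map (MulAut.conj g : G →* G) =
      Subgroup.centralizer {g * x * g⁻¹} := by
  ext y
  change y ∈ (Subgroup.centralizer {x}).map (MulAut.conj g).toMonoidHom ↔ _
  rw [Subgroup.mem_map_equiv, Subgroup.mem_centralizer_singleton_iff,
    Subgroup.mem_centralizer_singleton_iff, MulAut.conj_symm_apply]
  constructor <;> intro h
  · have := congrArg (fun z => g * z * g⁻¹) h
    simpa [mul_assoc] using this
  · have := congrArg (fun z => g⁻¹ * z * g) h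
    simpa [mul_assoc] using this

theorem nonempty_centralizer_mulEquiv {G : Type} [Group G] {x y : G} (h : IsConj x y) :
    Nonempty (Subgroup.centralizer {x} ≃* Subgroup.centralizer {y}) := by
  obtain ⟨g, rfl⟩ := isConj_iff.1 h
  exact ⟨((MulAut.conj g).subgroupMap _).trans (MulEquiv.subgroupCongr (map_conj_centralizer g x))⟩

theorem isReflectionGroup_centralizer_iff {k G : Type} [Field k] [Group G] {x y : G}
    (h : IsConj x y) : IsReflectionGroup k (Subgroup.centralizer {x}) ↔
      IsReflectionGroup k (Subgroup.centralizer {y}) := by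
  obtain ⟨e⟩ := nonempty_centralizer_mulEquiv h
  exact ⟨fun h => h.of_mulEquiv e, fun h => h.of_mulEquiv e.symm⟩

theorem sq_eq_one_of_isConj {G : Type} [Group G] {x y : G} (h : IsConj x y) (hy : y ^ 2 = 1) :
    x ^ 2 = 1 := by
  obtain ⟨g, rfl⟩ := isConj_iff.1 h
  rw [conj_pow, conj_eq_one_iff] at hy
  exact hy

theorem isReflectionGroup_real_centralizer_iff (w : W) :
    IsReflectionGroup ℝ (Subgroup.centralizer {w}) ↔ w ^ 2 = 1 := by
  constructor
  · intro h
    have := pow_eq_one_of_isReflectionGroup_real h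
      (z := ⟨w, Subgroup.mem_centralizer_singleton_iff.2 rfl⟩)
      fun g => Subtype.ext (Subgroup.mem_centralizer_singleton_iff.1 g.2).symm
    exact congrArg Subtype.val this
  · intro h
    obtain ⟨c, hc⟩ := exists_isConj w
    exact (isReflectionGroup_centralizer_iff hc).1 (isReflectionGroup_centralizer_rep c
      (isReflectionGroup_real_model c (sq_eq_one_of_isConj hc h)))

/-! ### The class `A₂` -/

theorem nonempty_s1_s2_u₁_mulEquiv :
    Nonempty (gp {s 1, s 2, u₁} ≃* Wreath (SymGrp 3) 2) :=
  nonempty_factor_mulEquiv .cA2 ⟨gp {s 1, s 2, u₁}, Wreath (SymGrp 3) 2⟩ (.tail _ (.head _))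

theorem not_isReflectionGroup_centralizer_cA2 :
    ¬ IsReflectionGroup ℂ (Subgroup.centralizer {rep .cA2}) := by
  intro h
  obtain ⟨e, -⟩ := isInternalDirectProduct_factors .cA2
  obtain ⟨f₀⟩ := nonempty_factor_mulEquiv .cA2 ⟨gp {s 0 * s 6}, Cyc 3⟩ (.head _)
  obtain ⟨f₁⟩ := nonempty_s1_s2_u₁_mulEquiv
  let H (i : Fin 2) : Type := ((factors .cA2).get i).sub
  let e' : (∀ i, H i) ≃* H 0 × H 1 :=
    { piFinTwoEquiv H with map_mul' := fun _ _ => rfl }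
  let f : H 0 × H 1 ≃* CycWreath := MulEquiv.prodCongr f₀ f₁
  exact not_isReflectionGroup_cycWreath (h.of_mulEquiv (e.symm.trans (e'.trans f)))

/-- Otherwise the product with a cyclic group of order three, which is the centraliser of `rep
.cA2`, would be a complex reflection group as well. -/
theorem not_isReflectionGroup_wreath_symGrp : ¬ IsReflectionGroup ℂ (Wreath (SymGrp 3) 2) := by
  intro h
  refine not_isReflectionGroup_centralizer_cA2 (isReflectionGroup_centralizer_rep _ ?_)
  simp only [factors, List.mem_cons, List.not_mem_nil, or_false]
  rintro F (rfl | rfl)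
  · exact isReflectionGroup_cyc 3
  · exact h

theorem isReflectionGroup_complex_centralizer_iff (w : W) :
    IsReflectionGroup ℂ (Subgroup.centralizer {w}) ↔ ¬ IsConj (rep .cA2) w := by
  constructor
  · intro h hw
    exact not_isReflectionGroup_centralizer_cA2 ((isReflectionGroup_centralizer_iff hw).2 h)
  · intro h
    obtain ⟨c, hc⟩ := exists_isConj w
    refine (isReflectionGroup_centralizer_iff hc).1 (isReflectionGroup_centralizer_rep c
      (isReflectionGroup_model c ?_))
    rintro rfl
    exact h hc

theorem isReflectionGroup_factor (c : CarterType) :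
    ∀ F ∈ factors c, (c = .cA2 ∧ F.sub = gp {s 1, s 2, u₁}) ∨ IsReflectionGroup ℂ F.sub := by
  intro F hF
  obtain ⟨e⟩ := nonempty_factor_mulEquiv c F hF
  by_cases hc : c = .cA2
  · subst hc
    have h : ∀ F ∈ factors .cA2, F.sub = gp {s 1, s 2, u₁} ∨ IsReflectionGroup ℂ F.Model := by
      have := isReflectionGroup_cyc 3
      simp only [factors, List.mem_cons, List.not_mem_nil, or_false]
      rintro F (rfl | rfl)
      · exact .inr this
      · exact .inl rfl
    exact (h F hF).imp (fun h => ⟨rfl, h⟩) fun h => h.of_mulEquiv e.symm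
  · exact .inr ((isReflectionGroup_model c hc F hF).of_mulEquiv e.symm)

theorem exists_isInternalDirectProduct (w : W) : ∃ (m : ℕ) (H : Fin m → Subgroup W),
    IsInternalDirectProduct H (Subgroup.centralizer {w}) ∧
      ∀ i, IsReflectionGroup ℂ (H i) ∨ IsReflectionGroup (ZMod 3) (H i) := by
  obtain ⟨c, hc⟩ := exists_isConj w
  obtain ⟨g, rfl⟩ := isConj_iff.1 hc
  have h := (isInternalDirectProduct_factors c).map (MulAut.conj g)
  rw [map_conj_centralizer] at h
  refine ⟨_, _, h, fun i => ?_⟩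
  let e := (MulAut.conj g).subgroupMap ((factors c).get i).sub
  rcases isReflectionGroup_factor c _ (List.get_mem _ i) with ⟨-, h⟩ | h
  · refine .inr (IsReflectionGroup.of_mulEquiv ?_ e)
    rw [h]
    exact IsReflectionGroup.of_mulEquiv ⟨3, isReflectionGroup_wreath_symGrp_three⟩
      nonempty_s1_s2_u₁_mulEquiv.some.symm
  · exact .inl (h.of_mulEquiv e)

end E6

theorem theorem7 :
    -- every centraliser is a direct product of reflection groups, over `ℂ` or over `𝔽₃`
    (∀ w : W, ∃ (m : ℕ) (H : Fin m → Subgroup W),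
      IsInternalDirectProduct H (Subgroup.centralizer {w}) ∧
      ∀ i, IsReflectionGroup ℂ (H i) ∨ IsReflectionGroup (ZMod 3) (H i)) ∧
    -- the 25 representatives form a system of representatives of the conjugacy classes
    (∀ w : W, ∃! c : CarterType, IsConj (rep c) w) ∧
    -- generators of the direct factors of each centraliser
    (∀ c : CarterType, IsInternalDirectProduct (fun i => ((factors c).get i).sub)
      (Subgroup.centralizer {rep c})) ∧
    -- isomorphism types of the direct factors
    (∀ c : CarterType, ∀ F ∈ factors c, Nonempty (F.sub ≃* F.Model)) ∧
    -- the factors that are wreath products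
    (IsInternalWreathProduct 2 (gp {s 0}) (gp {u₂}) (gp {s 0, u₂}) ∧
      IsInternalWreathProduct 2 (gp {s 1, s 2}) (gp {u₁}) (gp {s 1, s 2, u₁}) ∧
      IsInternalWreathProduct 3 (gp {s 0}) (gp {u₁, u₂}) (gp {s 0, u₁, u₂}) ∧
      IsInternalWreathProduct 2 (gp {s 1}) (gp {u₁}) (gp {s 1, u₁}) ∧
      IsInternalWreathProduct 2 (gp {s 0 * s 6}) (gp {u₂}) (gp {s 0 * s 6, u₂})) ∧
    -- the class `A₁⁴`: the centraliser as a semidirect product `W(D₄) ⋊ S₃`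
    (IsInternalSemidirectProduct (gp {s 0, s 1, s 5, T}) (gp {u₁, u₂})
        (Subgroup.centralizer {rep .cA1A1A1A1}) ∧
      Nonempty (gp {s 0, s 1, s 5, T} ≃* weylGroup (CartanMatrix.D 4)) ∧
      Nonempty (gp {u₁, u₂} ≃* SymGrp 3)) ∧
    -- the class `E₆[a₂]`: the whole centraliser is `G₅`
    Nonempty (Subgroup.centralizer {rep .cE6a2} ≃* G5) ∧
    -- all factors are complex reflection groups, except the factor `S₃ ≀ C₂` in the class `A₂`
    (∀ c : CarterType, ∀ F ∈ factors c, (c = .cA2 ∧ F.sub = gp {s 1, s 2, u₁}) ∨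
      IsReflectionGroup ℂ F.sub) ∧
    ¬ IsReflectionGroup ℂ (gp {s 1, s 2, u₁}) ∧
    IsReflectionGroupOfRank (ZMod 3) 3 (gp {s 1, s 2, u₁}) ∧
    -- for elements of order 1 or 2 the factors are real reflection groups
    (∀ c : CarterType, rep c ^ 2 = 1 → ∀ F ∈ factors c, IsReflectionGroup ℝ F.sub) ∧
    -- real and complex reflection groups among the centralisers
    (∀ w : W, IsReflectionGroup ℝ (Subgroup.centralizer {w}) ↔ w ^ 2 = 1) ∧
    (∀ w : W, IsReflectionGroup ℂ (Subgroup.centralizer {w}) ↔ ¬ IsConj (rep .cA2) w) := by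
  obtain ⟨e⟩ := nonempty_s1_s2_u₁_mulEquiv
  refine ⟨exists_isInternalDirectProduct, existsUnique_isConj, isInternalDirectProduct_factors,
    nonempty_factor_mulEquiv, isInternalWreathProduct_factors, ⟨?_, ?_, ?_⟩, ?_,
    isReflectionGroup_factor, fun h => not_isReflectionGroup_wreath_symGrp (h.of_mulEquiv e),
    isReflectionGroup_of_mulEquiv e.symm isReflectionGroup_wreath_symGrp_three, ?_,
    isReflectionGroup_real_centralizer_iff, isReflectionGroup_complex_centralizer_iff⟩
  · rw [← wordClosure_D4_S3.1, ← wordClosure_D4_S3.2]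
    exact isInternalSemidirectProduct_D4
  · rw [← wordClosure_D4_S3.1]
    exact wordClosure_D4
  · rw [← wordClosure_D4_S3.2]
    exact ⟨wordClosure_u₁_u₂.choose⟩
  · rw [centralizer_cE6a2]
    exact wordClosure_G5.1
  · intro c hc F hF
    obtain ⟨f⟩ := nonempty_factor_mulEquiv c F hF
    exact (isReflectionGroup_real_model c hc F hF).of_mulEquiv f.symm
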